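/- Let $k$ be a field of characteristic $0$. **Spaces.** All spaces are functors on commutative $k$-algebras $A$ with values in commutative monoids. * $\mathfrak L^+\mathbb A^1(A)=A[[t]]$ and $\mathfrak L_n^+\mathbb A^1(A)=A[[t]]/t^n$, under multiplication; $\mathfrak L^+\mathbb G_m(A)=A[[t]]^\times$ and $\mathfrak L^+_n\mathbb G_m(A)=(A[[t]]/t^n)^\times$, for $n\ge 0$. * $\mathrm{Gr}_{\mathbb G_m}(A)$ is the group of line bundles on $\operatorname{Spec}A[[t]]$ with a trivialization on $\operatorname{Spec}A((t))$, i.e. of invertible $A[[t]]$-submodules $\Lambda\subset A((t))$. It is the sheaf quotient of $\mathfrak L\mathbb G_m\colon A\mapsto A((t))^\times$ by $\mathfrak L^+\mathbb G_m$. * $\mathrm{Gr}^{pos}_{\mathbb G_m}\subset \mathrm{Gr}_{\mathbb G_m}$ is the submonoid of those $\Lambda$ with $1\in\Lambda$ (line bundles with a regular section that trivializes over $\operatorname{Spec}A((t))$). Such a $\Lambda$ has the effective divisor $D_\Lambda=\operatorname{Spec}A[[t]]/\Lambda^{-1}$, which is finite and flat over $\operatorname{Spec} A$. * $\mathrm{Gr}^{\le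 n}_{\mathbb G_m}\subset\mathrm{Gr}_{\mathbb G_m}$ is the sheaf quotient by $\mathfrak L^+\mathbb G_m$ of $\mathfrak L^{\le n}\mathbb G_m(A)=\{g\in A((t))^\times: d\log g\in t^{-n}A[[t]]\,dt\}$ for $n>0$, and $\mathfrak L^{\le 0}\mathbb G_m=\mathfrak L^+\mathbb G_m$. * $\mathrm{Gr}^{pos,\le n}_{\mathbb G_m}=\coprod_{m\ge 0}\operatorname{Sym}^m\mathcal D^{\le n}$, where $\mathcal D^{\le n}=\operatorname{Spec}k[[t]]/t^n$ and $\operatorname{Sym}^m\mathcal D^{\le n}=\operatorname{Spec}\big((k[[t]]/t^n)^{\otimes m}\big)^{S_m}$, with addition of divisors as monoid structure. The divisor of a cycle $\tau_1+\dots+\tau_m$ is $\operatorname{Spec}A[[t]]/\prod_i(t-\tau_i)$. **Pairings.** For an effective divisor $D\subset\operatorname{Spec}A[[t]]$ finite and flat over $\operatorname{Spec} A$ and $f\in A[[t]]$, let $\mathrm{Nm}_D(f)\in A$ be the determinant of multiplication by $f$ on the finite projective $A$-module $\mathcal O(D)$. Then $(\Lambda,f)\mapsto \mathrm{Nm}_{D_\Lambda}(f)$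 is a bi-multiplicative pairing of $\mathrm{Gr}^{pos}_{\mathbb G_m}$ with $\mathfrak L^+\mathbb A^1$. Restricted to $f\in A[[t]]^\times$ it extends uniquely to a bi-multiplicative pairing of $\mathrm{Gr}_{\mathbb G_m}$ with $\mathfrak L^+\mathbb G_m$. For all $n\ge0$ the norm pairing of $\mathrm{Gr}^{pos,\le n}_{\mathbb G_m}$ with $\mathfrak L^+\mathbb A^1$ factors through $\mathfrak L_n^+\mathbb A^1$, and the pairing of $\mathrm{Gr}^{\le n}_{\mathbb G_m}$ with $\mathfrak L^+\mathbb G_m$ factors through $\mathfrak L^+_n\mathbb G_m$. **Distributions.** For each of these four spaces $X$ on the Grassmannian side, the finite $k$-schemes $\operatorname{Spec}A$ over $X$ form a filtered category, and $$\Gamma^{\mathsf{IndCoh}}(X,\omega_X)=\operatorname*{colim}_{\operatorname{Spec} A\to X}A^\vee,\qquad A^\vee=\operatorname{Hom}_k(A,k),$$ the colimit being over all finite $k$-schemes over $X$ (so it is concentrated in degree $0$). It is a commutative algebra under convolution along the monoid structure of $X$. A bi-multiplicative pairing $\pi$ of $X$ with $Y$ induces a map $$c_\pi\colon\Gamma^{\mathsf{IndCoh}}(X,\omega_X)\to\Gamma(Y,\mathcal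 O_Y)$$ sending the class of $\xi\in A^\vee$ at $x\colon\operatorname{Spec}A\to X$ to the function on $Y$ with value $(\xi\otimes\mathrm{id}_B)(\pi(x,y))$ at $y\in Y(B)$, where $\pi(x,y)\in A\otimes_k B$. **Proposition.** For the four pairings above, and for every $n\ge 0$, each of the maps $$\Gamma^{\mathsf{IndCoh}}(\mathrm{Gr}^{pos}_{\mathbb G_m},\omega)\to\Gamma(\mathfrak L^+\mathbb A^1,\mathcal O),\qquad \Gamma^{\mathsf{IndCoh}}(\mathrm{Gr}_{\mathbb G_m},\omega)\to\Gamma(\mathfrak L^+\mathbb G_m,\mathcal O),$$ $$\Gamma^{\mathsf{IndCoh}}(\mathrm{Gr}^{pos,\le n}_{\mathbb G_m},\omega)\to\Gamma(\mathfrak L_n^+\mathbb A^1,\mathcal O),\qquad \Gamma^{\mathsf{IndCoh}}(\mathrm{Gr}^{\le n}_{\mathbb G_m},\omega)\to\Gamma(\mathfrak L_n^+\mathbb G_m,\mathcal O)$$ is an isomorphism of commutative algebras. -/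

import Mathlib

open CategoryTheory TensorProduct PowerSeries LaurentSeries

universe u

namespace LogCC
noncomputable section

/-- A prestack in commutative monoids over `k`: a functor from commutative `k`-algebras to
commutative monoids. All spaces below are classical (ind-schemes ind-finite over `k`, or affine
schemes), so no derived test algebras are needed. -/
abbrev MonoidPrestack (k : Type u) [Field k] := CommAlgCat.{u} k ⥤ CommMonCat.{u}

section IndCoh
variable {k : Type u} [Field k]

/-- The algebra of global functions on `Y`: natural families of maps `Y(A) → A`, with pointwise
operations. -/
def functionAlgebra (Y : MonoidPrestack k) :
    Subalgebra k (∀ A : CommAlgCat.{u} k, Y.obj A → A) where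
  carrier := {F | ∀ (A B : CommAlgCat.{u} k) (f : A ⟶ B) (y : Y.obj A),
    F B (Y.map f y) = f (F A y)}
  mul_mem' := fun {F G} hF hG A B f y => by
    simp only [Set.mem_ofPred_eq] at hF hG
    simp [hF A B f y, hG A B f y]
  add_mem' := fun {F G} hF hG A B f y => by
    simp only [Set.mem_ofPred_eq] at hF hG
    simp [hF A B f y, hG A B f y]
  algebraMap_mem' := fun c A B f y => by
    simp only [Pi.algebraMap_apply]
    exact (f.hom.commutes c).symm

/-- A map `Spec A → X` where `A` is a finite-dimensional `k`-algebra. -/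
structure FinPoint (X : MonoidPrestack k) where
  alg : CommAlgCat.{u} k
  finite : Module.Finite k alg
  pt : X.obj alg

/-- Morphisms of finite schemes over `X`, written on algebras: a morphism `p ⟶ q` is a map
`Spec q.alg → Spec p.alg` over `X`. -/
instance (X : MonoidPrestack k) : Category (FinPoint X) where
  Hom p q := {f : p.alg ⟶ q.alg // X.map f p.pt = q.pt}
  id p := ⟨𝟙 p.alg, by simp⟩
  comp f g := ⟨f.1 ≫ g.1, by simp [f.2, g.2]⟩

/-- The relations presenting the colimit of the dual spaces `p.algᵛ` over the finite schemes
over `X`. A map `Spec q.alg → Spec p.alg` over `X` induces on distributions the push-forward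
`q.algᵛ → p.algᵛ`, which is the transpose of the map of algebras. -/
inductive Relation (X : MonoidPrestack k) :
    ((Σ p : FinPoint X, Module.Dual k p.alg) →₀ k) → Prop
  | add (p : FinPoint X) (ξ η : Module.Dual k p.alg) : Relation X
      (Finsupp.single ⟨p, ξ + η⟩ 1 - Finsupp.single ⟨p, ξ⟩ 1 - Finsupp.single ⟨p, η⟩ 1)
  | smul (p : FinPoint X) (c : k) (ξ : Module.Dual k p.alg) : Relation X
      (Finsupp.single ⟨p, c • ξ⟩ 1 - c • Finsupp.single ⟨p, ξ⟩ 1)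
  | push (p q : FinPoint X) (f : p ⟶ q) (ξ : Module.Dual k q.alg) : Relation X
      (Finsupp.single ⟨p, ξ ∘ₗ f.1.hom.toLinearMap⟩ 1 - Finsupp.single ⟨q, ξ⟩ 1)

/-- The space of distributions `Γ^IndCoh(X, ω_X)` of an ind-finite ind-scheme `X`: the colimit over
all finite schemes `Spec A → X` of `Γ(Spec A, ω) = Aᵛ = Hom_k(A, k)`, with push-forwards as
transition maps. The colimit is presented by generators and relations. When the finite schemes
over `X` form a filtered category (as they do for an ind-finite ind-scheme), this is also the
derived colimit, which is thus concentrated in degree zero. -/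
def GammaIndCoh (X : MonoidPrestack k) : Type (u + 1) :=
  ((Σ p : FinPoint X, Module.Dual k p.alg) →₀ k) ⧸ Submodule.span k {z | Relation X z}

namespace GammaIndCoh
variable (X : MonoidPrestack k)

instance : AddCommGroup (GammaIndCoh X) :=
  inferInstanceAs (AddCommGroup (_ ⧸ Submodule.span k {z | Relation X z}))
instance : Module k (GammaIndCoh X) :=
  inferInstanceAs (Module k (_ ⧸ Submodule.span k {z | Relation X z}))

def mk : ((Σ p : FinPoint X, Module.Dual k p.alg) →₀ k) →ₗ[k] GammaIndCoh X :=
  (Submodule.span k {z | Relation X z}).mkQ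

theorem mk_eq_zero {z : (Σ p : FinPoint X, Module.Dual k p.alg) →₀ k} (h : Relation X z) :
    mk X z = 0 :=
  (Submodule.Quotient.mk_eq_zero _).2 (Submodule.subset_span h)

/-- The insertion `Γ(Spec A, ω) = Aᵛ → Γ^IndCoh(X, ω_X)` at a finite point of `X`. -/
def ι (p : FinPoint X) : Module.Dual k p.alg →ₗ[k] GammaIndCoh X where
  toFun ξ := mk X (Finsupp.single ⟨p, ξ⟩ 1)
  map_add' ξ η := by
    have h := mk_eq_zero X (Relation.add p ξ η)
    rwa [map_sub, map_sub, sub_sub, sub_eq_zero] at h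
  map_smul' c ξ := by
    have h := mk_eq_zero X (Relation.smul p c ξ)
    rwa [map_sub, map_smul, sub_eq_zero] at h

variable {X}

theorem ι_comp {p q : FinPoint X} (f : p ⟶ q) (ξ : Module.Dual k q.alg) :
    ι X p (ξ ∘ₗ f.1.hom.toLinearMap) = ι X q ξ := by
  have h := mk_eq_zero X (Relation.push p q f ξ)
  rwa [map_sub, sub_eq_zero] at h

/-- The universal property of the colimit. -/
def desc {M : Type*} [AddCommGroup M] [Module k M]
    (φ : ∀ p : FinPoint X, Module.Dual k p.alg →ₗ[k] M)
    (hφ : ∀ (p q : FinPoint X) (f : p ⟶ q) (ξ : Module.Dual k q.alg),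
      φ p (ξ ∘ₗ f.1.hom.toLinearMap) = φ q ξ) :
    GammaIndCoh X →ₗ[k] M :=
  (Submodule.span k {z | Relation X z}).liftQ
    (Finsupp.linearCombination k
      (fun z : (Σ p : FinPoint X, Module.Dual k p.alg) => φ z.1 z.2)) (by
    rw [Submodule.span_le]
    intro z hz
    have hz : Relation X z := hz
    cases hz with
    | add p ξ η => simp [Finsupp.linearCombination_single]
    | smul p c ξ => simp [Finsupp.linearCombination_single]
    | push p q f ξ => simp [Finsupp.linearCombination_single, hφ])

@[simp] theorem desc_ι {M : Type*} [AddCommGroup M] [Module k M]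
    (φ : ∀ p : FinPoint X, Module.Dual k p.alg →ₗ[k] M)
    (hφ : ∀ (p q : FinPoint X) (f : p ⟶ q) (ξ : Module.Dual k q.alg),
      φ p (ξ ∘ₗ f.1.hom.toLinearMap) = φ q ξ) (p : FinPoint X) (ξ : Module.Dual k p.alg) :
    desc φ hφ (ι X p ξ) = φ p ξ := by
  refine Eq.trans (Submodule.liftQ_apply _ _ _) ?_
  simp [Finsupp.linearCombination_single]

theorem induction_ι {P : GammaIndCoh X → Prop} (z : GammaIndCoh X)
    (h0 : P 0) (hadd : ∀ a b, P a → P b → P (a + b)) (hι : ∀ p ξ, P (ι X p ξ)) : P z := by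
  obtain ⟨w, rfl⟩ := Submodule.mkQ_surjective _ z
  induction w using Finsupp.induction_linear with
  | zero => rw [map_zero]; exact h0
  | add f g hf hg => rw [map_add]; exact hadd _ _ hf hg
  | single a c =>
    have h := hι a.1 (c • a.2)
    rw [map_smul] at h
    have e : (Finsupp.single a c : (Σ p : FinPoint X, Module.Dual k p.alg) →₀ k)
        = c • Finsupp.single a 1 := by simp
    rw [e, map_smul]
    exact h

theorem hom_ext {M : Type*} [AddCommGroup M] [Module k M] {g h : GammaIndCoh X →ₗ[k] M}
    (H : ∀ p ξ, g (ι X p ξ) = h (ι X p ξ)) : g = h := by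
  refine LinearMap.ext fun z => ?_
  induction z using induction_ι with
  | h0 => simp
  | hadd a b ha hb => simp [ha, hb]
  | hι p ξ => exact H p ξ

end GammaIndCoh

abbrev fst (A B : CommAlgCat.{u} k) : A ⟶ CommAlgCat.of k (A ⊗[k] B) :=
  CommAlgCat.ofHom Algebra.TensorProduct.includeLeft
abbrev snd (A B : CommAlgCat.{u} k) : B ⟶ CommAlgCat.of k (A ⊗[k] B) :=
  CommAlgCat.ofHom Algebra.TensorProduct.includeRight

namespace FinPoint
variable {X : MonoidPrestack k}

/-- The unit point `Spec k → X`. -/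
def one (X : MonoidPrestack k) : FinPoint X :=
  ⟨CommAlgCat.of k k, inferInstanceAs (Module.Finite k k), 1⟩

/-- The product of `Spec A → X` and `Spec B → X` under the monoid structure:
`Spec (A ⊗ B) → X × X → X`. -/
def mul (p q : FinPoint X) : FinPoint X where
  alg := CommAlgCat.of k (p.alg ⊗[k] q.alg)
  finite := by
    have := p.finite
    have := q.finite
    exact inferInstanceAs (Module.Finite k (p.alg ⊗[k] q.alg))
  pt := X.map (fst p.alg q.alg) p.pt * X.map (snd p.alg q.alg) q.pt

theorem map_map {A B C : CommAlgCat.{u} k} (f : A ⟶ B) (g : B ⟶ C) (x : X.obj A) :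
    X.map g (X.map f x) = X.map (f ≫ g) x := by simp

theorem mul_pt_map {A A' B B' : CommAlgCat.{u} k} (f : A ⟶ A') (g : B ⟶ B')
    (x : X.obj A) (y : X.obj B) :
    X.map (CommAlgCat.ofHom (Algebra.TensorProduct.map f.hom g.hom))
      (X.map (fst A B) x * X.map (snd A B) y) =
    X.map (fst A' B') (X.map f x) * X.map (snd A' B') (X.map g y) := by
  rw [map_mul, map_map, map_map, map_map, map_map]
  have h1 : fst A B ≫ CommAlgCat.ofHom (Algebra.TensorProduct.map f.hom g.hom) =
      f ≫ fst A' B' := by ext; simp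
  have h2 : snd A B ≫ CommAlgCat.ofHom (Algebra.TensorProduct.map f.hom g.hom) =
      g ≫ snd A' B' := by ext; simp
  rw [h1, h2]

theorem assoc_pt {A B C : CommAlgCat.{u} k} (x : X.obj A) (y : X.obj B) (z : X.obj C) :
    X.map (CommAlgCat.ofHom (Algebra.TensorProduct.assoc k k k A B C).toAlgHom)
      (X.map (fst (CommAlgCat.of k (A ⊗[k] B)) C) (X.map (fst A B) x * X.map (snd A B) y) *
        X.map (snd (CommAlgCat.of k (A ⊗[k] B)) C) z) =
    X.map (fst A (CommAlgCat.of k (B ⊗[k] C))) x *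
      X.map (snd A (CommAlgCat.of k (B ⊗[k] C))) (X.map (fst B C) y * X.map (snd B C) z) := by
  simp only [map_mul, map_map]
  rw [mul_assoc]
  rfl

theorem comm_pt {A B : CommAlgCat.{u} k} (x : X.obj A) (y : X.obj B) :
    X.map (CommAlgCat.ofHom (Algebra.TensorProduct.comm k A B).toAlgHom)
      (X.map (fst A B) x * X.map (snd A B) y) =
    X.map (fst B A) y * X.map (snd B A) x := by
  rw [map_mul, map_map, map_map, mul_comm]
  rfl

theorem lid_pt {A : CommAlgCat.{u} k} (x : X.obj A) :
    X.map (CommAlgCat.ofHom (Algebra.TensorProduct.lid k A).toAlgHom)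
      (X.map (fst (CommAlgCat.of k k) A) 1 * X.map (snd (CommAlgCat.of k k) A) x) = x := by
  rw [map_mul, map_map, map_map, map_one, one_mul]
  have h : snd (CommAlgCat.of k k) A ≫
      CommAlgCat.ofHom (Algebra.TensorProduct.lid k A).toAlgHom = 𝟙 A := by
    ext; simp
  rw [h]
  simp

def mulMap {p p' q q' : FinPoint X} (f : p ⟶ p') (g : q ⟶ q') : mul p q ⟶ mul p' q' :=
  ⟨CommAlgCat.ofHom (Algebra.TensorProduct.map f.1.hom g.1.hom),
    (mul_pt_map f.1 g.1 p.pt q.pt).trans (by rw [f.2, g.2]; rfl)⟩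

def assocHom (p q r : FinPoint X) : mul (mul p q) r ⟶ mul p (mul q r) :=
  ⟨CommAlgCat.ofHom (Algebra.TensorProduct.assoc k k k p.alg q.alg r.alg).toAlgHom,
    assoc_pt p.pt q.pt r.pt⟩

def commHom (p q : FinPoint X) : mul p q ⟶ mul q p :=
  ⟨CommAlgCat.ofHom (Algebra.TensorProduct.comm k p.alg q.alg).toAlgHom, comm_pt p.pt q.pt⟩

def oneMulHom (p : FinPoint X) : mul (one X) p ⟶ p :=
  ⟨CommAlgCat.ofHom (Algebra.TensorProduct.lid k p.alg).toAlgHom, lid_pt p.pt⟩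

/-- The external product of distributions `Aᵛ ⊗ Bᵛ → (A ⊗ B)ᵛ`. -/
def mulDual (p q : FinPoint X) :
    Module.Dual k p.alg →ₗ[k] Module.Dual k q.alg →ₗ[k] Module.Dual k (mul p q).alg :=
  TensorProduct.curry (TensorProduct.dualDistrib k p.alg q.alg)

def oneDual (X : MonoidPrestack k) : Module.Dual k (one X).alg :=
  (LinearMap.id : k →ₗ[k] k)

end FinPoint

namespace GammaIndCoh
variable {X : MonoidPrestack k}

def mulAux (p : FinPoint X) : Module.Dual k p.alg →ₗ[k] GammaIndCoh X →ₗ[k] GammaIndCoh X where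
  toFun ξ := desc (fun q => ι X (p.mul q) ∘ₗ FinPoint.mulDual p q ξ) (fun q q' g η => by
    have h := ι_comp (FinPoint.mulMap (𝟙 p) g) (FinPoint.mulDual p q' ξ η)
    rw [LinearMap.comp_apply, LinearMap.comp_apply, ← h]
    congr 1
    refine TensorProduct.ext' fun a b => ?_
    rfl)
  map_add' ξ ξ' := hom_ext fun q η => by simp
  map_smul' c ξ := hom_ext fun q η => by simp

/-- The convolution product: the external product of distributions, followed by push-forward
along the multiplication `X × X → X`. -/
def mulLin (X : MonoidPrestack k) : GammaIndCoh X →ₗ[k] GammaIndCoh X →ₗ[k] GammaIndCoh X :=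
  desc mulAux (fun p p' f ξ => hom_ext fun q η => by
    have h := ι_comp (FinPoint.mulMap f (𝟙 q)) (FinPoint.mulDual p' q ξ η)
    simp only [mulAux, LinearMap.coe_mk, AddHom.coe_mk, desc_ι, LinearMap.comp_apply]
    rw [← h]
    congr 1
    refine TensorProduct.ext' fun a b => ?_
    rfl)

instance : Mul (GammaIndCoh X) := ⟨fun a b => mulLin X a b⟩
instance : One (GammaIndCoh X) := ⟨ι X (FinPoint.one X) (FinPoint.oneDual X)⟩

theorem mul_def (a b : GammaIndCoh X) : a * b = mulLin X a b := rfl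
theorem one_def : (1 : GammaIndCoh X) = ι X (FinPoint.one X) (FinPoint.oneDual X) := rfl

theorem ι_mul_ι (p q : FinPoint X) (ξ : Module.Dual k p.alg) (η : Module.Dual k q.alg) :
    ι X p ξ * ι X q η = ι X (p.mul q) (FinPoint.mulDual p q ξ η) := by
  rw [mul_def, mulLin, desc_ι]
  simp [mulAux]

protected theorem mul_comm' (a b : GammaIndCoh X) : a * b = b * a := by
  induction a using induction_ι with
  | h0 => simp [mul_def]
  | hadd a a' h h' => simp only [mul_def, map_add, LinearMap.add_apply] at *; rw [h, h']
  | hι p ξ =>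
    induction b using induction_ι with
    | h0 => simp [mul_def]
    | hadd b b' h h' => simp only [mul_def, map_add, LinearMap.add_apply] at *; rw [h, h']
    | hι q η =>
      rw [ι_mul_ι, ι_mul_ι, ← ι_comp (FinPoint.commHom p q)]
      congr 1
      refine TensorProduct.ext' fun a b => ?_
      exact mul_comm _ _

protected theorem mul_assoc' (a b c : GammaIndCoh X) : a * b * c = a * (b * c) := by
  induction a using induction_ι with
  | h0 => simp [mul_def]
  | hadd a a' h h' => simp only [mul_def, map_add, LinearMap.add_apply] at *; rw [h, h']
  | hι p ξ =>
    induction b using induction_ι with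
    | h0 => simp [mul_def]
    | hadd b b' h h' => simp only [mul_def, map_add, LinearMap.add_apply] at *; rw [h, h']
    | hι q η =>
      induction c using induction_ι with
      | h0 => simp [mul_def]
      | hadd c c' h h' => simp only [mul_def, map_add] at *; rw [h, h']
      | hι r ζ =>
        rw [ι_mul_ι, ι_mul_ι, ι_mul_ι, ι_mul_ι, ← ι_comp (FinPoint.assocHom p q r)]
        congr 1
        refine TensorProduct.ext_threefold fun a b c => ?_
        exact mul_assoc _ _ _

protected theorem one_mul' (a : GammaIndCoh X) : 1 * a = a := by
  induction a using induction_ι with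
  | h0 => simp [mul_def]
  | hadd a a' h h' => simp only [mul_def, map_add] at *; rw [h, h']
  | hι p ξ =>
    rw [one_def, ι_mul_ι, ← ι_comp (FinPoint.oneMulHom p)]
    congr 1
    refine TensorProduct.ext' fun a b => ?_
    exact (ξ.map_smul a b).symm

instance : CommRing (GammaIndCoh X) where
  __ := (inferInstance : AddCommGroup (GammaIndCoh X))
  left_distrib a b c := by simp [mul_def]
  right_distrib a b c := by simp [mul_def]
  zero_mul a := by simp [mul_def]
  mul_zero a := by simp [mul_def]
  mul_assoc := GammaIndCoh.mul_assoc'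
  one_mul := GammaIndCoh.one_mul'
  mul_one a := by rw [GammaIndCoh.mul_comm', GammaIndCoh.one_mul']
  mul_comm := GammaIndCoh.mul_comm'

instance : Algebra k (GammaIndCoh X) :=
  Algebra.ofModule (fun c a b => by simp [mul_def]) (fun c a b => by simp [mul_def])

end GammaIndCoh

/-- A bilinear (bi-multiplicative) pairing `X × Y → 𝔸¹` of commutative monoids, the target being a
monoid under multiplication. If one of the arguments is a group then the values lie in `𝔾_m`. -/
structure Pairing (X Y : MonoidPrestack k) where
  toFun : ∀ A : CommAlgCat.{u} k, X.obj A → Y.obj A → A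
  map_map : ∀ {A B : CommAlgCat.{u} k} (f : A ⟶ B) (x : X.obj A) (y : Y.obj A),
    toFun B (X.map f x) (Y.map f y) = f (toFun A x y)
  one_left : ∀ (A : CommAlgCat.{u} k) (y : Y.obj A), toFun A 1 y = 1
  one_right : ∀ (A : CommAlgCat.{u} k) (x : X.obj A), toFun A x 1 = 1
  mul_left : ∀ (A : CommAlgCat.{u} k) (x x' : X.obj A) (y : Y.obj A),
    toFun A (x * x') y = toFun A x y * toFun A x' y
  mul_right : ∀ (A : CommAlgCat.{u} k) (x : X.obj A) (y y' : Y.obj A),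
    toFun A x (y * y') = toFun A x y * toFun A x y'

namespace Pairing
variable {X Y : MonoidPrestack k} (π : Pairing X Y)

/-- The contraction `ξ ⊗ id : A ⊗ B → B`, for a functional `ξ` on `A`. -/
def contract {A : Type u} [CommRing A] [Algebra k A] (ξ : Module.Dual k A)
    (B : Type u) [CommRing B] [Algebra k B] : A ⊗[k] B →ₗ[k] B :=
  TensorProduct.lift ((LinearMap.lsmul k B).comp ξ)

@[simp] theorem contract_tmul {A : Type u} [CommRing A] [Algebra k A] (ξ : Module.Dual k A)
    (B : Type u) [CommRing B] [Algebra k B] (a : A) (b : B) :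
    contract ξ B (a ⊗ₜ b) = ξ a • b := by simp [contract]

theorem contract_add {A : Type u} [CommRing A] [Algebra k A] (ξ η : Module.Dual k A)
    (B : Type u) [CommRing B] [Algebra k B] (z : A ⊗[k] B) :
    contract (ξ + η) B z = contract ξ B z + contract η B z := by
  induction z using TensorProduct.induction_on with
  | zero => simp
  | add a b ha hb => simp only [map_add, ha, hb]; abel
  | tmul a b => simp [add_smul]

theorem contract_smul {A : Type u} [CommRing A] [Algebra k A] (c : k) (ξ : Module.Dual k A)
    (B : Type u) [CommRing B] [Algebra k B] (z : A ⊗[k] B) :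
    contract (c • ξ) B z = c • contract ξ B z := by
  induction z using TensorProduct.induction_on with
  | zero => simp
  | add a b ha hb => simp only [map_add, ha, hb, smul_add]
  | tmul a b => simp [mul_smul]

theorem contract_map {A A' : Type u} [CommRing A] [Algebra k A] [CommRing A'] [Algebra k A']
    {B B' : Type u} [CommRing B] [Algebra k B] [CommRing B'] [Algebra k B']
    (ξ : Module.Dual k A') (f : A →ₐ[k] A') (g : B →ₐ[k] B') (z : A ⊗[k] B) :
    contract ξ B' (Algebra.TensorProduct.map f g z) =
      g (contract (ξ ∘ₗ f.toLinearMap) B z) := by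
  induction z using TensorProduct.induction_on with
  | zero => simp
  | add a b ha hb => simp only [map_add, ha, hb]
  | tmul a b => simp

/-- The function on `Y` obtained by integrating the pairing against a distribution `ξ` supported on
a finite scheme `x : Spec A → X`: at `y ∈ Y(B)` it takes the value `(ξ ⊗ id_B)(π(x, y))`, where
`π(x, y) ∈ A ⊗ B`. -/
def integrate (p : FinPoint X) (ξ : Module.Dual k p.alg) : functionAlgebra Y :=
  ⟨fun B y => contract ξ B
      (π.toFun (CommAlgCat.of k (p.alg ⊗[k] B)) (X.map (fst p.alg B) p.pt) (Y.map (snd p.alg B) y)),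
    fun B C f y => by
      let F : CommAlgCat.of k (p.alg ⊗[k] B) ⟶ CommAlgCat.of k (p.alg ⊗[k] C) :=
        CommAlgCat.ofHom (Algebra.TensorProduct.map (AlgHom.id k p.alg) f.hom)
      have h1 : X.map (fst p.alg C) p.pt = X.map F (X.map (fst p.alg B) p.pt) := by
        rw [FinPoint.map_map]
        have e : fst p.alg C = fst p.alg B ≫ F := by
          refine CommAlgCat.hom_ext (AlgHom.ext fun a => ?_)
          simp [F]
        rw [e]
      have h2 : Y.map (snd p.alg C) (Y.map f y) = Y.map F (Y.map (snd p.alg B) y) := by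
        rw [FinPoint.map_map, FinPoint.map_map]; congr 3
      dsimp only
      rw [h1, h2, π.map_map]
      generalize π.toFun (CommAlgCat.of k (p.alg ⊗[k] B)) _ _ = z
      exact contract_map ξ (AlgHom.id k p.alg) f.hom z⟩

/-- The map `Γ^IndCoh(X, ω_X) → Γ(Y, O_Y)` attached to a pairing: the pull-back of the coordinate
of `𝔸¹` is a function on `X × Y`, and a distribution on `X` is integrated against it along `X`. -/
def comparison : GammaIndCoh X →ₗ[k] functionAlgebra Y :=
  GammaIndCoh.desc
    (fun p =>
      { toFun := π.integrate p
        map_add' := fun ξ η => Subtype.ext <| funext fun B => funext fun y =>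
          contract_add ξ η B _
        map_smul' := fun c ξ => Subtype.ext <| funext fun B => funext fun y =>
          contract_smul c ξ B _ })
    (fun p q f ξ => Subtype.ext <| funext fun B => funext fun y => by
      let F : CommAlgCat.of k (p.alg ⊗[k] B) ⟶ CommAlgCat.of k (q.alg ⊗[k] B) :=
        CommAlgCat.ofHom (Algebra.TensorProduct.map f.1.hom (AlgHom.id k B))
      have h1 : X.map (fst q.alg B) q.pt = X.map F (X.map (fst p.alg B) p.pt) := by
        rw [← f.2, FinPoint.map_map, FinPoint.map_map]
        have e : f.1 ≫ fst q.alg B = fst p.alg B ≫ F := by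
          refine CommAlgCat.hom_ext (AlgHom.ext fun a => ?_)
          simp [F]
        rw [e]
      have h2 : Y.map (snd q.alg B) y = Y.map F (Y.map (snd p.alg B) y) := by
        rw [FinPoint.map_map]
        have e : snd q.alg B = snd p.alg B ≫ F := by
          refine CommAlgCat.hom_ext (AlgHom.ext fun a => ?_)
          simp [F]
        rw [e]
      change contract (ξ ∘ₗ f.1.hom.toLinearMap) B
          (π.toFun (CommAlgCat.of k (p.alg ⊗[k] B)) _ _) =
        contract ξ B (π.toFun (CommAlgCat.of k (q.alg ⊗[k] B)) _ _)
      rw [h1, h2, π.map_map]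
      generalize π.toFun (CommAlgCat.of k (p.alg ⊗[k] B)) _ _ = z
      exact (contract_map ξ f.1.hom (AlgHom.id k B) z).symm)

end Pairing

end IndCoh

section Laurent
variable {A B C : Type u} [CommRing A] [CommRing B] [CommRing C]

/-- Functoriality of Laurent series in the coefficients. -/
def mapLaurent (f : A →+* B) : A⸨X⸩ →+* B⸨X⸩ where
  toFun x := HahnSeries.map x f
  map_zero' := by ext; simp
  map_one' := by
    ext n
    by_cases h : n = 0 <;> simp [HahnSeries.coeff_one, h]
  map_add' x y := by ext; simp
  map_mul' x y := HahnSeries.map_mul f.toNonUnitalRingHom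

@[simp] theorem mapLaurent_coeff (f : A →+* B) (x : A⸨X⸩) (n : ℤ) :
    (mapLaurent f x).coeff n = f (x.coeff n) := rfl

theorem mapLaurent_id (x : A⸨X⸩) : mapLaurent (RingHom.id A) x = x := by ext; simp

theorem mapLaurent_comp (f : A →+* B) (g : B →+* C) (x : A⸨X⸩) :
    mapLaurent (g.comp f) x = mapLaurent g (mapLaurent f x) := by ext; simp

theorem mapLaurent_coe (f : A →+* B) (x : A⟦X⟧) :
    mapLaurent f (algebraMap A⟦X⟧ A⸨X⸩ x) = algebraMap B⟦X⟧ B⸨X⸩ (PowerSeries.map f x) := by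
  ext n
  simp only [mapLaurent_coeff, LaurentSeries.coe_algebraMap]
  rw [PowerSeries.coeff_coe, PowerSeries.coeff_coe]
  split_ifs <;> simp

theorem mapLaurent_smul (f : A →+* B) (a : A⟦X⟧) (x : A⸨X⸩) :
    mapLaurent f (a • x) = PowerSeries.map f a • mapLaurent f x := by
  rw [Algebra.smul_def, Algebra.smul_def, map_mul, mapLaurent_coe]

/-- Base change `Λ ↦ B⟦t⟧ ⊗ Λ` of lattices along `A → B`, as the `B⟦t⟧`-submodule of `B⸨t⸩`
generated by the image of `Λ`. For an invertible `Λ` this is the pull-back of the line bundle. -/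
def baseChange (f : A →+* B) : Submodule A⟦X⟧ A⸨X⸩ →* Submodule B⟦X⟧ B⸨X⸩ where
  toFun Λ := Submodule.span B⟦X⟧ (mapLaurent f '' Λ)
  map_one' := by
    rw [Submodule.one_eq_span, Submodule.one_eq_span]
    refine le_antisymm (Submodule.span_le.2 ?_) (Submodule.span_le.2 ?_)
    · rintro _ ⟨x, hx, rfl⟩
      obtain ⟨a, rfl⟩ := Submodule.mem_span_singleton.1 hx
      rw [mapLaurent_smul, map_one]
      exact Submodule.smul_mem _ _ (Submodule.mem_span_singleton_self 1)
    · rintro _ rfl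
      exact Submodule.subset_span ⟨1, Submodule.mem_span_singleton_self 1, map_one _⟩
  map_mul' Λ Λ' := by
    rw [Submodule.span_mul_span]
    refine le_antisymm (Submodule.span_le.2 ?_) (Submodule.span_le.2 ?_)
    · rintro _ ⟨x, hx, rfl⟩
      refine Submodule.mul_induction_on hx (fun a ha b hb => ?_) (fun a b ha hb => ?_)
      · rw [map_mul]
        exact Submodule.subset_span (Set.mul_mem_mul ⟨a, ha, rfl⟩ ⟨b, hb, rfl⟩)
      · rw [map_add]
        exact Submodule.add_mem _ ha hb
    · rintro _ ⟨_, ⟨a, ha, rfl⟩, _, ⟨b, hb, rfl⟩, rfl⟩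
      exact Submodule.subset_span ⟨a * b, Submodule.mul_mem_mul ha hb, map_mul _ _ _⟩

theorem mem_baseChange (f : A →+* B) {Λ : Submodule A⟦X⟧ A⸨X⸩} {x : A⸨X⸩} (hx : x ∈ Λ) :
    mapLaurent f x ∈ baseChange f Λ :=
  Submodule.subset_span ⟨x, hx, rfl⟩

theorem baseChange_id (Λ : Submodule A⟦X⟧ A⸨X⸩) : baseChange (RingHom.id A) Λ = Λ := by
  refine le_antisymm (Submodule.span_le.2 ?_) (fun x hx => ?_)
  · rintro _ ⟨x, hx, rfl⟩
    rwa [mapLaurent_id]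
  · have := mem_baseChange (RingHom.id A) hx
    rwa [mapLaurent_id] at this

theorem baseChange_comp (f : A →+* B) (g : B →+* C) (Λ : Submodule A⟦X⟧ A⸨X⸩) :
    baseChange (g.comp f) Λ = baseChange g (baseChange f Λ) := by
  refine le_antisymm (Submodule.span_le.2 ?_) (Submodule.span_le.2 ?_)
  · rintro _ ⟨x, hx, rfl⟩
    rw [mapLaurent_comp]
    exact mem_baseChange g (mem_baseChange f hx)
  · rintro _ ⟨y, hy, rfl⟩
    refine Submodule.span_induction (p := fun y _ => mapLaurent g y ∈ baseChange (g.comp f) Λ)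
      ?_ ?_ ?_ ?_ hy
    · rintro _ ⟨x, hx, rfl⟩
      rw [← mapLaurent_comp]
      exact mem_baseChange _ hx
    · simp
    · intro a b _ _ ha hb
      rw [map_add]
      exact Submodule.add_mem _ ha hb
    · intro a b _ hb
      rw [mapLaurent_smul]
      exact Submodule.smul_mem _ _ hb

/-- The derivation `t d/dt` of Laurent series. -/
def euler (x : A⸨X⸩) : A⸨X⸩ where
  coeff n := (n : A) * x.coeff n
  isPWO_support' := x.isPWO_support.mono fun n hn h => hn (by simp [h])

theorem euler_mul (x y : A⸨X⸩) : euler (x * y) = euler x * y + x * euler y := by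
  ext n
  have hx : (euler x).support ⊆ x.support := fun n hn h => hn (by simp [euler, h])
  have hy : (euler y).support ⊆ y.support := fun n hn h => hn (by simp [euler, h])
  rw [HahnSeries.coeff_add, HahnSeries.coeff_mul_left' x.isPWO_support hx,
    HahnSeries.coeff_mul_right' y.isPWO_support hy, ← Finset.sum_add_distrib]
  change (n : A) * (x * y).coeff n = _
  rw [HahnSeries.coeff_mul, Finset.mul_sum]
  refine Finset.sum_congr rfl fun ij hij => ?_
  have h : ij.1 + ij.2 = n := (Finset.mem_antidiagonal.1 hij).2.2
  simp only [euler, ← h]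
  push_cast
  ring

theorem derivative_eq (x : A⸨X⸩) :
    LaurentSeries.derivative A x = HahnSeries.single (-1) 1 * euler x := by
  ext n
  rw [HahnSeries.coeff_single_mul]
  simp [euler]

theorem derivative_mul (x y : A⸨X⸩) : LaurentSeries.derivative A (x * y) =
    LaurentSeries.derivative A x * y + x * LaurentSeries.derivative A y := by
  simp only [derivative_eq, euler_mul]
  ring

theorem derivative_coe (x : A⟦X⟧) :
    LaurentSeries.derivative A (algebraMap A⟦X⟧ A⸨X⸩ x) =
      algebraMap A⟦X⟧ A⸨X⸩ (PowerSeries.derivative A x) := by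
  ext n
  simp only [LaurentSeries.derivative_apply, LaurentSeries.hasseDeriv_coeff,
    LaurentSeries.coe_algebraMap]
  rw [PowerSeries.coeff_coe, PowerSeries.coeff_coe, PowerSeries.coeff_derivative]
  rcases lt_trichotomy n (-1) with h | h | h
  · rw [if_pos (by omega), if_pos (by omega)]; simp
  · subst h; simp
  · obtain ⟨m, rfl⟩ := Int.eq_ofNat_of_zero_le (show 0 ≤ n by omega)
    rw [if_neg (by omega), if_neg (by omega)]
    have e : ((m : ℤ) + (1 : ℕ)).natAbs = m + 1 := by omega
    rw [e]
    simp [mul_comm]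

theorem derivative_smul (a : A⟦X⟧) (x : A⸨X⸩) : LaurentSeries.derivative A (a • x) =
    PowerSeries.derivative A a • x + a • LaurentSeries.derivative A x := by
  simp only [Algebra.smul_def, derivative_mul, derivative_coe]

theorem mapLaurent_derivative (f : A →+* B) (x : A⸨X⸩) :
    mapLaurent f (LaurentSeries.derivative A x) =
      LaurentSeries.derivative B (mapLaurent f x) := by
  ext n
  simp

end Laurent

/-- The `A`-points of `Gr^pos`. Those `Λ` that contain `1`: line bundles on the disc with a regular
section (the section `1`) that trivializes on the punctured disc. -/
def grPos (A : Type u) [CommRing A] : Submonoid (Submodule A⟦X⟧ A⸨X⸩)ˣ where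
  carrier := {Λ | (1 : A⸨X⸩) ∈ (Λ : Submodule A⟦X⟧ A⸨X⸩)}
  one_mem' := Submodule.mem_one.2 ⟨1, map_one _⟩
  mul_mem' := fun {Λ Λ'} h h' => by
    have h1 := Submodule.mul_mem_mul h h'
    rwa [one_mul] at h1

/-- The `A`-points of `Gr^{≤n}`, the quotient (as a sheaf) of
`𝔏^{≤n}𝔾_m = {g : dlog g ∈ t^{-n} A⟦t⟧ dt}` (which is `𝔏⁺𝔾_m` by convention if `n = 0`) by `𝔏⁺𝔾_m`.
Locally on `A`, one has `Λ = g A⟦t⟧` with `g ∈ A⸨t⸩ˣ`, and `dlog g ∈ t^{-n} A⟦t⟧ dt` says exactly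
that `t ^ n d/dt` preserves `Λ`; if `n = 0` then `Λ` has to be the trivial lattice. -/
def grLe (n : ℕ) (A : Type u) [CommRing A] : Submonoid (Submodule A⟦X⟧ A⸨X⸩)ˣ where
  carrier := {Λ | (n = 0 → Λ = 1) ∧ ∀ x ∈ (Λ : Submodule A⟦X⟧ A⸨X⸩),
    (X ^ n : A⟦X⟧) • LaurentSeries.derivative A x ∈ (Λ : Submodule A⟦X⟧ A⸨X⸩)}
  one_mem' := ⟨fun _ => rfl, by
    intro x hx
    rw [Units.val_one, Submodule.mem_one] at hx ⊢
    obtain ⟨a, rfl⟩ := hx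
    exact ⟨X ^ n * PowerSeries.derivative A a, by
      rw [derivative_coe, Algebra.smul_def, map_mul]⟩⟩
  mul_mem' := fun {Λ Λ'} h h' => ⟨fun hn => by rw [h.1 hn, h'.1 hn, one_mul], by
    intro x hx
    rw [Units.val_mul] at hx ⊢
    refine Submodule.mul_induction_on hx (fun a ha b hb => ?_) (fun a b ha hb => ?_)
    · rw [derivative_mul, smul_add, ← smul_mul_assoc, ← mul_smul_comm]
      exact Submodule.add_mem _ (Submodule.mul_mem_mul (h.2 a ha) hb)
        (Submodule.mul_mem_mul ha (h'.2 b hb))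
    · rw [map_add, smul_add]
      exact Submodule.add_mem _ ha hb⟩

theorem grPos_map {A B : Type u} [CommRing A] [CommRing B] (f : A →+* B)
    {Λ : (Submodule A⟦X⟧ A⸨X⸩)ˣ} (h : Λ ∈ grPos A) :
    Units.map (baseChange f) Λ ∈ grPos B := by
  have h1 := mem_baseChange f h
  rwa [map_one] at h1

theorem grLe_map (n : ℕ) {A B : Type u} [CommRing A] [CommRing B] (f : A →+* B)
    {Λ : (Submodule A⟦X⟧ A⸨X⸩)ˣ} (h : Λ ∈ grLe n A) :
    Units.map (baseChange f) Λ ∈ grLe n B := by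
  refine ⟨fun hn => by rw [h.1 hn, map_one], fun x hx => ?_⟩
  have hx : x ∈ baseChange f Λ := hx
  change _ ∈ baseChange f Λ
  refine Submodule.span_induction (p := fun x _ => (X ^ n : B⟦X⟧) • LaurentSeries.derivative B x ∈
    baseChange f Λ) ?_ ?_ ?_ ?_ hx
  · rintro _ ⟨y, hy, rfl⟩
    have := mem_baseChange f (h.2 y hy)
    rwa [mapLaurent_smul, mapLaurent_derivative, map_pow, PowerSeries.map_X] at this
  · simp
  · intro a b _ _ ha hb
    rw [map_add, smul_add]
    exact Submodule.add_mem _ ha hb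
  · intro a b hb hab
    rw [derivative_smul, smul_add, smul_smul, smul_comm]
    exact Submodule.add_mem _ (Submodule.smul_mem _ _ hb) (Submodule.smul_mem _ _ hab)

section Spaces
variable (k : Type u) [Field k]

/-- The affine Grassmannian of `𝔾_m`: an `A`-point is a line bundle on the formal disc `Spec A⟦t⟧`
with a trivialization on the punctured disc `Spec A⸨t⸩`, that is, an invertible
`A⟦t⟧`-submodule `Λ` of `A⸨t⸩` (a unit of the monoid of submodules). Tensor product is the product
of submodules. Locally on `A` one has `Λ = g A⟦t⟧`, so this is the sheaf quotient of `𝔏𝔾_m` by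
`𝔏⁺𝔾_m`. The Abel-Jacobi point of a nilpotent `τ` is `O(τ) = (t - τ)⁻¹ A⟦t⟧`. -/
def Gr : MonoidPrestack k where
  obj A := CommMonCat.of (Submodule A⟦X⟧ A⸨X⸩)ˣ
  map f := CommMonCat.ofHom (Units.map (baseChange f.hom.toRingHom))
  map_id _ := CommMonCat.ext fun _ => Units.ext (baseChange_id _)
  map_comp _ _ := CommMonCat.ext fun _ => Units.ext (baseChange_comp _ _ _)

/-- The space `Gr^pos` of effective divisors on the formal disc, a submonoid of `Gr`. -/
def GrPos : MonoidPrestack k where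
  obj A := CommMonCat.of (grPos A)
  map {A B} f := CommMonCat.ofHom
    (((Units.map (baseChange f.hom.toRingHom)).comp (grPos A).subtype).codRestrict (grPos B)
      (fun Λ => grPos_map _ Λ.2))
  map_id _ := CommMonCat.ext fun _ => Subtype.ext (Units.ext (baseChange_id _))
  map_comp _ _ := CommMonCat.ext fun _ => Subtype.ext (Units.ext (baseChange_comp _ _ _))

/-- The subgroup `Gr^{≤n}` of `Gr`. -/
def GrLe (n : ℕ) : MonoidPrestack k where
  obj A := CommMonCat.of (grLe n A)
  map {A B} f := CommMonCat.ofHom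
    (((Units.map (baseChange f.hom.toRingHom)).comp (grLe n A).subtype).codRestrict (grLe n B)
      (fun Λ => grLe_map n _ Λ.2))
  map_id _ := CommMonCat.ext fun _ => Subtype.ext (Units.ext (baseChange_id _))
  map_comp _ _ := CommMonCat.ext fun _ => Subtype.ext (Units.ext (baseChange_comp _ _ _))

/-- `𝔏⁺𝔸¹`, the scheme `A ↦ A⟦t⟧`, as a monoid under multiplication. -/
def LPlusA1 : MonoidPrestack k where
  obj A := CommMonCat.of A⟦X⟧
  map f := CommMonCat.ofHom (PowerSeries.map f.hom.toRingHom).toMonoidHom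
  map_id _ := CommMonCat.ext fun _ => rfl
  map_comp _ _ := CommMonCat.ext fun _ => rfl

/-- `𝔏⁺𝔾_m`, the group scheme `A ↦ A⟦t⟧ˣ`. -/
def LPlusGm : MonoidPrestack k where
  obj A := CommMonCat.of A⟦X⟧ˣ
  map f := CommMonCat.ofHom (Units.map (PowerSeries.map f.hom.toRingHom).toMonoidHom)
  map_id _ := CommMonCat.ext fun _ => Units.ext rfl
  map_comp _ _ := CommMonCat.ext fun _ => Units.ext rfl

/-- `A⟦t⟧ / t ^ n`. -/
abbrev Trunc (n : ℕ) (A : Type u) [CommRing A] : Type u := A⟦X⟧ ⧸ Ideal.span {(X ^ n : A⟦X⟧)}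

def truncMap (n : ℕ) {A B : Type u} [CommRing A] [CommRing B] (f : A →+* B) :
    Trunc n A →+* Trunc n B :=
  Ideal.quotientMap _ (PowerSeries.map f) (Ideal.span_le.2 (by
    rintro _ rfl
    change PowerSeries.map f (X ^ n) ∈ Ideal.span {(X ^ n : B⟦X⟧)}
    rw [map_pow, PowerSeries.map_X]
    exact Ideal.mem_span_singleton_self _))

theorem truncMap_id (n : ℕ) {A : Type u} [CommRing A] (x : Trunc n A) :
    truncMap n (RingHom.id A) x = x := by
  obtain ⟨a, rfl⟩ := Ideal.Quotient.mk_surjective x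
  rfl

theorem truncMap_comp (n : ℕ) {A B C : Type u} [CommRing A] [CommRing B] [CommRing C]
    (f : A →+* B) (g : B →+* C) (x : Trunc n A) :
    truncMap n (g.comp f) x = truncMap n g (truncMap n f x) := by
  obtain ⟨a, rfl⟩ := Ideal.Quotient.mk_surjective x
  rfl

/-- `𝔏_n⁺𝔸¹`, the scheme `A ↦ A⟦t⟧ / t ^ n`, as a monoid under multiplication. -/
def LnA1 (n : ℕ) : MonoidPrestack k where
  obj A := CommMonCat.of (Trunc n A)
  map f := CommMonCat.ofHom (truncMap n f.hom.toRingHom).toMonoidHom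
  map_id _ := CommMonCat.ext fun x => truncMap_id n x
  map_comp _ _ := CommMonCat.ext fun x => truncMap_comp n _ _ x

/-- `𝔏_n⁺𝔾_m`, the group scheme `A ↦ (A⟦t⟧ / t ^ n)ˣ`. -/
def LnGm (n : ℕ) : MonoidPrestack k where
  obj A := CommMonCat.of (Trunc n A)ˣ
  map f := CommMonCat.ofHom (Units.map (truncMap n f.hom.toRingHom).toMonoidHom)
  map_id _ := CommMonCat.ext fun _ => Units.ext (truncMap_id n _)
  map_comp _ _ := CommMonCat.ext fun _ => Units.ext (truncMap_comp n _ _ _)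

end Spaces

open Classical in
/-- The determinant of an endomorphism `g` of a finitely generated projective module `M`: present
`M` as a direct summand of a free module and extend `g` by the identity of the complement. The
result does not depend on the presentation (see `projDet_eq`). Junk value `1` if `M` is not
finitely generated and projective. -/
def projDet {A M : Type u} [CommRing A] [AddCommGroup M] [Module A M] (g : M →ₗ[A] M) : A :=
  if h : ∃ (m : ℕ) (i : M →ₗ[A] (Fin m → A)) (p : (Fin m → A) →ₗ[A] M), p ∘ₗ i = LinearMap.id then
    LinearMap.det (LinearMap.id +
      h.choose_spec.choose ∘ₗ (g - LinearMap.id) ∘ₗ h.choose_spec.choose_spec.choose)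
  else 1

theorem det_id_add_comp_comm {A : Type u} [CommRing A] {m n : ℕ}
    (x : (Fin m → A) →ₗ[A] (Fin n → A)) (y : (Fin n → A) →ₗ[A] (Fin m → A)) :
    LinearMap.det (LinearMap.id + x ∘ₗ y) = LinearMap.det (LinearMap.id + y ∘ₗ x) := by
  rw [← LinearMap.det_toMatrix', ← LinearMap.det_toMatrix', map_add, map_add,
    LinearMap.toMatrix'_comp, LinearMap.toMatrix'_comp, LinearMap.toMatrix'_id,
    LinearMap.toMatrix'_id, Matrix.det_one_add_mul_comm]

theorem projDet_eq {A M : Type u} [CommRing A] [AddCommGroup M] [Module A M] (g : M →ₗ[A] M)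
    (m : ℕ) (i : M →ₗ[A] (Fin m → A)) (p : (Fin m → A) →ₗ[A] M) (h : p ∘ₗ i = LinearMap.id) :
    projDet g = LinearMap.det (LinearMap.id + i ∘ₗ (g - LinearMap.id) ∘ₗ p) := by
  have h' : ∃ (m : ℕ) (i : M →ₗ[A] (Fin m → A)) (p : (Fin m → A) →ₗ[A] M),
    p ∘ₗ i = LinearMap.id := ⟨m, i, p, h⟩
  rw [projDet, dif_pos h']
  have key : ∀ (m' : ℕ) (i' : M →ₗ[A] (Fin m' → A)) (p' : (Fin m' → A) →ₗ[A] M),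
      p' ∘ₗ i' = LinearMap.id → LinearMap.det (LinearMap.id + i' ∘ₗ (g - LinearMap.id) ∘ₗ p') =
        LinearMap.det (LinearMap.id + i ∘ₗ (g - LinearMap.id) ∘ₗ p) := fun m' i' p' hh => by
    have e1 : i' ∘ₗ (g - LinearMap.id) ∘ₗ p' =
        (i' ∘ₗ p) ∘ₗ (i ∘ₗ (g - LinearMap.id) ∘ₗ p') := LinearMap.ext fun v =>
      congrArg i' (LinearMap.congr_fun h ((g - LinearMap.id : M →ₗ[A] M) (p' v))).symm
    have e2 : i ∘ₗ (g - LinearMap.id) ∘ₗ p =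
        (i ∘ₗ (g - LinearMap.id) ∘ₗ p') ∘ₗ (i' ∘ₗ p) := LinearMap.ext fun v =>
      congrArg (fun w => i ((g - LinearMap.id : M →ₗ[A] M) w)) (LinearMap.congr_fun hh (p v)).symm
    rw [e1, e2, det_id_add_comp_comm]
  exact key _ _ _ h'.choose_spec.choose_spec.choose_spec

/-- The norm `Nm_D(f)` of a function `f` along the divisor `D = Spec (A⟦t⟧ / I)`, finite and flat
over `Spec A`: the determinant of multiplication by `f` on `A⟦t⟧ / I` over `A`. -/
def divisorNorm {A : Type u} [CommRing A] (I : Ideal A⟦X⟧) (f : A⟦X⟧) : A :=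
  projDet (LinearMap.mulLeft A (Ideal.Quotient.mk I f))

/-- The ideal of the effective divisor of `Λ ∈ Gr^pos(A)`. As `1 ∈ Λ`, the inverse `Λ⁻¹` lies in
`A⟦t⟧`, and it is the ideal of the zeros of the section `1` of the line bundle `Λ`. -/
def latticeDivisor {A : Type u} [CommRing A] (Λ : grPos A) : Ideal A⟦X⟧ :=
  Submodule.comap (Algebra.linearMap A⟦X⟧ A⸨X⸩) ((Λ.1⁻¹ : (Submodule A⟦X⟧ A⸨X⸩)ˣ) :
    Submodule A⟦X⟧ A⸨X⸩)

section Tensor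
variable (k : Type u) [Field k] (R : Type u) [CommRing R] [Algebra k R]

/-- The `m`-fold tensor power `R^{⊗m}` of a `k`-algebra. -/
def TPow (m : ℕ) : Type u := ⨂[k] (_ : Fin m), R

namespace TPow
variable (m : ℕ)

instance : CommRing (TPow k R m) := inferInstanceAs (CommRing (⨂[k] (_ : Fin m), R))
instance : Algebra k (TPow k R m) := inferInstanceAs (Algebra k (⨂[k] (_ : Fin m), R))

/-- Pure tensors. -/
def tmk : MultilinearMap k (fun _ : Fin m => R) (TPow k R m) := PiTensorProduct.tprod k

variable {k R m}

theorem tmk_mul (r s : Fin m → R) : tmk k R m r * tmk k R m s = tmk k R m (r * s) :=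
  PiTensorProduct.tprod_mul_tprod r s

theorem tmk_one : tmk k R m 1 = 1 := rfl

theorem induction {P : TPow k R m → Prop} (x : TPow k R m)
    (hr : ∀ (c : k) (r : Fin m → R), P (c • tmk k R m r))
    (ha : ∀ x y, P x → P y → P (x + y)) : P x :=
  PiTensorProduct.induction_on (motive := P) x hr ha

def liftLin {E : Type u} [AddCommGroup E] [Module k E]
    (f : MultilinearMap k (fun _ : Fin m => R) E) : TPow k R m →ₗ[k] E :=
  PiTensorProduct.lift f

@[simp] theorem liftLin_tmk {E : Type u} [AddCommGroup E] [Module k E]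
    (f : MultilinearMap k (fun _ : Fin m => R) E) (r : Fin m → R) :
    liftLin f (tmk k R m r) = f r :=
  PiTensorProduct.lift.tprod r

def liftAlg {S : Type u} [CommRing S] [Algebra k S]
    (f : MultilinearMap k (fun _ : Fin m => R) S) (one : f 1 = 1)
    (mul : ∀ r s, f (r * s) = f r * f s) : TPow k R m →ₐ[k] S :=
  AlgHom.ofLinearMap (liftLin f) (by rw [← tmk_one, liftLin_tmk, one]) (fun x y => by
    induction x using induction with
    | ha a b ha hb => simp only [add_mul, map_add, ha, hb]
    | hr c r =>
      induction y using induction with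
      | ha a b ha hb => simp only [mul_add, map_add, ha, hb]
      | hr d s =>
        simp only [smul_mul_smul_comm, map_smul, tmk_mul, liftLin_tmk, mul])

@[simp] theorem liftAlg_tmk {S : Type u} [CommRing S] [Algebra k S]
    (f : MultilinearMap k (fun _ : Fin m => R) S) (one : f 1 = 1)
    (mul : ∀ r s, f (r * s) = f r * f s) (r : Fin m → R) :
    liftAlg f one mul (tmk k R m r) = f r := liftLin_tmk f r

variable (k R) in
/-- The action of permutations on `R^{⊗m}`. -/
def perm (σ : Equiv.Perm (Fin m)) : TPow k R m →ₐ[k] TPow k R m :=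
  liftAlg ((tmk k R m).domDomCongr σ) tmk_one (fun _ _ => (tmk_mul _ _).symm)

@[simp] theorem perm_tmk (σ : Equiv.Perm (Fin m)) (r : Fin m → R) :
    perm k R σ (tmk k R m r) = tmk k R m (fun i => r (σ i)) := liftAlg_tmk _ _ _ _

theorem perm_perm (σ τ : Equiv.Perm (Fin m)) (x : TPow k R m) :
    perm k R σ (perm k R τ x) = perm k R (τ * σ) x := by
  induction x using induction with
  | ha a b ha hb => simp only [map_add, ha, hb]
  | hr c r => simp only [map_smul, perm_tmk]; rfl

end TPow

open TPow

/-- The invariants `(R^{⊗m})^{S_m}`, the functions on `Sym^m (Spec R)`. -/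
def SymT (m : ℕ) : Subalgebra k (TPow k R m) where
  carrier := {x | ∀ σ : Equiv.Perm (Fin m), perm k R σ x = x}
  mul_mem' := fun hx hy σ => by rw [map_mul, hx σ, hy σ]
  add_mem' := fun hx hy σ => by rw [map_add, hx σ, hy σ]
  algebraMap_mem' := fun c σ => AlgHom.commutes _ c

namespace SymT

/-- The invariant tensor `r ⊗ ⋯ ⊗ r`. -/
def pow (m : ℕ) (r : R) : SymT k R m :=
  ⟨tmk k R m fun _ => r, fun σ => perm_tmk σ _⟩

theorem pow_one (m : ℕ) : pow k R m 1 = 1 := rfl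
theorem pow_mul (m : ℕ) (r s : R) : pow k R m (r * s) = pow k R m r * pow k R m s :=
  Subtype.ext (tmk_mul _ _).symm

/-- The averaging projection `R^{⊗m} → (R^{⊗m})^{S_m}` (in characteristic zero). -/
def avg (m : ℕ) : TPow k R m →ₗ[k] SymT k R m where
  toFun x := ⟨((m.factorial : k)⁻¹) • ∑ σ : Equiv.Perm (Fin m), perm k R σ x, fun τ => by
    simp only [map_smul, map_sum, perm_perm]
    congr 1
    exact Fintype.sum_equiv (Equiv.mulRight τ) _ _ fun σ => rfl⟩
  map_add' x y := Subtype.ext (by simp [Finset.sum_add_distrib])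
  map_smul' c x := Subtype.ext (by simp [Finset.smul_sum, smul_comm c])

theorem avg_coe (m : ℕ) (x : TPow k R m) : (avg k R m x : TPow k R m) =
    ((m.factorial : k)⁻¹) • ∑ σ : Equiv.Perm (Fin m), perm k R σ x := rfl

theorem avg_mul (m : ℕ) (s : SymT k R m) (x : TPow k R m) :
    avg k R m (s * x) = s * avg k R m x := by
  apply Subtype.ext
  rw [Subalgebra.coe_mul, avg_coe, avg_coe, mul_smul_comm, Finset.mul_sum]
  congr 1
  refine Finset.sum_congr rfl fun σ _ => ?_
  rw [map_mul, s.2 σ]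

theorem avg_of_mem [CharZero k] (m : ℕ) (s : SymT k R m) : avg k R m s = s := by
  apply Subtype.ext
  rw [avg_coe, Finset.sum_congr rfl fun σ _ => s.2 σ]
  simp [Fintype.card_perm, ← Nat.cast_smul_eq_nsmul k, smul_smul, Nat.factorial_ne_zero]

end SymT

variable {k R}

def splitMul (m m' : ℕ) : MultilinearMap k (fun _ : Fin (m + m') => R)
    (TPow k R m ⊗[k] TPow k R m') :=
  ((tmk k R m).domCoprod (tmk k R m')).domDomCongr finSumFinEquiv

theorem splitMul_apply (m m' : ℕ) (r : Fin (m + m') → R) :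
    splitMul (k := k) m m' r = tmk k R m (fun i => r (Fin.castAdd m' i)) ⊗ₜ
        tmk k R m' (fun i => r (Fin.natAdd m i)) := by
  simp [splitMul]

variable (k R) in
/-- The isomorphism `R^{⊗(m + m')} → R^{⊗m} ⊗ R^{⊗m'}`. -/
def split (m m' : ℕ) : TPow k R (m + m') →ₐ[k] TPow k R m ⊗[k] TPow k R m' :=
  liftAlg (splitMul m m') (by rw [splitMul_apply]; rfl) (fun r s => by
    simp only [splitMul_apply, Algebra.TensorProduct.tmul_mul_tmul, tmk_mul]
    rfl)

theorem split_tmk (m m' : ℕ) (r : Fin (m + m') → R) :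
    split k R m m' (tmk k R (m + m') r) = tmk k R m (fun i => r (Fin.castAdd m' i)) ⊗ₜ
        tmk k R m' (fun i => r (Fin.natAdd m i)) := by
  rw [split, liftAlg_tmk, splitMul_apply]

def sumPerm {m m' : ℕ} (σ : Equiv.Perm (Fin m)) (τ : Equiv.Perm (Fin m')) :
    Equiv.Perm (Fin (m + m')) :=
  finSumFinEquiv.permCongr (Equiv.sumCongr σ τ)

theorem split_perm {m m' : ℕ} (σ : Equiv.Perm (Fin m)) (τ : Equiv.Perm (Fin m'))
    (x : TPow k R (m + m')) :
    split k R m m' (perm k R (sumPerm σ τ) x) =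
      Algebra.TensorProduct.map (perm k R σ) (perm k R τ) (split k R m m' x) := by
  induction x using induction with
  | ha a b ha hb => simp only [map_add, ha, hb]
  | hr c r =>
    simp only [map_smul, perm_tmk, split_tmk, Algebra.TensorProduct.map_tmul]
    congr 3 <;> funext i <;> simp [sumPerm]


variable (k R) in
theorem SymT.span_pow [CharZero k] (m : ℕ) :
    Submodule.span k (Set.range (SymT.pow k R m)) = ⊤ := by
  rw [eq_top_iff]
  rintro s -
  rw [← SymT.avg_of_mem k R m s]
  induction (s : TPow k R m) using TPow.induction with
  | ha a b ha hb => rw [map_add]; exact Submodule.add_mem _ ha hb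
  | hr c r =>
    rw [map_smul]
    refine Submodule.smul_mem _ _ ?_
    have key : (∑ σ : Equiv.Perm (Fin m), tmk k R m (fun i => r (σ i))) =
        ∑ T : Finset (Fin m), ((-1 : ℤ) ^ T.card) • tmk k R m (fun _ => ∑ i ∈ Tᶜ, r i) := by
      have h1 : ∀ T : Finset (Fin m), tmk k R m (fun _ => ∑ i ∈ Tᶜ, r i) =
          ∑ f : Fin m → Fin m, if T ⊆ (Finset.univ.image f)ᶜ then
            tmk k R m (fun i => r (f i)) else 0 := fun T => by
        rw [MultilinearMap.map_sum_finset (tmk k R m) (fun _ => r) (fun _ => Tᶜ),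
          ← Finset.sum_filter]
        refine Finset.sum_congr ?_ fun _ _ => rfl
        ext f
        simp only [Fintype.mem_piFinset, Finset.mem_compl, Finset.mem_filter, Finset.mem_univ,
          true_and, Finset.subset_iff, Finset.mem_image, not_exists]
        exact ⟨fun h x hx i hi => h i (hi ▸ hx), fun h i hi => h hi i rfl⟩
      simp_rw [h1, Finset.smul_sum, smul_ite, smul_zero]
      rw [Finset.sum_comm]
      have h2 : ∀ f : Fin m → Fin m, (∑ T : Finset (Fin m), if T ⊆ (Finset.univ.image f)ᶜ then
          ((-1 : ℤ) ^ T.card) • tmk k R m (fun i => r (f i)) else 0) =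
          if Function.Bijective f then tmk k R m (fun i => r (f i)) else 0 := fun f => by
        have e : (Finset.univ.filter fun T : Finset (Fin m) => T ⊆ (Finset.univ.image f)ᶜ) =
            ((Finset.univ.image f)ᶜ).powerset := by ext; simp
        rw [← Finset.sum_filter, e, ← Finset.sum_smul, Finset.sum_powerset_neg_one_pow_card]
        have e2 : ((Finset.univ.image f)ᶜ = ∅) ↔ Function.Bijective f := by
          rw [Finset.compl_eq_empty_iff, ← Finite.surjective_iff_bijective, Finset.eq_univ_iff_forall]
          simp [Function.Surjective]
        by_cases hf : Function.Bijective f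
        · rw [if_pos hf, if_pos (e2.2 hf), one_smul]
        · rw [if_neg hf, if_neg (fun h => hf (e2.1 h)), zero_smul]
      simp_rw [h2]
      rw [← Finset.sum_filter]
      refine Finset.sum_bij (fun σ _ => (σ : Fin m → Fin m)) ?_ ?_ ?_ ?_
      · intro σ _; exact Finset.mem_filter.2 ⟨Finset.mem_univ _, σ.bijective⟩
      · intro σ _ τ _ h; exact Equiv.coe_fn_injective h
      · intro f hf
        exact ⟨Equiv.ofBijective f (Finset.mem_filter.1 hf).2, Finset.mem_univ _, rfl⟩
      · intro σ _; rfl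
    have e : SymT.avg k R m (tmk k R m r) = ((m.factorial : k)⁻¹) •
        ∑ T : Finset (Fin m), ((-1 : ℤ) ^ T.card) • SymT.pow k R m (∑ i ∈ Tᶜ, r i) := by
      apply Subtype.ext
      rw [SymT.avg_coe]
      simp only [perm_tmk, key]
      simp [SymT.pow]
    rw [e]
    refine Submodule.smul_mem _ _ (Submodule.sum_mem _ fun T _ => ?_)
    exact zsmul_mem (Submodule.subset_span (Set.mem_range_self (f := SymT.pow k R m) (∑ i ∈ Tᶜ, r i))) _

theorem eq_zero_of_sum_pow_smul [CharZero k] {B : Type u} [AddCommGroup B] [Module k B]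
    (N : ℕ) (v : ℕ → B) (h : ∀ c : k, ∑ m ∈ Finset.range N, c ^ m • v m = 0) :
    ∀ m < N, v m = 0 := by
  intro m hm
  rw [← Module.forall_dual_apply_eq_zero_iff k]
  intro ℓ
  have hp : (∑ j ∈ Finset.range N, Polynomial.monomial j (ℓ (v j))) = 0 := by
    refine Polynomial.funext fun c => ?_
    rw [Polynomial.eval_finsetSum, Polynomial.eval_zero]
    have := congrArg ℓ (h c)
    rw [map_sum, map_zero] at this
    rw [← this]
    refine Finset.sum_congr rfl fun j _ => ?_
    rw [Polynomial.eval_monomial, map_smul, smul_eq_mul, mul_comm]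
  have := congrArg (fun p => Polynomial.coeff p m) hp
  simpa [Polynomial.finsetSum_coeff, Polynomial.coeff_monomial, hm] using this

variable (k R) in
/-- The functions `∏_m (R^{⊗m})^{S_m}` on the coproduct of all `Sym^m (Spec R)`. -/
def SymAll : Type u := ∀ m : ℕ, SymT k R m

instance : CommRing (SymAll k R) := inferInstanceAs (CommRing (∀ m : ℕ, SymT k R m))
instance : Algebra k (SymAll k R) := inferInstanceAs (Algebra k (∀ m : ℕ, SymT k R m))

namespace SymAll

variable (k R) in
/-- The function on the coproduct of all `Sym^m (Spec R)` which is `r ⊗ ⋯ ⊗ r` on `Sym^m`. -/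
def pow (r : R) : SymAll k R := fun m => SymT.pow k R m r

variable (k R) in
def single (m : ℕ) : SymT k R m →ₗ[k] SymAll k R := LinearMap.single k (fun m => SymT k R m) m

theorem single_mul_single (m : ℕ) (x y : SymT k R m) :
    single k R m x * single k R m y = single k R m (x * y) := by
  funext j
  change Pi.single (M := fun m => SymT k R m) m x j * Pi.single (M := fun m => SymT k R m) m y j =
    Pi.single (M := fun m => SymT k R m) m (x * y) j
  by_cases hj : j = m
  · subst hj
    simp only [Pi.single_eq_same]
  · rw [Pi.single_eq_of_ne hj, Pi.single_eq_of_ne hj, Pi.single_eq_of_ne hj, zero_mul]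

theorem single_mul_single_of_ne {m m' : ℕ} (h : m ≠ m') (x : SymT k R m) (y : SymT k R m') :
    single k R m x * single k R m' y = 0 := by
  funext j
  change Pi.single (M := fun m => SymT k R m) m x j * Pi.single (M := fun m => SymT k R m) m' y j = 0
  by_cases hj : j = m
  · subst hj
    rw [Pi.single_eq_of_ne h, mul_zero]
  · rw [Pi.single_eq_of_ne hj, zero_mul]

theorem sum_single_apply (N : ℕ) (x : SymAll k R) (m : ℕ) (hm : m < N) :
    (∑ j ∈ Finset.range N, single k R j (x j)) m = x m := by
  change (∑ j ∈ Finset.range N, (Pi.single j (x j) : ∀ m, SymT k R m)) m = x m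
  rw [Finset.sum_apply, Finset.sum_eq_single m]
  · simp
  · intro j _ hj
    rw [Pi.single_eq_of_ne hj.symm]
  · intro h
    exact absurd (Finset.mem_range.2 hm) h

end SymAll

variable (k R) in
/-- The `B`-points of the coproduct over `m ≥ 0` of the schemes `Sym^m (Spec R)`. A map from
`Spec B` to the coproduct meets only finitely many components, so it is a map of algebras
`∏_m (R^{⊗m})^{S_m} → B` that factors through finitely many of the factors. -/
def SymPoint (B : Type u) [CommRing B] [Algebra k B] : Type u :=
  {φ : SymAll k R →ₐ[k] B // ∃ N : ℕ, ∀ x : SymAll k R, (∀ m < N, x m = 0) → φ x = 0}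

namespace SymPoint
variable {B : Type u} [CommRing B] [Algebra k B]

/-- A number of components that suffices for `φ`. -/
def bound (φ : SymPoint k R B) : ℕ := φ.2.choose

theorem apply_eq_sum (φ : SymPoint k R B) {N : ℕ} (hN : φ.bound ≤ N) (x : SymAll k R) :
    φ.1 x = ∑ m ∈ Finset.range N, φ.1 (SymAll.single k R m (x m)) := by
  rw [← map_sum, ← sub_eq_zero, ← map_sub]
  refine φ.2.choose_spec _ fun m hm => ?_
  change x m - _ = 0
  rw [SymAll.sum_single_apply N x m (lt_of_lt_of_le hm hN), sub_self]

theorem ext_pow [CharZero k] {φ ψ : SymPoint k R B}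
    (h : ∀ r, φ.1 (SymAll.pow k R r) = ψ.1 (SymAll.pow k R r)) : φ = ψ := by
  have h1 : ∀ m < max φ.bound ψ.bound, ∀ r, φ.1 (SymAll.single k R m (SymT.pow k R m r)) -
      ψ.1 (SymAll.single k R m (SymT.pow k R m r)) = 0 := fun m hm r => by
    refine eq_zero_of_sum_pow_smul (k := k) (max φ.bound ψ.bound)
      (fun m => φ.1 (SymAll.single k R m (SymT.pow k R m r)) -
      ψ.1 (SymAll.single k R m (SymT.pow k R m r))) (fun c => ?_) m hm
    have hc := sub_eq_zero.2 (h (c • r))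
    rw [apply_eq_sum φ (le_max_left _ ψ.bound), apply_eq_sum ψ (le_max_right φ.bound _),
      ← Finset.sum_sub_distrib] at hc
    refine Eq.trans (Finset.sum_congr rfl fun j _ => ?_) hc
    have e : SymAll.pow k R (c • r) j = c ^ j • SymT.pow k R j r := Subtype.ext (by
      change tmk k R j (fun _ => c • r) = c ^ j • tmk k R j (fun _ => r)
      rw [MultilinearMap.map_smul_univ (tmk k R j) (fun _ => c) (fun _ => r)]
      simp)
    rw [e, map_smul, map_smul, map_smul, smul_sub]
  have h2 : ∀ m < max φ.bound ψ.bound, ∀ s, φ.1 (SymAll.single k R m s) =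
      ψ.1 (SymAll.single k R m s) := fun m hm s => by
    have hs : s ∈ Submodule.span k (Set.range (SymT.pow k R m)) := by
      rw [SymT.span_pow]; trivial
    induction hs using Submodule.span_induction with
    | mem x hx => obtain ⟨r, rfl⟩ := hx; exact sub_eq_zero.1 (h1 m hm r)
    | zero => simp
    | add x y _ _ hx hy => simp only [map_add, hx, hy]
    | smul c x _ hx => simp only [map_smul, hx]
  refine Subtype.ext (AlgHom.ext fun x => ?_)
  rw [apply_eq_sum φ (le_max_left _ ψ.bound), apply_eq_sum ψ (le_max_right φ.bound _)]
  exact Finset.sum_congr rfl fun m hm => h2 m (Finset.mem_range.1 hm) _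

/-- The component of `φ` on `Sym^m`, extended to `R^{⊗m}` by averaging. -/
def comp (φ : SymPoint k R B) (m : ℕ) : TPow k R m →ₗ[k] B :=
  φ.1.toLinearMap ∘ₗ SymAll.single k R m ∘ₗ SymT.avg k R m

theorem comp_coe [CharZero k] (φ : SymPoint k R B) (m : ℕ) (s : SymT k R m) :
    φ.comp m s = φ.1 (SymAll.single k R m s) := by
  simp [comp, SymT.avg_of_mem]

theorem comp_mul [CharZero k] (φ : SymPoint k R B) (m : ℕ) (s : SymT k R m) (x : TPow k R m) :
    φ.comp m (s * x) = φ.comp m s * φ.comp m x := by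
  rw [comp_coe]
  simp only [comp, LinearMap.comp_apply, SymT.avg_mul, AlgHom.toLinearMap_apply]
  rw [← map_mul, SymAll.single_mul_single]

theorem comp_mul_comp_of_ne (φ : SymPoint k R B) {m m' : ℕ} (h : m ≠ m') (x : TPow k R m)
    (y : TPow k R m') : φ.comp m x * φ.comp m' y = 0 := by
  simp only [comp, LinearMap.comp_apply, AlgHom.toLinearMap_apply]
  rw [← map_mul, SymAll.single_mul_single_of_ne h, map_zero]

/-- The component of `(φ, ψ)` on `Sym^m × Sym^m'`, extended to `R^{⊗m} ⊗ R^{⊗m'}` by averaging. -/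
def comp₂ (φ ψ : SymPoint k R B) (m m' : ℕ) : TPow k R m ⊗[k] TPow k R m' →ₗ[k] B :=
  TensorProduct.lift ((LinearMap.mul k B).compl₁₂ (φ.comp m) (ψ.comp m'))

@[simp] theorem comp₂_tmul (φ ψ : SymPoint k R B) (m m' : ℕ) (x : TPow k R m) (y : TPow k R m') :
    comp₂ φ ψ m m' (x ⊗ₜ y) = φ.comp m x * ψ.comp m' y := by simp [comp₂]

variable (k R) in
def avg₂ (m m' : ℕ) : TPow k R m ⊗[k] TPow k R m' →ₗ[k] TPow k R m ⊗[k] TPow k R m' :=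
  TensorProduct.map ((SymT k R m).val.toLinearMap ∘ₗ SymT.avg k R m)
    ((SymT k R m').val.toLinearMap ∘ₗ SymT.avg k R m')

theorem avg₂_split [CharZero k] (m m' : ℕ) (s : SymT k R (m + m')) :
    avg₂ k R m m' (split k R m m' s) = split k R m m' s := by
  have h : ∀ z : TPow k R m ⊗[k] TPow k R m', avg₂ k R m m' z =
      ((m.factorial : k)⁻¹ * (m'.factorial : k)⁻¹) •
        ∑ σ : Equiv.Perm (Fin m), ∑ τ : Equiv.Perm (Fin m'),
          Algebra.TensorProduct.map (perm k R σ) (perm k R τ) z := fun z => by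
    induction z using TensorProduct.induction_on with
    | zero => simp
    | add a b ha hb => simp only [map_add, ha, hb, Finset.sum_add_distrib, smul_add]
    | tmul a b =>
      simp only [avg₂, TensorProduct.map_tmul, LinearMap.comp_apply, AlgHom.toLinearMap_apply,
        Subalgebra.coe_val, SymT.avg_coe, Algebra.TensorProduct.map_tmul]
      rw [TensorProduct.smul_tmul_smul, TensorProduct.sum_tmul]
      simp only [TensorProduct.tmul_sum]
  rw [h]
  simp only [← split_perm, s.2 _, Finset.sum_const, Finset.card_univ, Fintype.card_perm,
    Fintype.card_fin]
  rw [← Nat.cast_smul_eq_nsmul k, ← Nat.cast_smul_eq_nsmul k, smul_smul, smul_smul]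
  have h1 : (m.factorial : k) ≠ 0 := by exact_mod_cast Nat.factorial_ne_zero m
  have h2 : (m'.factorial : k) ≠ 0 := by exact_mod_cast Nat.factorial_ne_zero m'
  convert one_smul k _ using 2
  field_simp

theorem comp₂_avg₂_mul [CharZero k] (φ ψ : SymPoint k R B) (m m' : ℕ)
    (u v : TPow k R m ⊗[k] TPow k R m') :
    comp₂ φ ψ m m' (avg₂ k R m m' u * v) =
      comp₂ φ ψ m m' (avg₂ k R m m' u) * comp₂ φ ψ m m' v := by
  induction u using TensorProduct.induction_on with
  | zero => simp
  | add a b ha hb => simp only [map_add, add_mul, ha, hb]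
  | tmul a b =>
    induction v using TensorProduct.induction_on with
    | zero => simp
    | add a b ha hb => simp only [map_add, mul_add, ha, hb]
    | tmul c d =>
      simp only [avg₂, TensorProduct.map_tmul, LinearMap.comp_apply, AlgHom.toLinearMap_apply,
        Subalgebra.coe_val, Algebra.TensorProduct.tmul_mul_tmul, comp₂_tmul, comp_mul]
      ring

theorem comp₂_mul_comp₂_of_ne (φ ψ : SymPoint k R B) {m m' p p' : ℕ} (h : (m, m') ≠ (p, p'))
    (u : TPow k R m ⊗[k] TPow k R m') (v : TPow k R p ⊗[k] TPow k R p') :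
    comp₂ φ ψ m m' u * comp₂ φ ψ p p' v = 0 := by
  induction u using TensorProduct.induction_on with
  | zero => simp
  | add a b ha hb => simp only [map_add, add_mul, ha, hb, add_zero]
  | tmul a b =>
    induction v using TensorProduct.induction_on with
    | zero => simp
    | add a b ha hb => simp only [map_add, mul_add, ha, hb, add_zero]
    | tmul c d =>
      rw [comp₂_tmul, comp₂_tmul, mul_mul_mul_comm]
      by_cases hm : m = p
      · have hm' : m' ≠ p' := fun h' => h (by rw [hm, h'])
        rw [comp_mul_comp_of_ne ψ hm', mul_zero]
      · rw [comp_mul_comp_of_ne φ hm, zero_mul]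

/-- The underlying linear map of `sum`. -/
def sumLin (φ ψ : SymPoint k R B) : SymAll k R →ₗ[k] B where
  toFun x := ∑ p ∈ Finset.range φ.bound ×ˢ Finset.range ψ.bound,
    comp₂ φ ψ p.1 p.2 (split k R p.1 p.2 (x (p.1 + p.2)))
  map_add' x y := by
    rw [← Finset.sum_add_distrib]
    refine Finset.sum_congr rfl fun p _ => ?_
    rw [← map_add, ← map_add]
    rfl
  map_smul' c x := by
    rw [Finset.smul_sum]
    refine Finset.sum_congr rfl fun p _ => ?_
    rw [← map_smul, ← map_smul]
    rfl

theorem sumLin_pow [CharZero k] (φ ψ : SymPoint k R B) (r : R) :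
    sumLin φ ψ (SymAll.pow k R r) = φ.1 (SymAll.pow k R r) * ψ.1 (SymAll.pow k R r) := by
  rw [apply_eq_sum φ le_rfl, apply_eq_sum ψ le_rfl, Finset.sum_mul_sum, ← Finset.sum_product']
  refine Finset.sum_congr rfl fun p _ => ?_
  change comp₂ φ ψ p.1 p.2 (split k R p.1 p.2 (tmk k R (p.1 + p.2) fun _ => r)) = _
  rw [split_tmk, comp₂_tmul]
  exact congrArg₂ (· * ·) (comp_coe φ p.1 (SymT.pow k R p.1 r)) (comp_coe ψ p.2 (SymT.pow k R p.2 r))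

theorem pow_one : SymAll.pow k R 1 = 1 := rfl

/-- The sum of effective cycles: the composite of `(φ, ψ)` with the maps
`Sym^m × Sym^m' → Sym^{m + m'}`, which are dual to the inclusions
`(R^{⊗(m + m')})^{S_{m + m'}} ⊆ (R^{⊗m})^{S_m} ⊗ (R^{⊗m'})^{S_m'}`. -/
def sum [CharZero k] (φ ψ : SymPoint k R B) : SymPoint k R B :=
  ⟨AlgHom.ofLinearMap (sumLin φ ψ)
    (by rw [← pow_one, sumLin_pow, pow_one, map_one, map_one, one_mul])
    (fun x y => by
      change (∑ p ∈ _, _) = (∑ p ∈ _, _) * (∑ q ∈ _, _)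
      rw [Finset.sum_mul_sum]
      refine Finset.sum_congr rfl fun p hp => ?_
      rw [Finset.sum_eq_single p]
      · have e : (x * y) (p.1 + p.2) = x (p.1 + p.2) * y (p.1 + p.2) := rfl
        rw [e, Subalgebra.coe_mul, map_mul, ← avg₂_split p.1 p.2 (x (p.1 + p.2)),
          comp₂_avg₂_mul]
      · intro q _ hq
        exact comp₂_mul_comp₂_of_ne φ ψ hq.symm _ _
      · intro h
        exact absurd hp h),
    φ.bound + ψ.bound, fun x hx => by
      change (∑ p ∈ _, _) = _
      refine Finset.sum_eq_zero fun p hp => ?_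
      rw [Finset.mem_product, Finset.mem_range, Finset.mem_range] at hp
      rw [hx _ (by omega)]
      simp⟩

theorem sum_pow [CharZero k] (φ ψ : SymPoint k R B) (r : R) :
    (sum φ ψ).1 (SymAll.pow k R r) = φ.1 (SymAll.pow k R r) * ψ.1 (SymAll.pow k R r) :=
  sumLin_pow φ ψ r

variable (k R) in
def aug : TPow k R 0 →ₐ[k] k :=
  liftAlg (MultilinearMap.constOfIsEmpty k (fun _ : Fin 0 => R) (1 : k)) rfl
    (fun _ _ => (mul_one _).symm)

theorem aug_tmk (r : Fin 0 → R) : aug k R (tmk k R 0 r) = 1 := liftAlg_tmk _ _ _ _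

variable (k R B) in
/-- The empty cycle, the point of `Sym^0`. -/
def zero : SymPoint k R B :=
  ⟨((Algebra.ofId k B).comp (aug k R)).comp
    ((SymT k R 0).val.comp (Pi.evalAlgHom k (fun m => SymT k R m) 0)), 1, fun x hx => by
      change (Algebra.ofId k B) (aug k R ((x 0 : SymT k R 0) : TPow k R 0)) = 0
      rw [hx 0 one_pos]
      simp⟩

theorem zero_pow (r : R) : (zero k R B).1 (SymAll.pow k R r) = 1 := by
  change (Algebra.ofId k B) (aug k R (tmk k R 0 fun _ => r)) = 1
  rw [aug_tmk, map_one]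

/-- The monoid structure is addition of cycles. -/
instance [CharZero k] : CommMonoid (SymPoint k R B) where
  mul := sum
  one := zero k R B
  mul_assoc a b c := ext_pow fun r => by
    change (sum (sum a b) c).1 _ = (sum a (sum b c)).1 _
    simp only [sum_pow, mul_assoc]
  one_mul a := ext_pow fun r => by
    change (sum (zero k R B) a).1 _ = _
    rw [sum_pow, zero_pow, one_mul]
  mul_one a := ext_pow fun r => by
    change (sum a (zero k R B)).1 _ = _
    rw [sum_pow, zero_pow, mul_one]
  mul_comm a b := ext_pow fun r => by
    change (sum a b).1 _ = (sum b a).1 _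
    rw [sum_pow, sum_pow, mul_comm]

theorem mul_pow' [CharZero k] (φ ψ : SymPoint k R B) (r : R) :
    (φ * ψ).1 (SymAll.pow k R r) = φ.1 (SymAll.pow k R r) * ψ.1 (SymAll.pow k R r) :=
  sum_pow φ ψ r

theorem one_pow' [CharZero k] (r : R) : (1 : SymPoint k R B).1 (SymAll.pow k R r) = 1 :=
  zero_pow r

def map [CharZero k] {C : Type u} [CommRing C] [Algebra k C] (f : B →ₐ[k] C) :
    SymPoint k R B →* SymPoint k R C where
  toFun φ := ⟨f.comp φ.1, φ.2.imp fun N hN x hx => by simp [hN x hx]⟩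
  map_one' := ext_pow fun r => by
    change f ((1 : SymPoint k R B).1 _) = _
    rw [one_pow', one_pow', map_one]
  map_mul' φ ψ := ext_pow fun r => by
    refine Eq.trans ?_ (mul_pow' _ _ r).symm
    change f ((φ * ψ).1 _) = f (φ.1 _) * f (ψ.1 _)
    rw [mul_pow', map_mul]

end SymPoint

variable (k R) in
/-- The function `1 ⊗ ⋯ ⊗ r ⊗ ⋯ ⊗ 1`, the pull-back of `r` along the `i`-th projection. -/
def coord {m : ℕ} (i : Fin m) (r : R) : TPow k R m :=
  tmk k R m (Function.update 1 i r)

theorem perm_coord {m : ℕ} (σ : Equiv.Perm (Fin m)) (i : Fin m) (r : R) :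
    perm k R σ (coord k R i r) = coord k R (σ.symm i) r := by
  rw [coord, perm_tmk, coord]
  congr 1
  funext j
  by_cases h : σ j = i
  · subst h; simp
  · rw [Function.update_of_ne h, Function.update_of_ne]
    · rfl
    · rintro rfl; simp at h

variable (k R) in
/-- `∏_i (t - r_i)`, where `r_i` is the pull-back of `r` along the `i`-th projection. -/
def divisorAux (r : R) (m : ℕ) : (TPow k R m)⟦X⟧ := ∏ i : Fin m, (X - C (coord k R i r))

theorem map_divisorAux (r : R) (m : ℕ) (σ : Equiv.Perm (Fin m)) :
    PowerSeries.map (perm k R σ).toRingHom (divisorAux k R r m) = divisorAux k R r m := by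
  rw [divisorAux, map_prod]
  refine Fintype.prod_equiv σ.symm _ _ fun i => ?_
  rw [map_sub, PowerSeries.map_X, PowerSeries.map_C]
  exact congrArg (fun z => X - C z) (perm_coord σ i r)

variable (k R) in
/-- The equation `∏_i (t - r_i)` of the universal divisor, as a power series over the functions on
the coproduct of all `Sym^m (Spec R)`; `r` is the coordinate on `Spec R`. -/
def divisor (r : R) : (SymAll k R)⟦X⟧ :=
  PowerSeries.mk fun j => fun m => ⟨PowerSeries.coeff j (divisorAux k R r m), fun σ => by
    have := congrArg (PowerSeries.coeff j) (map_divisorAux (k := k) r m σ)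
    rwa [PowerSeries.coeff_map] at this⟩

end Tensor

section Statement
variable (k : Type u) [Field k]

/-- `Gr^{pos,≤n}`, the coproduct over `m ≥ 0` of `Sym^m D^{≤n}`, where `D^{≤n} = Spec k⟦t⟧ / t ^ n`
and `Sym^m D^{≤n} = Spec (((k⟦t⟧ / t ^ n)^{⊗m})^{S_m})`, with addition of divisors. -/
def GrPosLe [CharZero k] (n : ℕ) : MonoidPrestack k where
  obj B := CommMonCat.of (SymPoint k (Trunc n k) B)
  map f := CommMonCat.ofHom (SymPoint.map f.hom)
  map_id _ := CommMonCat.ext fun _ => Subtype.ext (AlgHom.ext fun _ => rfl)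
  map_comp _ _ := CommMonCat.ext fun _ => Subtype.ext (AlgHom.ext fun _ => rfl)

variable {k}

/-- The ideal of the effective divisor on the formal disc given by a point of `Gr^{pos,≤n}`. The
cycle `τ_1 + ⋯ + τ_m` has the equation `(t - τ_1) ⋯ (t - τ_m)`. -/
def symDivisor {n : ℕ} {B : Type u} [CommRing B] [Algebra k B]
    (φ : SymPoint k (Trunc n k) B) : Ideal B⟦X⟧ :=
  Ideal.span {PowerSeries.map φ.1.toRingHom (divisor k (Trunc n k) (Ideal.Quotient.mk _ X))}

/-- `Γ^IndCoh(X, ω_X)` is a filtered colimit (so that it agrees with the derived one), and the map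
`Γ^IndCoh(X, ω_X) → Γ(Y, O_Y)` given by the pairing is an isomorphism of commutative algebras; on
the left the product is convolution along the monoid structure of `X`, on the right it is the
product of functions. -/
def IsDuality {X Y : MonoidPrestack k} (π : Pairing X Y) : Prop :=
  IsCofiltered (FinPoint X) ∧
    ∃ e : GammaIndCoh X ≃ₐ[k] functionAlgebra Y, ∀ z : GammaIndCoh X, e z = π.comparison z

end Statement

end
end LogCC

/-! The argument is Cartier duality tested at `k`-points. Pairing a point of `X` over a finite
algebra `A` with `Y(k)` gives a character `Y(k) → A` whose coordinates are functions on `Y`. Call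
the pairing perfect (`IsPerfect`) if every such regular character comes from exactly one `A`-point.
If moreover functions on `Y` are determined by their values at `k`-points and have finite coproducts
(`HasCoproduct`), then the comparison map is an isomorphism (`IsPerfect.isDuality`). For
injectivity, every finite point is dominated by one whose algebra is spanned by the values of its
character, and there a functional is determined by its integrals. For surjectivity, a function `q`
on `Y` has finitely many translates up to linear combination, so `k[Y(k)]` modulo the largest ideal
inside the kernel of `q` is a finite algebra carrying a regular character (`exists_character`); `q`
is a coordinate of it, and perfectness supplies the point.

It remains to prove that the four pairings exist and are perfect. Over a local ring an effective
divisor on the disc is cut out by a monic polynomial that is a power of `t` up to nilpotents. After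
an injective extension of the ring it becomes `∏ (t - τ_i)` with `τ_i` nilpotent, and the norm of
`f` is `∏ f(τ_i)`. Such extensions jointly detect elements (`exists_isSplit`), so additivity of
norms can be checked on them, and so can uniqueness: the norms of `s - t` recover `∏ (s - τ_i)` at
infinitely many `s` (`grPos_ext`).

For existence, a regular character of `R = k⟦t⟧ / t ^ n` is a multiplicative polynomial law. In
characteristic zero the tensors `r ⊗ ⋯ ⊗ r` span the invariants of `R^{⊗m}`, so the law is an
algebra map out of the functions on the symmetric powers, that is a point of `Gr^{pos,≤n}`
(`exists_symPoint`). A regular character of `k⟦t⟧` sees only finitely many coefficients, which gives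
`Gr^pos` (`exists_grPos_of_isRegular`). A regular character of `k⟦t⟧ˣ` extends to `k⟦t⟧` after
multiplication by a power of the constant coefficient, the norm along `t = 0`, which gives `Gr`
(`exists_gr_of_isRegular`). Finally, for `n > 0` the condition on `dlog` defining `Gr^{≤n}` says
that the power sums `∑ τ_i ^ j` with `j ≥ n` vanish (`mem_grLe_iff`). By Newton's identities this
amounts to trivial pairing with the series that are `1` modulo `t ^ n` (`grNorm_eq_one`,
`mem_grLe_of_grNorm`). -/

namespace LogCC
noncomputable section

/-! ### Perfect pairings and the criterion for duality -/

section Criterion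
variable {k : Type u} [Field k]

/-- The structure map of a `k`-algebra. -/
def toAlg (A : CommAlgCat.{u} k) : CommAlgCat.of k k ⟶ A := CommAlgCat.ofHom (Algebra.ofId k A)

theorem toAlg_comp {A B : CommAlgCat.{u} k} (f : A ⟶ B) : toAlg A ≫ f = toAlg B :=
  CommAlgCat.hom_ext (AlgHom.ext fun c => f.hom.commutes c)

variable {X Y : MonoidPrestack k}

namespace Pairing
variable (π : Pairing X Y)

/-- The `A`-valued character of the monoid `Y(k)` given by pairing with an `A`-point of `X`. -/
def char {A : CommAlgCat.{u} k} (x : X.obj A) : Y.obj (CommAlgCat.of k k) →* A where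
  toFun y := π.toFun A x (Y.map (toAlg A) y)
  map_one' := by rw [map_one, π.one_right]
  map_mul' y z := by rw [map_mul, π.mul_right]

theorem char_apply {A : CommAlgCat.{u} k} (x : X.obj A) (y : Y.obj (CommAlgCat.of k k)) :
    π.char x y = π.toFun A x (Y.map (toAlg A) y) := rfl

theorem char_map {A B : CommAlgCat.{u} k} (f : A ⟶ B) (x : X.obj A)
    (y : Y.obj (CommAlgCat.of k k)) : π.char (X.map f x) y = f (π.char x y) := by
  rw [char_apply, char_apply, ← π.map_map, FinPoint.map_map, toAlg_comp]

theorem char_mul {A : CommAlgCat.{u} k} (x x' : X.obj A) (y : Y.obj (CommAlgCat.of k k)) :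
    π.char (x * x') y = π.char x y * π.char x' y := π.mul_left _ _ _ _

theorem contract_base {A : Type u} [CommRing A] [Algebra k A] (ξ : Module.Dual k A)
    (z : A ⊗[k] k) : contract ξ k z = ξ (Algebra.TensorProduct.rid k k A z) := by
  induction z using TensorProduct.induction_on with
  | zero => simp
  | add a b ha hb => simp only [map_add, ha, hb]
  | tmul a b => simp [mul_comm]

/-- Over the base, contraction with `ξ` is `ξ` itself. The arguments below see a distribution only
through this formula. -/
theorem integrate_base (p : FinPoint X) (ξ : Module.Dual k p.alg)
    (y : Y.obj (CommAlgCat.of k k)) :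
    (π.integrate p ξ).1 (CommAlgCat.of k k) y = ξ (π.char p.pt y) := by
  let f : CommAlgCat.of k (p.alg ⊗[k] k) ⟶ p.alg :=
    CommAlgCat.ofHom (Algebra.TensorProduct.rid k k p.alg).toAlgHom
  refine (contract_base ξ _).trans (congrArg ξ ?_)
  change f.hom _ = _
  refine (π.map_map f _ _).symm.trans ?_
  rw [FinPoint.map_map, FinPoint.map_map, char_apply]
  have h1 : fst p.alg (CommAlgCat.of k k) ≫ f = 𝟙 p.alg :=
    CommAlgCat.hom_ext (AlgHom.ext fun a => by simp [f])
  have h2 : snd p.alg (CommAlgCat.of k k) ≫ f = toAlg p.alg :=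
    CommAlgCat.hom_ext (AlgHom.ext fun a => by
      simp [f, toAlg, Algebra.ofId_apply, Algebra.algebraMap_eq_smul_one])
  rw [h1, h2, X.map_id]
  rfl

theorem comparison_ι (p : FinPoint X) (ξ : Module.Dual k p.alg) :
    π.comparison (GammaIndCoh.ι X p ξ) = π.integrate p ξ := GammaIndCoh.desc_ι _ _ _ _

end Pairing

/-- A map from `Y(k)` to a vector space all of whose coordinates are functions on `Y`. -/
def IsRegular (Y : MonoidPrestack k) {A : Type u} [AddCommGroup A] [Module k A]
    (G : Y.obj (CommAlgCat.of k k) → A) : Prop :=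
  ∀ ξ : Module.Dual k A, ∃ q : functionAlgebra Y, ∀ y, ξ (G y) = q.1 (CommAlgCat.of k k) y

theorem Pairing.isRegular_char (π : Pairing X Y) (p : FinPoint X) :
    IsRegular Y (π.char p.pt) := fun ξ => ⟨π.integrate p ξ, fun y => (π.integrate_base p ξ y).symm⟩

/-- A function on a commutative monoid with finitely many coefficients `a i` under translation
factors through a character with values in a finite algebra, whose coordinates are linear
combinations of the `a i`. -/
theorem exists_character {M : Type u} [CommMonoid M] {ι : Type u} [Fintype ι] (q : M → k)
    (a b : ι → M → k) (h : ∀ y z, q (y * z) = ∑ i, a i y * b i z) :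
    ∃ (A : CommAlgCat.{u} k) (_ : Module.Finite k A) (G : M →* A) (ξ : Module.Dual k A),
      (∀ y, ξ (G y) = q y) ∧
      ∀ η : Module.Dual k A, ∃ c : ι → k, ∀ y, η (G y) = ∑ i, c i * a i y := by
  let L : (M → k) → MonoidAlgebra k M →ₗ[k] k := fun f =>
    Finsupp.linearCombination k f ∘ₗ (MonoidAlgebra.coeffLinearEquiv k).toLinearMap
  have hL : ∀ f m c, L f (MonoidAlgebra.single m c) = c * f m := fun f m c => by
    simp [L, MonoidAlgebra.coeffLinearEquiv]
  have key : ∀ z m, L q (z * MonoidAlgebra.single m 1) = ∑ i, L (a i) z * b i m := fun z m => by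
    induction z using MonoidAlgebra.induction_linear with
    | zero => simp
    | add f g hf hg => simp only [add_mul, map_add, hf, hg, Finset.sum_add_distrib]
    | single y c =>
      rw [MonoidAlgebra.single_mul_single, hL, h, mul_one, Finset.mul_sum]
      exact Finset.sum_congr rfl fun i _ => by rw [hL, mul_assoc]
  -- `J` is the largest ideal inside the kernel of `L q`. The expansion of `q (y * z)` shows that it
  -- contains the common kernel of the finitely many `L (a i)`, so the quotient is
  -- finite-dimensional.
  let J : Ideal (MonoidAlgebra k M) :=
    { carrier := {z | ∀ w, L q (z * w) = 0}
      add_mem' := fun {z z'} hz hz' w => by rw [add_mul, map_add, hz, hz', add_zero]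
      zero_mem' := fun w => by rw [zero_mul, map_zero]
      smul_mem' := fun c z hz w => by
        rw [smul_eq_mul, mul_comm c z, mul_assoc]; exact hz _ }
  have hJ : ∀ z, (∀ i, L (a i) z = 0) → z ∈ J := fun z hz w => by
    induction w using MonoidAlgebra.induction_linear with
    | zero => simp
    | add f g hf hg => rw [mul_add, map_add, hf, hg, add_zero]
    | single y c =>
      have e : MonoidAlgebra.single y c = c • (MonoidAlgebra.single y 1 : MonoidAlgebra k M) := by
        simp
      rw [e, mul_smul_comm, map_smul, key]
      simp [hz]
  let mkJ : MonoidAlgebra k M →ₐ[k] MonoidAlgebra k M ⧸ J := Ideal.Quotient.mkₐ k J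
  have hmk : Function.Surjective mkJ := Ideal.Quotient.mkₐ_surjective k J
  let P : MonoidAlgebra k M →ₗ[k] (ι → k) := LinearMap.pi fun i => L (a i)
  have hker : LinearMap.ker P ≤ LinearMap.ker mkJ.toLinearMap := fun z hz => by
    rw [LinearMap.mem_ker] at hz ⊢
    exact Ideal.Quotient.eq_zero_iff_mem.2 (hJ z fun i => congrFun hz i)
  have hfin : Module.Finite k (MonoidAlgebra k M ⧸ J) := by
    have h1 : Module.Finite k (MonoidAlgebra k M ⧸ LinearMap.ker P) :=
      Module.Finite.equiv P.quotKerEquivRange.symm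
    refine Module.Finite.of_surjective ((LinearMap.ker P).liftQ mkJ.toLinearMap hker) ?_
    intro x
    obtain ⟨z, rfl⟩ := hmk x
    exact ⟨(LinearMap.ker P).mkQ z, (LinearMap.ker P).liftQ_apply _ _⟩
  have hle : Submodule.restrictScalars k J ≤ LinearMap.ker (L q) := fun z hz => by
    have := hz 1
    rwa [mul_one] at this
  refine ⟨CommAlgCat.of k (MonoidAlgebra k M ⧸ J), hfin,
    (mkJ : MonoidAlgebra k M →* _).comp (MonoidAlgebra.of k M),
    (Submodule.restrictScalars k J).liftQ (L q) hle, fun y => ?_, fun η => ?_⟩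
  · refine ((Submodule.restrictScalars k J).liftQ_apply _ (MonoidAlgebra.of k M y)).trans ?_
    rw [MonoidAlgebra.of_apply, hL, one_mul]
  -- Pulled back to `k[M]`, a functional on the quotient kills the common kernel of the `L (a i)`
  -- and is therefore a linear combination of them.
  · have hη : ⨅ i, LinearMap.ker (L (a i)) ≤ LinearMap.ker (η ∘ₗ mkJ.toLinearMap) := fun z hz => by
      have hz' : mkJ.toLinearMap z = 0 :=
        hker (LinearMap.mem_ker.2 (funext fun i => (Submodule.mem_iInf _).1 hz i))
      rw [LinearMap.mem_ker, LinearMap.comp_apply, hz', map_zero]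
    obtain ⟨c, hc⟩ := (Submodule.mem_span_range_iff_exists_fun k).1
      (mem_span_of_iInf_ker_le_ker hη)
    refine ⟨c, fun y => ?_⟩
    have := LinearMap.congr_fun hc (MonoidAlgebra.single y 1)
    rw [LinearMap.sum_apply] at this
    refine Eq.trans ?_ (this.symm.trans (Finset.sum_congr rfl fun i _ => ?_))
    · rfl
    · rw [LinearMap.smul_apply, hL, one_mul, smul_eq_mul]

/-- The subalgebra spanned by the values of a character. -/
def spanRange {M : Type u} [CommMonoid M] {A : Type u} [CommRing A] [Algebra k A] (G : M →* A) :
    Subalgebra k A :=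
  (Submodule.span k (Set.range G)).toSubalgebra
    (Submodule.subset_span ⟨1, map_one G⟩) (fun x y hx hy => by
      induction hx using Submodule.span_induction with
      | zero => rw [zero_mul]; exact Submodule.zero_mem _
      | add a b _ _ ha hb => rw [add_mul]; exact Submodule.add_mem _ ha hb
      | smul c a _ ha => rw [smul_mul_assoc]; exact Submodule.smul_mem _ _ ha
      | mem a ha =>
        obtain ⟨m, rfl⟩ := ha
        induction hy using Submodule.span_induction with
        | zero => rw [mul_zero]; exact Submodule.zero_mem _
        | add a b _ _ ha hb => rw [mul_add]; exact Submodule.add_mem _ ha hb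
        | smul c a _ ha => rw [mul_smul_comm]; exact Submodule.smul_mem _ _ ha
        | mem b hb =>
          obtain ⟨m', rfl⟩ := hb
          exact Submodule.subset_span ⟨m * m', map_mul G m m'⟩)

/-- A character, with values in the subalgebra that it spans. -/
def toSpanRange {M : Type u} [CommMonoid M] {A : Type u} [CommRing A] [Algebra k A] (G : M →* A) :
    M →* spanRange (k := k) G :=
  G.codRestrict _ fun m => Submodule.subset_span ⟨m, rfl⟩

theorem IsRegular.of_injective {A B : Type u} [AddCommGroup A] [Module k A] [AddCommGroup B]
    [Module k B] {G : Y.obj (CommAlgCat.of k k) → A} (f : A →ₗ[k] B)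
    (hf : Function.Injective f) (h : IsRegular Y fun y => f (G y)) : IsRegular Y G := fun ξ => by
  obtain ⟨g, hg⟩ := f.exists_leftInverse_of_injective (LinearMap.ker_eq_bot.2 hf)
  obtain ⟨q, hq⟩ := h (ξ ∘ₗ g)
  refine ⟨q, fun y => ?_⟩
  rw [← hq, LinearMap.comp_apply, ← LinearMap.comp_apply g f, hg, LinearMap.id_apply]

theorem IsRegular.prod {A B : Type u} [AddCommGroup A] [Module k A] [AddCommGroup B]
    [Module k B] {G : Y.obj (CommAlgCat.of k k) → A} {H : Y.obj (CommAlgCat.of k k) → B}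
    (hG : IsRegular Y G) (hH : IsRegular Y H) : IsRegular Y fun y => (G y, H y) := fun ξ => by
  obtain ⟨q, hq⟩ := hG (ξ ∘ₗ LinearMap.inl k A B)
  obtain ⟨r, hr⟩ := hH (ξ ∘ₗ LinearMap.inr k A B)
  refine ⟨q + r, fun y => ?_⟩
  change _ = q.1 _ y + r.1 _ y
  rw [← hq, ← hr, LinearMap.comp_apply, LinearMap.comp_apply, ← map_add]
  simp

/-- `π` identifies the points of `X` over finite algebras `A` with the regular characters
`Y(k) → A`. -/
structure IsPerfect (π : Pairing X Y) : Prop where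
  inj : ∀ (A : CommAlgCat.{u} k), Module.Finite k A → ∀ x x' : X.obj A,
    (∀ y, π.char x y = π.char x' y) → x = x'
  surj : ∀ (A : CommAlgCat.{u} k), Module.Finite k A → ∀ G : Y.obj (CommAlgCat.of k k) →* A,
    IsRegular Y G → ∃ x : X.obj A, ∀ y, π.char x y = G y

/-- The functions on `Y` are determined by their values at `k`-points, where they satisfy
`q(yz) = ∑ a_i(y) b_i(z)` for suitable functions `a_i` and `b_i`. -/
structure HasCoproduct (Y : MonoidPrestack k) : Prop where
  ext : ∀ q q' : functionAlgebra Y,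
    (∀ y, q.1 (CommAlgCat.of k k) y = q'.1 (CommAlgCat.of k k) y) → q = q'
  comul : ∀ q : functionAlgebra Y, ∃ (ι : Type u) (_ : Fintype ι) (a b : ι → functionAlgebra Y),
    ∀ y z, q.1 (CommAlgCat.of k k) (y * z) =
      ∑ i, (a i).1 (CommAlgCat.of k k) y * (b i).1 (CommAlgCat.of k k) z

namespace Pairing
variable (π : Pairing X Y)

/-- At `k`-points, linearity of the pairing in `X` turns the character of a product of two points
into the tensor product of their characters. -/
theorem comparison_mul (hY : HasCoproduct Y) (a b : GammaIndCoh X) :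
    π.comparison (a * b) = π.comparison a * π.comparison b := by
  induction a using GammaIndCoh.induction_ι with
  | h0 => simp
  | hadd a a' h h' => rw [add_mul, map_add, h, h', map_add, add_mul]
  | hι p ξ =>
    induction b using GammaIndCoh.induction_ι with
    | h0 => simp
    | hadd b b' h h' => rw [mul_add, map_add, h, h', map_add, mul_add]
    | hι q η =>
      refine hY.ext _ _ fun y => ?_
      change _ = (π.comparison (GammaIndCoh.ι X p ξ)).1 _ y *
        (π.comparison (GammaIndCoh.ι X q η)).1 _ y
      rw [GammaIndCoh.ι_mul_ι, Pairing.comparison_ι, Pairing.comparison_ι, Pairing.comparison_ι,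
        Pairing.integrate_base, Pairing.integrate_base, Pairing.integrate_base]
      change FinPoint.mulDual p q ξ η (π.char (X.map (fst p.alg q.alg) p.pt *
        X.map (snd p.alg q.alg) q.pt) y) = _
      rw [Pairing.char_mul, Pairing.char_map, Pairing.char_map]
      change TensorProduct.dualDistrib k p.alg q.alg (ξ ⊗ₜ η)
        (((π.char p.pt y) ⊗ₜ[k] (1 : q.alg)) * ((1 : p.alg) ⊗ₜ[k] (π.char q.pt y))) = _
      rw [Algebra.TensorProduct.tmul_mul_tmul, mul_one, one_mul,
        TensorProduct.dualDistrib_apply]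

theorem comparison_one (hY : HasCoproduct Y) : π.comparison (1 : GammaIndCoh X) = 1 := by
  refine hY.ext _ _ fun y => ?_
  rw [GammaIndCoh.one_def, Pairing.comparison_ι, Pairing.integrate_base]
  exact π.one_left _ _

end Pairing

namespace IsPerfect
variable {π : Pairing X Y} (hπ : IsPerfect π)
include hπ

/-- The values of a character span a subalgebra over which the character stays regular, and
perfectness turns it into a point. On points spanned in this way, functionals and morphisms can be
tested on the values of the character. -/
theorem exists_span (A : CommAlgCat.{u} k) (hA : Module.Finite k A)
    (G : Y.obj (CommAlgCat.of k k) →* A) (hG : IsRegular Y G) :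
    ∃ r : FinPoint X, ∃ i : r.alg →ₐ[k] A, (∀ y, i (π.char r.pt y) = G y) ∧
      ∀ x, x ∈ Submodule.span k (Set.range (π.char r.pt)) := by
  have hfin : Module.Finite k (spanRange (k := k) G) :=
    inferInstanceAs (Module.Finite k (Subalgebra.toSubmodule (spanRange (k := k) G)))
  obtain ⟨x, hx⟩ := hπ.surj (CommAlgCat.of k (spanRange (k := k) G)) hfin (toSpanRange G)
    (IsRegular.of_injective (spanRange (k := k) G).val.toLinearMap Subtype.val_injective hG)
  refine ⟨⟨_, hfin, x⟩, (spanRange (k := k) G).val, fun y => ?_, ?_⟩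
  · exact congrArg Subtype.val (hx y)
  · rintro ⟨z, hz⟩
    change (⟨z, hz⟩ : spanRange (k := k) G) ∈ Submodule.span k (Set.range (π.char x))
    have e : ((spanRange (k := k) G).val.toLinearMap ∘ π.char x) = G :=
      funext fun y => congrArg Subtype.val (hx y)
    have hz' : z ∈ Submodule.span k (Set.range G) := hz
    rw [← e, Set.range_comp, ← Submodule.map_span] at hz'
    obtain ⟨w, hw, hwz⟩ := hz'
    have hwz' : w = ⟨z, hz⟩ := Subtype.ext hwz
    rwa [← hwz']

/-- The inclusion of the span is a morphism over `X` because points are determined by their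
characters. -/
theorem exists_hom (p : FinPoint X) :
    ∃ (r : FinPoint X) (_ : r ⟶ p), ∀ x, x ∈ Submodule.span k (Set.range (π.char r.pt)) := by
  obtain ⟨r, i, hi, hr⟩ := hπ.exists_span p.alg p.finite (π.char p.pt) (π.isRegular_char p)
  refine ⟨r, ⟨CommAlgCat.ofHom i, hπ.inj _ p.finite _ _ fun y => ?_⟩, hr⟩
  rw [Pairing.char_map]
  exact hi y

/-- Two points are dominated by the span of the joint character with values in `p.alg × q.alg`. Two
parallel maps agree after restriction to a spanned point, since both carry its character to the
character of `q`. -/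
theorem isCofiltered : IsCofiltered (FinPoint X) where
  nonempty := ⟨FinPoint.one X⟩
  cone_objs p q := by
    have := p.finite
    have := q.finite
    obtain ⟨r, i, hi, -⟩ := hπ.exists_span (CommAlgCat.of k (p.alg × q.alg))
      (inferInstanceAs (Module.Finite k (p.alg × q.alg)))
      ((π.char p.pt).prod (π.char q.pt)) ((π.isRegular_char p).prod (π.isRegular_char q))
    refine ⟨r, ⟨CommAlgCat.ofHom ((AlgHom.fst k p.alg q.alg).comp i),
      hπ.inj _ p.finite _ _ fun y => ?_⟩, ⟨CommAlgCat.ofHom ((AlgHom.snd k p.alg q.alg).comp i),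
      hπ.inj _ q.finite _ _ fun y => ?_⟩, trivial⟩
    · rw [Pairing.char_map]
      exact congrArg Prod.fst (hi y)
    · rw [Pairing.char_map]
      exact congrArg Prod.snd (hi y)
  cone_maps p q f g := by
    obtain ⟨r, h, hr⟩ := hπ.exists_hom p
    refine ⟨r, h, Subtype.ext (CommAlgCat.hom_ext (AlgHom.ext fun x => ?_))⟩
    refine LinearMap.congr_fun (f := (h.1 ≫ f.1).hom.toLinearMap)
      (g := (h.1 ≫ g.1).hom.toLinearMap) (LinearMap.ext_on_range (v := π.char r.pt)
        (Submodule.eq_top_iff'.2 hr) fun y => ?_) x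
    change (h.1 ≫ f.1) (π.char r.pt y) = (h.1 ≫ g.1) (π.char r.pt y)
    rw [← Pairing.char_map, ← Pairing.char_map, ← FinPoint.map_map, ← FinPoint.map_map, h.2,
      f.2, g.2]

theorem exists_ι (z : GammaIndCoh X) :
    ∃ (p : FinPoint X) (ξ : Module.Dual k p.alg), GammaIndCoh.ι X p ξ = z := by
  have := hπ.isCofiltered
  induction z using GammaIndCoh.induction_ι with
  | h0 => exact ⟨FinPoint.one X, 0, map_zero _⟩
  | hι p ξ => exact ⟨p, ξ, rfl⟩
  | hadd a b ha hb =>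
    obtain ⟨p, ξ, rfl⟩ := ha
    obtain ⟨q, η, rfl⟩ := hb
    obtain ⟨r, f, g, -⟩ := IsCofilteredOrEmpty.cone_objs p q
    exact ⟨r, ξ ∘ₗ f.1.hom.toLinearMap + η ∘ₗ g.1.hom.toLinearMap, by
      rw [map_add, GammaIndCoh.ι_comp, GammaIndCoh.ι_comp]⟩

/-- At a point whose algebra is spanned by its character, the values of the integral at `k`-points
are the values of the functional on a spanning set. -/
theorem comparison_injective : Function.Injective π.comparison := by
  rw [injective_iff_map_eq_zero]
  intro z hz
  obtain ⟨p, ξ, rfl⟩ := hπ.exists_ι z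
  obtain ⟨r, f, hr⟩ := hπ.exists_hom p
  rw [← GammaIndCoh.ι_comp f]
  rw [← GammaIndCoh.ι_comp f, Pairing.comparison_ι] at hz
  rw [show ξ ∘ₗ f.1.hom.toLinearMap = 0 from ?_, map_zero]
  refine LinearMap.ext_on_range (v := π.char r.pt) (Submodule.eq_top_iff'.2 hr) fun y => ?_
  rw [← Pairing.integrate_base, hz]
  rfl

/-- The character built from `q` has coordinates that are combinations of the `a i`, which are
functions on `Y`; so it is regular, and perfectness realizes it by a point with `q` as one
coordinate. -/
theorem comparison_surjective (hY : HasCoproduct Y) : Function.Surjective π.comparison := by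
  intro q
  obtain ⟨ι, _, a, b, h⟩ := hY.comul q
  obtain ⟨A, hA, G, ξ, hξ, hη⟩ := exists_character (q.1 (CommAlgCat.of k k))
    (fun i => (a i).1 (CommAlgCat.of k k)) (fun i => (b i).1 (CommAlgCat.of k k)) h
  obtain ⟨x, hx⟩ := hπ.surj A hA G fun η => by
    obtain ⟨c, hc⟩ := hη η
    refine ⟨∑ i, c i • a i, fun y => (hc y).trans ?_⟩
    have e : ((∑ i, c i • a i : functionAlgebra Y) :
        ∀ A : CommAlgCat.{u} k, Y.obj A → A) = ∑ i, c i • (a i).1 := by simp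
    rw [e, Finset.sum_apply, Finset.sum_apply]
    rfl
  refine ⟨GammaIndCoh.ι X ⟨A, hA, x⟩ ξ, hY.ext _ _ fun y => ?_⟩
  rw [Pairing.comparison_ι, Pairing.integrate_base]
  exact (congrArg ξ (hx y)).trans (hξ y)

theorem isDuality (hY : HasCoproduct Y) : IsDuality π :=
  ⟨hπ.isCofiltered, AlgEquiv.ofBijective
    (AlgHom.ofLinearMap π.comparison (π.comparison_one hY) (π.comparison_mul hY))
    ⟨hπ.comparison_injective, hπ.comparison_surjective hY⟩, fun _ => rfl⟩

end IsPerfect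
end Criterion

/-! ### Norms along divisors with a dual basis -/

section Norm
variable {A B : Type u} [CommRing A] [CommRing B]

/-- The non-negative part of a Laurent series. -/
def regPart : A⸨X⸩ →ₗ[A] A⟦X⟧ where
  toFun x := PowerSeries.mk fun n => x.coeff n
  map_add' x y := by ext; simp
  map_smul' c x := by ext; simp

theorem coeff_regPart (x : A⸨X⸩) (n : ℕ) : coeff n (regPart x) = x.coeff n :=
  PowerSeries.coeff_mk n fun n : ℕ => x.coeff n

theorem coeff_algebraMap_nat (f : A⟦X⟧) (n : ℕ) :
    (algebraMap A⟦X⟧ A⸨X⸩ f).coeff (n : ℤ) = coeff n f := by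
  rw [LaurentSeries.coe_algebraMap, PowerSeries.coeff_coe, if_neg (by omega)]
  simp

theorem coeff_algebraMap_neg (f : A⟦X⟧) {n : ℤ} (hn : n < 0) :
    (algebraMap A⟦X⟧ A⸨X⸩ f).coeff n = 0 := by
  rw [LaurentSeries.coe_algebraMap, PowerSeries.coeff_coe, if_pos hn]

theorem algebraMap_injective : Function.Injective (algebraMap A⟦X⟧ A⸨X⸩) := fun f g h => by
  ext n
  rw [← coeff_algebraMap_nat, h, coeff_algebraMap_nat]

theorem regPart_algebraMap (f : A⟦X⟧) : regPart (algebraMap A⟦X⟧ A⸨X⸩ f) = f := by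
  ext n
  rw [coeff_regPart, coeff_algebraMap_nat]

theorem exists_algebraMap_iff (x : A⸨X⸩) :
    (∃ f, algebraMap A⟦X⟧ A⸨X⸩ f = x) ↔ ∀ n < 0, x.coeff n = 0 := by
  constructor
  · rintro ⟨f, rfl⟩ n hn
    exact coeff_algebraMap_neg f hn
  · intro h
    refine ⟨regPart x, HahnSeries.ext (funext fun n => ?_)⟩
    rcases lt_or_ge n 0 with hn | hn
    · rw [coeff_algebraMap_neg _ hn, h n hn]
    · obtain ⟨m, rfl⟩ := Int.eq_ofNat_of_zero_le hn
      exact (coeff_algebraMap_nat _ m).trans (coeff_regPart x m)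

theorem regPart_mapLaurent (φ : A →+* B) (x : A⸨X⸩) :
    regPart (mapLaurent φ x) = PowerSeries.map φ (regPart x) := by
  ext n
  simp [coeff_regPart]

theorem algebraMap_X_pow (N : ℕ) :
    algebraMap A⟦X⟧ A⸨X⸩ (X ^ N) = HahnSeries.single (N : ℤ) 1 := by
  rw [LaurentSeries.coe_algebraMap, HahnSeries.ofPowerSeries_X_pow]

theorem exists_pow_mul (x : A⸨X⸩) :
    ∃ N : ℕ, ∀ M ≥ N, ∃ f, algebraMap A⟦X⟧ A⸨X⸩ f = algebraMap A⟦X⟧ A⸨X⸩ (X ^ M) * x := by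
  refine ⟨(-x.order).toNat, fun M hM => (exists_algebraMap_iff _).2 fun n hn => ?_⟩
  rw [algebraMap_X_pow, HahnSeries.coeff_single_mul, one_mul]
  exact HahnSeries.coeff_eq_zero_of_lt_order (by omega)

/-- Elements `α i` of an ideal `I` of `A⟦t⟧` and `b i` of its inverse with `∑ α i * b i = 1`. -/
structure IsDualBasis (I : Ideal A⟦X⟧) {ι : Type*} [Fintype ι] (α : ι → A⟦X⟧) (b : ι → A⸨X⸩) :
    Prop where
  mem : ∀ i, α i ∈ I
  integral : ∀ i, ∀ x ∈ I, ∃ y, algebraMap A⟦X⟧ A⸨X⸩ y = b i * algebraMap A⟦X⟧ A⸨X⸩ x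
  sum : ∑ i, algebraMap A⟦X⟧ A⸨X⸩ (α i) * b i = 1

theorem regPart_mul_smul (b : A⸨X⸩) (c : A) (x : A⟦X⟧) :
    regPart (b * algebraMap A⟦X⟧ A⸨X⸩ (c • x)) = c • regPart (b * algebraMap A⟦X⟧ A⸨X⸩ x) := by
  rw [← map_smul, PowerSeries.smul_eq_C_mul, map_mul (algebraMap A⟦X⟧ A⸨X⸩), mul_left_comm,
    ← HahnSeries.C_mul_eq_smul, LaurentSeries.coe_algebraMap, HahnSeries.ofPowerSeries_C]

/-- The retraction of `A⟦t⟧` onto an ideal given by a dual basis. -/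
def retract {ι : Type*} [Fintype ι] (α : ι → A⟦X⟧) (b : ι → A⸨X⸩) : A⟦X⟧ →ₗ[A] A⟦X⟧ where
  toFun x := ∑ i, α i * regPart (b i * algebraMap A⟦X⟧ A⸨X⸩ x)
  map_add' x y := by simp only [map_add, mul_add, Finset.sum_add_distrib]
  map_smul' c x := by
    simp only [regPart_mul_smul, mul_smul_comm, RingHom.id_apply, Finset.smul_sum]

theorem retract_apply {ι : Type*} [Fintype ι] (α : ι → A⟦X⟧) (b : ι → A⸨X⸩) (x : A⟦X⟧) :
    retract α b x = ∑ i, α i * regPart (b i * algebraMap A⟦X⟧ A⸨X⸩ x) := rfl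

theorem retract_map {ι : Type*} [Fintype ι] (φ : A →+* B) (α : ι → A⟦X⟧) (b : ι → A⸨X⸩)
    (x : A⟦X⟧) : retract (fun i => PowerSeries.map φ (α i)) (fun i => mapLaurent φ (b i))
      (PowerSeries.map φ x) = PowerSeries.map φ (retract α b x) := by
  simp only [retract_apply, map_sum, map_mul, ← mapLaurent_coe]
  simp only [← map_mul, regPart_mapLaurent]

namespace IsDualBasis
variable {I : Ideal A⟦X⟧} {ι : Type*} [Fintype ι] {α : ι → A⟦X⟧} {b : ι → A⸨X⸩}
  (h : IsDualBasis I α b)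
include h

theorem retract_mem (x : A⟦X⟧) : retract α b x ∈ I := by
  rw [retract_apply]
  exact Ideal.sum_mem _ fun i _ => Ideal.mul_mem_right _ _ (h.mem i)

/-- For `x` in `I` the products `b i * x` are already integral, so `regPart` loses nothing and the
sum is `(∑ α i * b i) * x`. -/
theorem retract_of_mem {x : A⟦X⟧} (hx : x ∈ I) : retract α b x = x := by
  apply algebraMap_injective
  rw [retract_apply, map_sum]
  have e : ∀ i, algebraMap A⟦X⟧ A⸨X⸩ (α i * regPart (b i * algebraMap A⟦X⟧ A⸨X⸩ x)) =
      (algebraMap A⟦X⟧ A⸨X⸩ (α i) * b i) * algebraMap A⟦X⟧ A⸨X⸩ x := fun i => by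
    obtain ⟨y, hy⟩ := h.integral i x hx
    rw [map_mul, ← hy, regPart_algebraMap, hy, mul_assoc]
  simp only [e, ← Finset.sum_mul, h.sum, one_mul]

/-- For large `N` every `X ^ N * b i` is integral, and `X ^ N = ∑ α i * (X ^ N * b i)`. -/
theorem exists_pow_mem : ∃ N, X ^ N ∈ I := by
  choose N hN using fun i => exists_pow_mul (b i)
  choose f hf using fun i => hN i (∑ j, N j) (Finset.single_le_sum (fun j _ => Nat.zero_le (N j))
    (Finset.mem_univ i))
  refine ⟨∑ j, N j, ?_⟩
  have e : (X ^ (∑ j, N j) : A⟦X⟧) = ∑ i, α i * f i := by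
    apply algebraMap_injective
    rw [map_sum, ← one_mul (algebraMap A⟦X⟧ A⸨X⸩ _), ← h.sum, Finset.sum_mul]
    refine Finset.sum_congr rfl fun i _ => ?_
    rw [map_mul, hf]
    ring
  rw [e]
  exact Ideal.sum_mem _ fun i _ => Ideal.mul_mem_right _ _ (h.mem i)

end IsDualBasis

/-- Truncation of power series, as a linear map to `A ^ N`. -/
def truncLin (N : ℕ) : A⟦X⟧ →ₗ[A] (Fin N → A) := LinearMap.pi fun j => PowerSeries.coeff (j : ℕ)

/-- The power series with given first coefficients. -/
def ofCoeffs (N : ℕ) : (Fin N → A) →ₗ[A] A⟦X⟧ := Fintype.linearCombination A fun j => X ^ (j : ℕ)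

theorem ofCoeffs_truncLin (N : ℕ) (x : A⟦X⟧) : ∃ y, ofCoeffs N (truncLin N x) = x + X ^ N * y := by
  obtain ⟨y, hy⟩ : (X ^ N : A⟦X⟧) ∣ ofCoeffs N (truncLin N x) - x := by
    rw [PowerSeries.X_pow_dvd_iff]
    intro m hm
    rw [map_sub, ofCoeffs, Fintype.linearCombination_apply, map_sum,
      Finset.sum_eq_single (⟨m, hm⟩ : Fin N)]
    · simp [truncLin]
    · intro j _ hj
      have : m ≠ (j : ℕ) := fun e => hj (Fin.ext e.symm)
      simp [PowerSeries.coeff_X_pow, this]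
    · simp
  exact ⟨y, by rw [← hy]; ring⟩

/-- The matrix of `1 + i (f - 1) p` for the presentation of `A⟦t⟧ / I` as a direct summand of
`A ^ N` that is given by a dual basis. -/
def normMatrix {ι : Type*} [Fintype ι] (α : ι → A⟦X⟧) (b : ι → A⸨X⸩) (N : ℕ) (f : A⟦X⟧) :
    Matrix (Fin N) (Fin N) A :=
  1 + Matrix.of fun i j : Fin N => coeff (i : ℕ) ((f - 1) * X ^ (j : ℕ) -
    retract α b ((f - 1) * X ^ (j : ℕ)))

theorem normMatrix_map {ι : Type*} [Fintype ι] (φ : A →+* B) (α : ι → A⟦X⟧) (b : ι → A⸨X⸩) (N : ℕ)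
    (f : A⟦X⟧) : normMatrix (fun i => PowerSeries.map φ (α i)) (fun i => mapLaurent φ (b i)) N
      (PowerSeries.map φ f) = φ.mapMatrix (normMatrix α b N f) := by
  rw [normMatrix, normMatrix, map_add, map_one]
  congr 1
  ext i j
  simp only [Matrix.of_apply, RingHom.mapMatrix_apply, Matrix.map_apply]
  rw [← PowerSeries.coeff_map, map_sub (PowerSeries.map φ), ← retract_map]
  simp

/-- The projector `1 - retract` kills `I` and so descends to the quotient; truncation at `N` loses
only multiples of `X ^ N`, which lie in `I`. -/
theorem IsDualBasis.exists_retraction {I : Ideal A⟦X⟧} {ι : Type*} [Fintype ι] {α : ι → A⟦X⟧}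
    {b : ι → A⸨X⸩} (h : IsDualBasis I α b) {N : ℕ} (hN : X ^ N ∈ I) :
    ∃ (i : (A⟦X⟧ ⧸ I) →ₗ[A] (Fin N → A)), (∀ x, i (Ideal.Quotient.mk I x) =
      truncLin N (x - retract α b x)) ∧
      ((Ideal.Quotient.mkₐ A I).toLinearMap ∘ₗ ofCoeffs N) ∘ₗ i = LinearMap.id := by
  have hker : Submodule.restrictScalars A I ≤
      LinearMap.ker (truncLin N ∘ₗ (LinearMap.id - retract α b)) := fun x hx => by
    rw [LinearMap.mem_ker, LinearMap.comp_apply, LinearMap.sub_apply, LinearMap.id_apply,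
      h.retract_of_mem hx, sub_self, map_zero]
  obtain ⟨i, hi⟩ : ∃ i : (A⟦X⟧ ⧸ I) →ₗ[A] (Fin N → A), ∀ x, i (Ideal.Quotient.mk I x) =
      truncLin N (x - retract α b x) :=
    ⟨(Submodule.restrictScalars A I).liftQ _ hker, fun x => Submodule.liftQ_apply _ _ _⟩
  refine ⟨i, hi, LinearMap.ext fun y => ?_⟩
  obtain ⟨x, rfl⟩ := Ideal.Quotient.mk_surjective y
  rw [LinearMap.comp_apply, hi, LinearMap.comp_apply]
  obtain ⟨z, hz⟩ := ofCoeffs_truncLin N (x - retract α b x)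
  rw [hz]
  change Ideal.Quotient.mk I _ = Ideal.Quotient.mk I x
  rw [Ideal.Quotient.eq]
  have e : x - retract α b x + X ^ N * z - x = X ^ N * z - retract α b x := by ring
  rw [e]
  exact Ideal.sub_mem _ (Ideal.mul_mem_right _ _ hN) (h.retract_mem x)

/-- The determinant does not depend on the presentation; the one coming from the dual basis has a
matrix that visibly commutes with change of rings. -/
theorem divisorNorm_eq {I : Ideal A⟦X⟧} {ι : Type*} [Fintype ι] {α : ι → A⟦X⟧}
    {b : ι → A⸨X⸩} (h : IsDualBasis I α b) {N : ℕ} (hN : X ^ N ∈ I) (f : A⟦X⟧) :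
    divisorNorm I f = (normMatrix α b N f).det := by
  obtain ⟨i, hi, hp⟩ := h.exists_retraction hN
  rw [divisorNorm, projDet_eq _ N i _ hp, ← LinearMap.det_toMatrix', map_add,
    LinearMap.toMatrix'_id, normMatrix]
  congr 2
  ext a c
  rw [LinearMap.toMatrix'_apply, Matrix.of_apply]
  have e : (ofCoeffs N (Pi.single c 1) : A⟦X⟧) = X ^ (c : ℕ) := by
    rw [ofCoeffs, Fintype.linearCombination_apply]
    simp
  simp only [LinearMap.comp_apply, e]
  have e2 : (LinearMap.mulLeft A (Ideal.Quotient.mk I f) - LinearMap.id :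
      (A⟦X⟧ ⧸ I) →ₗ[A] A⟦X⟧ ⧸ I) ((Ideal.Quotient.mkₐ A I).toLinearMap (X ^ (c : ℕ))) =
      Ideal.Quotient.mk I ((f - 1) * X ^ (c : ℕ)) := by
    rw [sub_mul, one_mul, map_sub, map_mul]
    rfl
  rw [e2, hi]
  rfl

/-- Norms are compatible with base change. -/
theorem divisorNorm_map (φ : A →+* B) {I : Ideal A⟦X⟧} {J : Ideal B⟦X⟧} {ι : Type*} [Fintype ι]
    {α : ι → A⟦X⟧} {b : ι → A⸨X⸩} (h : IsDualBasis I α b)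
    (h' : IsDualBasis J (fun i => PowerSeries.map φ (α i)) (fun i => mapLaurent φ (b i)))
    (hφ : ∀ x ∈ I, PowerSeries.map φ x ∈ J) (f : A⟦X⟧) :
    divisorNorm J (PowerSeries.map φ f) = φ (divisorNorm I f) := by
  obtain ⟨N, hN⟩ := h.exists_pow_mem
  have hN' : X ^ N ∈ J := by
    have := hφ _ hN
    rwa [map_pow, PowerSeries.map_X] at this
  rw [divisorNorm_eq h hN, divisorNorm_eq h' hN', normMatrix_map, RingHom.map_det]

/-- A module is a direct summand of a free module of finite rank. -/
def IsSummand (A M : Type u) [CommRing A] [AddCommGroup M] [Module A M] : Prop :=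
  ∃ (m : ℕ) (i : M →ₗ[A] (Fin m → A)) (p : (Fin m → A) →ₗ[A] M), p ∘ₗ i = LinearMap.id

theorem IsDualBasis.isSummand {I : Ideal A⟦X⟧} {ι : Type*} [Fintype ι] {α : ι → A⟦X⟧}
    {b : ι → A⸨X⸩} (h : IsDualBasis I α b) : IsSummand A (A⟦X⟧ ⧸ I) := by
  obtain ⟨N, hN⟩ := h.exists_pow_mem
  obtain ⟨i, -, hp⟩ := h.exists_retraction hN
  exact ⟨N, i, _, hp⟩

section ProjDet
variable {M M' : Type u} [AddCommGroup M] [Module A M] [AddCommGroup M'] [Module A M']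

/-- Since `p ∘ i = id`, extension of endomorphisms by the identity on the complement respects
composition. -/
theorem projDet_comp (hM : IsSummand A M) (g g' : M →ₗ[A] M) :
    projDet (g ∘ₗ g') = projDet g * projDet g' := by
  obtain ⟨m, i, p, h⟩ := hM
  rw [projDet_eq _ m i p h, projDet_eq _ m i p h, projDet_eq _ m i p h, ← LinearMap.det_comp]
  congr 1
  refine LinearMap.ext fun v => ?_
  have h' : ∀ w, p (i w) = w := LinearMap.congr_fun h
  simp only [LinearMap.add_apply, LinearMap.comp_apply, LinearMap.id_apply, LinearMap.sub_apply,
    map_add, map_sub, h']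
  abel

theorem projDet_id (hM : IsSummand A M) : projDet (LinearMap.id : M →ₗ[A] M) = 1 := by
  obtain ⟨m, i, p, h⟩ := hM
  rw [projDet_eq _ m i p h, sub_self, LinearMap.zero_comp, LinearMap.comp_zero, add_zero,
    LinearMap.det_id]

theorem isSummand_of_subsingleton [Subsingleton M] : IsSummand A M :=
  ⟨0, 0, 0, LinearMap.ext fun _ => Subsingleton.elim _ _⟩

/-- The endomorphism preserves `0 × M'` and acts by `a` on the quotient `A`, so its matrix is block
triangular and is expanded along the first row. -/
theorem projDet_prod (hM : IsSummand A M') (e : (A × M') ≃ₗ[A] M) (g : M →ₗ[A] M)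
    (g' : M' →ₗ[A] M') (a : A) (h1 : ∀ x, g (e (0, x)) = e (0, g' x))
    (h2 : ∃ x, g (e (1, 0)) = e (a, x)) :
    IsSummand A M ∧ projDet g = a * projDet g' := by
  obtain ⟨m, i, p, h⟩ := hM
  have hip : ∀ w, p (i w) = w := LinearMap.congr_fun h
  -- The presentation of `M'` is enlarged by one free coordinate at index `0`.
  let i' : M →ₗ[A] (Fin (m + 1) → A) := LinearMap.pi (Fin.cons
    (LinearMap.fst A A M' ∘ₗ e.symm.toLinearMap)
    (fun j => LinearMap.proj j ∘ₗ i ∘ₗ LinearMap.snd A A M' ∘ₗ e.symm.toLinearMap))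
  let p' : (Fin (m + 1) → A) →ₗ[A] M := e.toLinearMap ∘ₗ LinearMap.prod (LinearMap.proj 0)
    (p ∘ₗ LinearMap.funLeft A A Fin.succ)
  have i0 : ∀ c x, i' (e (c, x)) 0 = c := fun c x => by simp [i']
  have iS : ∀ c x j, i' (e (c, x)) (Fin.succ j) = i x j := fun c x j => by simp [i']
  have hp' : ∀ v, p' v = e (v 0, p (fun j => v (Fin.succ j))) := fun v => rfl
  have h' : p' ∘ₗ i' = LinearMap.id := LinearMap.ext fun y => by
    obtain ⟨⟨c, x⟩, rfl⟩ := e.surjective y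
    rw [LinearMap.comp_apply, hp', i0]
    simp only [iS]
    have : p (fun j => i x j) = x := hip x
    rw [this]
    rfl
  have hsingle : ∀ c : Fin m, (fun j : Fin m => (Pi.single (Fin.succ c) 1 : Fin (m + 1) → A)
      (Fin.succ j)) = Pi.single c 1 := fun c => by
    ext j; simp [Pi.single_apply]
  have e1 : ∀ c : Fin m, p' (Pi.single (Fin.succ c) 1) = e (0, p (Pi.single c 1)) := fun c => by
    rw [hp', hsingle, Pi.single_eq_of_ne (Fin.succ_ne_zero c).symm]
  refine ⟨⟨_, i', p', h'⟩, ?_⟩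
  rw [projDet_eq _ _ i' p' h', projDet_eq _ m i p h, ← LinearMap.det_toMatrix',
    ← LinearMap.det_toMatrix', Matrix.det_succ_row_zero, Finset.sum_eq_single 0]
  · have e00 : LinearMap.toMatrix' (LinearMap.id + i' ∘ₗ (g - LinearMap.id) ∘ₗ p') 0 0 = a := by
      rw [LinearMap.toMatrix'_apply]
      obtain ⟨x, hx⟩ := h2
      have e1 : p' (Pi.single 0 1) = e (1, 0) := by
        rw [hp', Pi.single_eq_same]
        have : (fun j : Fin m => (Pi.single 0 1 : Fin (m + 1) → A) (Fin.succ j)) = 0 := by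
          ext j; simp
        rw [this, map_zero]
      rw [LinearMap.add_apply, LinearMap.comp_apply, LinearMap.comp_apply, e1, LinearMap.sub_apply,
        hx, LinearMap.id_apply, LinearMap.id_apply, Pi.add_apply, map_sub, Pi.sub_apply, i0, i0]
      simp
    rw [e00]
    simp only [Fin.val_zero, pow_zero, one_mul, Fin.succAbove_zero]
    congr 2
    ext r c
    rw [Matrix.submatrix_apply, LinearMap.toMatrix'_apply, LinearMap.toMatrix'_apply]
    simp only [LinearMap.add_apply, LinearMap.comp_apply, e1, LinearMap.sub_apply, h1,
      LinearMap.id_apply, Pi.add_apply, map_sub, Pi.sub_apply, iS, congrFun (hsingle c) r]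
  · intro c _ hc
    obtain ⟨c, rfl⟩ := Fin.exists_succ_eq_of_ne_zero hc
    have e00 : LinearMap.toMatrix' (LinearMap.id + i' ∘ₗ (g - LinearMap.id) ∘ₗ p') 0
        (Fin.succ c) = 0 := by
      rw [LinearMap.toMatrix'_apply]
      simp only [LinearMap.add_apply, LinearMap.comp_apply, e1, LinearMap.sub_apply, h1,
        LinearMap.id_apply, Pi.add_apply, map_sub, Pi.sub_apply, i0]
      simp
    rw [e00]
    simp
  · simp

end ProjDet

theorem divisorNorm_mul {I : Ideal A⟦X⟧} (hI : IsSummand A (A⟦X⟧ ⧸ I)) (f g : A⟦X⟧) :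
    divisorNorm I (f * g) = divisorNorm I f * divisorNorm I g := by
  rw [divisorNorm, divisorNorm, divisorNorm, ← projDet_comp hI, ← LinearMap.mulLeft_mul, map_mul]

theorem divisorNorm_one {I : Ideal A⟦X⟧} (hI : IsSummand A (A⟦X⟧ ⧸ I)) :
    divisorNorm I (1 : A⟦X⟧) = 1 := by
  rw [divisorNorm, map_one, LinearMap.mulLeft_one, projDet_id hI]

theorem divisorNorm_top (f : A⟦X⟧) : divisorNorm (⊤ : Ideal A⟦X⟧) f = 1 := by
  have : Subsingleton (A⟦X⟧ ⧸ (⊤ : Ideal A⟦X⟧)) := Ideal.Quotient.subsingleton_iff.2 rfl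
  rw [divisorNorm, ← projDet_id (isSummand_of_subsingleton (A := A) (M := A⟦X⟧ ⧸ (⊤ : Ideal A⟦X⟧)))]
  congr 1
  exact LinearMap.ext fun _ => Subsingleton.elim _ _

end Norm

/-! ### Values of power series at nilpotent elements -/

section Eval
variable {A B : Type u} [CommRing A] [CommRing B]

theorem X_sub_C_dvd_X_pow {τ : A} {N : ℕ} (h : τ ^ N = 0) : (X - C τ : A⟦X⟧) ∣ X ^ N := by
  have := sub_dvd_pow_sub_pow (X : A⟦X⟧) (C τ) N
  rwa [← map_pow, h, map_zero, sub_zero] at this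

theorem X_sub_C_mul_injective {τ : A} (h : IsNilpotent τ) {f g : A⟦X⟧}
    (hfg : (X - C τ) * f = (X - C τ) * g) : f = g := by
  obtain ⟨N, hN⟩ := h
  obtain ⟨w, hw⟩ := X_sub_C_dvd_X_pow hN
  have : X ^ N * f = X ^ N * g := by
    rw [hw, mul_comm (X - C τ) w, mul_assoc, hfg, mul_assoc]
  exact PowerSeries.X_pow_mul_cancel this

/-- Multiply by the cofactor of `X - C τ` in `X ^ (N + 1)`, which is monic of degree `N`, and
compare coefficients of `X ^ N`. -/
theorem eq_zero_of_X_sub_C_dvd {τ : A} (h : IsNilpotent τ) {a : A}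
    (ha : (X - C τ : A⟦X⟧) ∣ C a) : a = 0 := by
  obtain ⟨N, hN⟩ := h
  obtain ⟨q, hq⟩ := ha
  rcases N with _ | N
  -- The relation `τ ^ 0 = 0` holds only in the zero ring.
  · have h01 : (1 : A) = 0 := by rwa [pow_zero] at hN
    rw [← one_mul a, h01, zero_mul]
  have hw : (∑ i ∈ Finset.range (N + 1), (X : A⟦X⟧) ^ i * (C τ) ^ (N + 1 - 1 - i)) * (X - C τ) =
      X ^ (N + 1) := by
    rw [(Commute.all (X : A⟦X⟧) (C τ)).geom_sum₂_mul, ← map_pow, hN, map_zero, sub_zero]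
  have h2 : (∑ i ∈ Finset.range (N + 1), (X : A⟦X⟧) ^ i * (C τ) ^ (N + 1 - 1 - i)) * C a =
      X ^ (N + 1) * q := by rw [hq, ← mul_assoc, hw]
  have h3 := congrArg (coeff N) h2
  rw [PowerSeries.coeff_X_pow_mul', if_neg (by omega), PowerSeries.coeff_mul_C, map_sum,
    Finset.sum_eq_single N] at h3
  · simpa using h3
  · intro i hi hne
    rw [← map_pow, PowerSeries.coeff_mul_C, PowerSeries.coeff_X_pow, if_neg (Ne.symm hne), zero_mul]
  · simp

/-- The value of a power series at a nilpotent element. -/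
def ev (τ : A) (f : A⟦X⟧) : A := ∑ j ∈ Finset.range (nilpotencyClass τ), coeff j f * τ ^ j

/-- Up to a multiple of `X ^ N`, which `X - C τ` divides, the series is a polynomial, and each `X ^
j - C τ ^ j` is a multiple of `X - C τ`. -/
theorem exists_eq_ev {τ : A} (h : IsNilpotent τ) (f : A⟦X⟧) :
    ∃ q, f = C (ev τ f) + (X - C τ) * q := by
  have hN : τ ^ nilpotencyClass τ = 0 := pow_nilpotencyClass h
  obtain ⟨y, hy⟩ := ofCoeffs_truncLin (nilpotencyClass τ) f
  suffices hd : (X - C τ : A⟦X⟧) ∣ f - C (ev τ f) by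
    obtain ⟨q, hq⟩ := hd
    exact ⟨q, by rw [← hq]; ring⟩
  have e : f - C (ev τ f) = (ofCoeffs (nilpotencyClass τ) (truncLin (nilpotencyClass τ) f) -
      C (ev τ f)) - X ^ (nilpotencyClass τ) * y := by rw [hy]; ring
  rw [e]
  refine dvd_sub ?_ ((X_sub_C_dvd_X_pow hN).mul_right y)
  rw [ev, ofCoeffs, Fintype.linearCombination_apply, Finset.sum_range, map_sum,
    ← Finset.sum_sub_distrib]
  refine Finset.dvd_sum fun j _ => ?_
  rw [map_mul, map_pow, PowerSeries.smul_eq_C_mul]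
  change _ ∣ C (coeff (j : ℕ) f) * _ - _
  rw [← mul_sub]
  exact (sub_dvd_pow_sub_pow _ _ _).mul_left _

/-- Multiplicativity of `ev` and its values at constants and at `X` come from this uniqueness of the
remainder rather than from the defining sum. -/
theorem ev_unique {τ : A} (h : IsNilpotent τ) {f q : A⟦X⟧} {a : A}
    (hf : f = C a + (X - C τ) * q) : ev τ f = a := by
  obtain ⟨q', hq'⟩ := exists_eq_ev h f
  refine sub_eq_zero.1 (eq_zero_of_X_sub_C_dvd h ⟨q - q', ?_⟩)
  rw [map_sub, mul_sub]
  linear_combination hf - hq'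

theorem ev_C {τ : A} (h : IsNilpotent τ) (a : A) : ev τ (C a) = a :=
  ev_unique h (q := 0) (by simp)

theorem ev_one {τ : A} (h : IsNilpotent τ) : ev τ (1 : A⟦X⟧) = 1 := by
  rw [← map_one C, ev_C h]

theorem ev_X {τ : A} (h : IsNilpotent τ) : ev τ X = τ := ev_unique h (q := 1) (by ring)

theorem ev_add {τ : A} (f g : A⟦X⟧) : ev τ (f + g) = ev τ f + ev τ g := by
  simp [ev, add_mul, Finset.sum_add_distrib]

theorem ev_sub {τ : A} (f g : A⟦X⟧) : ev τ (f - g) = ev τ f - ev τ g := by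
  simp [ev, sub_mul, Finset.sum_sub_distrib]

theorem ev_mul {τ : A} (h : IsNilpotent τ) (f g : A⟦X⟧) : ev τ (f * g) = ev τ f * ev τ g := by
  obtain ⟨p, hp⟩ := exists_eq_ev h f
  obtain ⟨q, hq⟩ := exists_eq_ev h g
  refine ev_unique h (q := p * C (ev τ g) + q * C (ev τ f) + p * (X - C τ) * q) ?_
  conv_lhs => rw [hp, hq]
  rw [map_mul]
  ring

theorem ev_pow {τ : A} (h : IsNilpotent τ) (f : A⟦X⟧) (n : ℕ) : ev τ (f ^ n) = ev τ f ^ n := by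
  induction n with
  | zero => rw [pow_zero, pow_zero, ev_one h]
  | succ n ih => rw [pow_succ, ev_mul h, ih, pow_succ]

theorem ev_eq_sum {τ : A} {N : ℕ} (h : τ ^ N = 0) (f : A⟦X⟧) :
    ev τ f = ∑ j ∈ Finset.range N, coeff j f * τ ^ j := by
  refine Finset.sum_subset (Finset.range_mono (csInf_le' h)) fun j _ hj => ?_
  rw [Finset.mem_range, not_lt] at hj
  rw [pow_eq_zero_of_le hj (pow_nilpotencyClass ⟨N, h⟩), mul_zero]

theorem ev_zero (f : A⟦X⟧) : ev 0 f = constantCoeff f := by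
  rw [ev_eq_sum (N := 1) (pow_one 0)]
  simp

/-- The norm along the sum of the divisors of `X - C τ` and of `Q`. -/
theorem divisorNorm_X_sub_C_mul {τ : A} (h : IsNilpotent τ) {Q : A⟦X⟧}
    (hQ : IsSummand A (A⟦X⟧ ⧸ Ideal.span {Q})) (f : A⟦X⟧) :
    IsSummand A (A⟦X⟧ ⧸ Ideal.span {(X - C τ) * Q}) ∧
      divisorNorm (Ideal.span {(X - C τ) * Q}) f = ev τ f * divisorNorm (Ideal.span {Q}) f := by
  let I := Ideal.span {(X - C τ) * Q}
  let mk : A⟦X⟧ →ₐ[A] A⟦X⟧ ⧸ I := Ideal.Quotient.mkₐ A I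
  have hmk : ∀ x, mk x = 0 ↔ (X - C τ) * Q ∣ x := fun x =>
    Ideal.Quotient.eq_zero_iff_mem.trans Ideal.mem_span_singleton
  let T : (A⟦X⟧ ⧸ Ideal.span {Q}) →ₗ[A] A⟦X⟧ ⧸ I :=
    (Submodule.restrictScalars A (Ideal.span {Q})).liftQ
      (mk.toLinearMap ∘ₗ LinearMap.mulLeft A (X - C τ)) (fun x hx => by
        obtain ⟨y, rfl⟩ := Ideal.mem_span_singleton.1 hx
        rw [LinearMap.mem_ker]
        exact (hmk _).2 ⟨y, by rw [LinearMap.mulLeft_apply]; ring⟩)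
  have hT : ∀ x, T (Ideal.Quotient.mk _ x) = mk ((X - C τ) * x) := fun x =>
    Submodule.liftQ_apply _ _ _
  -- Division by `X - C τ` splits the quotient into constants and multiples of `X - C τ`; up to such
  -- multiples, `f` acts on constants by `ev τ f`.
  let E : (A × (A⟦X⟧ ⧸ Ideal.span {Q})) →ₗ[A] A⟦X⟧ ⧸ I :=
    LinearMap.coprod (Algebra.linearMap A _) T
  have hE : ∀ c x, E (c, Ideal.Quotient.mk _ x) = mk (C c + (X - C τ) * x) := fun c x => by
    rw [LinearMap.coprod_apply, hT, map_add]
    rfl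
  have hbij : Function.Bijective E := by
    constructor
    · rw [injective_iff_map_eq_zero]
      rintro ⟨c, y⟩ hy
      obtain ⟨x, rfl⟩ := Ideal.Quotient.mk_surjective y
      rw [hE, hmk] at hy
      have hc : c = 0 := eq_zero_of_X_sub_C_dvd h
        ((dvd_add_left (dvd_mul_right (X - C τ) x)).1 ((dvd_mul_right _ _).trans hy))
      subst hc
      rw [map_zero, zero_add] at hy
      obtain ⟨z, hz⟩ := hy
      rw [mul_assoc] at hz
      have := X_sub_C_mul_injective h hz
      rw [Prod.mk_eq_zero]
      exact ⟨rfl, Ideal.Quotient.eq_zero_iff_mem.2 (Ideal.mem_span_singleton.2 ⟨z, this⟩)⟩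
    · intro y
      obtain ⟨x, rfl⟩ := Ideal.Quotient.mk_surjective y
      obtain ⟨q, hq⟩ := exists_eq_ev h x
      refine ⟨(ev τ x, Ideal.Quotient.mk _ q), (hE _ _).trans ?_⟩
      rw [← hq]
      rfl
  refine projDet_prod hQ (LinearEquiv.ofBijective E hbij) (LinearMap.mulLeft A (mk f))
    (LinearMap.mulLeft A (Ideal.Quotient.mk _ f)) (ev τ f) (fun y => ?_) ?_
  · obtain ⟨x, rfl⟩ := Ideal.Quotient.mk_surjective y
    change mk f * E _ = E (0, Ideal.Quotient.mk _ f * Ideal.Quotient.mk _ x)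
    rw [← map_mul, hE, hE, ← map_mul]
    congr 1
    simp only [map_zero]
    ring
  · obtain ⟨q, hq⟩ := exists_eq_ev h f
    refine ⟨Ideal.Quotient.mk _ q, ?_⟩
    change mk f * E (1, 0) = E _
    rw [hE, ← hq, ← map_zero (Ideal.Quotient.mk (Ideal.span {Q})), hE]
    simp

/-- The equation of the divisor `τ_1 + ⋯ + τ_m`. -/
def rootProd (l : List A) : A⟦X⟧ := (l.map fun τ => X - C τ).prod

theorem rootProd_nil : rootProd ([] : List A) = 1 := rfl

theorem rootProd_cons (τ : A) (l : List A) : rootProd (τ :: l) = (X - C τ) * rootProd l := by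
  simp [rootProd]

theorem rootProd_append (l l' : List A) : rootProd (l ++ l') = rootProd l * rootProd l' := by
  simp [rootProd]

theorem map_rootProd (φ : A →+* B) (l : List A) :
    PowerSeries.map φ (rootProd l) = rootProd (l.map φ) := by
  induction l with
  | nil => simp [rootProd]
  | cons τ l ih => rw [rootProd_cons, List.map_cons, rootProd_cons, map_mul, ih]; simp

/-- The norm along a sum of points is the product of the values. -/
theorem divisorNorm_rootProd {l : List A} (h : ∀ τ ∈ l, IsNilpotent τ) (f : A⟦X⟧) :
    IsSummand A (A⟦X⟧ ⧸ Ideal.span {rootProd l}) ∧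
      divisorNorm (Ideal.span {rootProd l}) f = (l.map fun τ => ev τ f).prod := by
  induction l with
  | nil =>
    rw [rootProd_nil, Ideal.span_singleton_one]
    have : Subsingleton (A⟦X⟧ ⧸ (⊤ : Ideal A⟦X⟧)) := Ideal.Quotient.subsingleton_iff.2 rfl
    exact ⟨isSummand_of_subsingleton, by rw [divisorNorm_top]; simp⟩
  | cons τ l ih =>
    obtain ⟨h1, h2⟩ := ih fun σ hσ => h σ (List.mem_cons_of_mem _ hσ)
    rw [rootProd_cons, List.map_cons, List.prod_cons, ← h2]
    exact divisorNorm_X_sub_C_mul (h τ List.mem_cons_self) h1 f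

end Eval

/-! ### Splitting monic polynomials over injective extensions -/

section Roots
variable {A : Type u} [CommRing A]

theorem adjoinRoot_of_injective {P : Polynomial A} (hP : P.Monic) (hd : P.natDegree ≠ 0) :
    Function.Injective (AdjoinRoot.of P) := by
  rcases subsingleton_or_nontrivial A with hA | hA
  · exact fun _ _ _ => Subsingleton.elim _ _
  rw [injective_iff_map_eq_zero]
  intro a ha
  by_contra h0
  rw [← AdjoinRoot.mk_C, AdjoinRoot.mk_eq_zero] at ha
  refine hP.not_dvd_of_degree_lt (Polynomial.C_ne_zero.2 h0) ?_ ha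
  refine lt_of_le_of_lt Polynomial.degree_C_le ?_
  rwa [← Polynomial.natDegree_pos_iff_degree_pos, Nat.pos_iff_ne_zero]

/-- A monic polynomial is a product of linear factors over a suitable extension of the ring. -/
theorem exists_roots (n : ℕ) : ∀ (A : Type u) [CommRing A] (P : Polynomial A), P.Monic →
    P.natDegree = n → ∃ (B : Type u) (_ : CommRing B) (φ : A →+* B), Function.Injective φ ∧
      ∃ l : List B, P.map φ = (l.map fun τ => Polynomial.X - Polynomial.C τ).prod := by
  induction n with
  | zero =>
    intro A _ P hP hd
    refine ⟨A, inferInstance, RingHom.id A, Function.injective_id, [], ?_⟩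
    rw [hP.natDegree_eq_zero.1 hd]
    simp
  | succ n ih =>
    intro A _ P hP hd
    rcases subsingleton_or_nontrivial A with hA | hA
    · exact ⟨A, inferInstance, RingHom.id A, Function.injective_id, [], Subsingleton.elim _ _⟩
    have hinj := adjoinRoot_of_injective hP (by omega)
    have : Nontrivial (AdjoinRoot P) := hinj.nontrivial
    have hr : (P.map (AdjoinRoot.of P)).IsRoot (AdjoinRoot.root P) := AdjoinRoot.isRoot_root P
    obtain ⟨Q, hQ⟩ := Polynomial.dvd_iff_isRoot.2 hr
    have hQm : Q.Monic := (Polynomial.monic_X_sub_C _).of_mul_monic_left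
      (by rw [← hQ]; exact hP.map _)
    have hQd : Q.natDegree = n := by
      have := congrArg Polynomial.natDegree hQ
      rw [hP.natDegree_map, (Polynomial.monic_X_sub_C _).natDegree_mul hQm,
        Polynomial.natDegree_X_sub_C, hd] at this
      omega
    obtain ⟨B, _, φ, hφ, l, hl⟩ := ih _ Q hQm hQd
    refine ⟨B, inferInstance, φ.comp (AdjoinRoot.of P), hφ.comp hinj,
      φ (AdjoinRoot.root P) :: l, ?_⟩
    rw [← Polynomial.map_map, hQ, Polynomial.map_mul, hl]
    simp

theorem coe_prod_X_sub_C (l : List A) :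
    (((l.map fun τ => Polynomial.X - Polynomial.C τ).prod : Polynomial A) : A⟦X⟧) =
      rootProd l := by
  induction l with
  | nil => simp [rootProd]
  | cons τ l ih =>
    rw [List.map_cons, List.prod_cons, Polynomial.coe_mul, ih, rootProd_cons, Polynomial.coe_sub,
      Polynomial.coe_X, Polynomial.coe_C]

/-- Evaluation at the root `τ` sends the nilpotent `P - X ^ m` to `-τ ^ m`. -/
theorem isNilpotent_of_mem_roots {P : Polynomial A} {m : ℕ}
    (hP : IsNilpotent (P - Polynomial.X ^ m)) {l : List A}
    (hl : P = (l.map fun τ => Polynomial.X - Polynomial.C τ).prod) {τ : A} (hτ : τ ∈ l) :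
    IsNilpotent τ := by
  have h0 : P.eval τ = 0 := by
    rw [hl, ← Polynomial.coe_evalRingHom, map_list_prod]
    exact List.prod_eq_zero (List.mem_map.2 ⟨Polynomial.X - Polynomial.C τ,
      List.mem_map.2 ⟨τ, hτ, rfl⟩, by simp⟩)
  have h1 := hP.map (Polynomial.evalRingHom τ)
  rw [Polynomial.coe_evalRingHom, Polynomial.eval_sub, h0, zero_sub, isNilpotent_neg_iff,
    Polynomial.eval_pow, Polynomial.eval_X] at h1
  obtain ⟨K, hK⟩ := h1
  exact ⟨m * K, by rw [pow_mul, hK]⟩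

/-- `P` divides `(P - X ^ m) ^ K - (-X ^ m) ^ K`, whose first term vanishes for suitable `K`. -/
theorem dvd_X_pow_of_isNilpotent {P : Polynomial A} {m : ℕ}
    (hP : IsNilpotent (P - Polynomial.X ^ m)) : ∃ M, P ∣ Polynomial.X ^ M := by
  obtain ⟨K, hK⟩ := hP
  refine ⟨m * K, ?_⟩
  have h1 : P ∣ (P - Polynomial.X ^ m) ^ K - (-Polynomial.X ^ m) ^ K := by
    have := sub_dvd_pow_sub_pow (P - Polynomial.X ^ m) (-Polynomial.X ^ m) K
    rwa [sub_neg_eq_add, sub_add_cancel] at this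
  rw [hK, zero_sub, dvd_neg, neg_pow, ← pow_mul] at h1
  have h2 : IsUnit ((-1 : Polynomial A) ^ K) := (isUnit_one.neg).pow K
  exact (h2.dvd_mul_left).1 h1

end Roots

/-! ### Effective line bundles: base change, splitting, additivity of norms -/

section Lattice
variable {A B C : Type u} [CommRing A] [CommRing B] [CommRing C]

theorem exists_sum_of_mem_mul {M N : Submodule A⟦X⟧ A⸨X⸩} {x : A⸨X⸩} (hx : x ∈ M * N) :
    ∃ (ι : Type) (_ : Fintype ι) (a b : ι → A⸨X⸩), (∀ i, a i ∈ M) ∧ (∀ i, b i ∈ N) ∧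
      ∑ i, a i * b i = x := by
  refine Submodule.mul_induction_on hx (fun a ha b hb => ?_) (fun x y hx hy => ?_)
  · exact ⟨Unit, inferInstance, fun _ => a, fun _ => b, fun _ => ha, fun _ => hb, by simp⟩
  · obtain ⟨ι, _, a, b, ha, hb, rfl⟩ := hx
    obtain ⟨κ, _, c, d, hc, hd, rfl⟩ := hy
    exact ⟨ι ⊕ κ, inferInstance, Sum.elim a c, Sum.elim b d, Sum.rec ha hc, Sum.rec hb hd,
      by simp⟩

theorem inv_mul_mem (Λ : (Submodule A⟦X⟧ A⸨X⸩)ˣ) {a x : A⸨X⸩}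
    (ha : a ∈ (↑Λ⁻¹ : Submodule A⟦X⟧ A⸨X⸩)) (hx : x ∈ (Λ : Submodule A⟦X⟧ A⸨X⸩)) :
    ∃ f, algebraMap A⟦X⟧ A⸨X⸩ f = a * x := by
  have := Submodule.mul_mem_mul ha hx
  rwa [Units.inv_mul, Submodule.mem_one] at this

theorem exists_dual (Λ : (Submodule A⟦X⟧ A⸨X⸩)ˣ) :
    ∃ (ι : Type) (_ : Fintype ι) (a b : ι → A⸨X⸩),
      (∀ i, a i ∈ (↑Λ⁻¹ : Submodule A⟦X⟧ A⸨X⸩)) ∧ (∀ i, b i ∈ (Λ : Submodule A⟦X⟧ A⸨X⸩)) ∧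
      ∑ i, a i * b i = 1 := by
  refine exists_sum_of_mem_mul ?_
  rw [Units.inv_mul]
  exact Submodule.mem_one.2 ⟨1, map_one _⟩

/-- An invertible submodule is the dual of its inverse. Membership thus becomes the vanishing of
negative coefficients of Laurent series, which can be tested coefficient by coefficient after base
change. -/
theorem mem_unit_iff (Λ : (Submodule A⟦X⟧ A⸨X⸩)ˣ) (x : A⸨X⸩) :
    x ∈ (Λ : Submodule A⟦X⟧ A⸨X⸩) ↔
      ∀ a ∈ (↑Λ⁻¹ : Submodule A⟦X⟧ A⸨X⸩), ∃ f, algebraMap A⟦X⟧ A⸨X⸩ f = a * x := by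
  refine ⟨fun hx a ha => inv_mul_mem Λ ha hx, fun h => ?_⟩
  obtain ⟨ι, _, a, b, ha, hb, hab⟩ := exists_dual Λ
  have e : x = ∑ i, (a i * x) * b i := calc
    x = (∑ i, a i * b i) * x := by rw [hab, one_mul]
    _ = ∑ i, (a i * x) * b i := by
      rw [Finset.sum_mul]
      exact Finset.sum_congr rfl fun i _ => by ring
  rw [e]
  refine Submodule.sum_mem _ fun i _ => ?_
  obtain ⟨f, hf⟩ := h _ (ha i)
  rw [← hf, ← Algebra.smul_def]
  exact Submodule.smul_mem _ _ (hb i)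

/-- Membership in a line bundle can be checked after base changes that jointly detect the
elements of `A`. -/
theorem mem_of_baseChange (Λ : (Submodule A⟦X⟧ A⸨X⸩)ˣ) (x : A⸨X⸩)
    (h : ∀ a : A, a ≠ 0 → ∃ (B : Type u) (_ : CommRing B) (φ : A →+* B), φ a ≠ 0 ∧
      mapLaurent φ x ∈ baseChange φ Λ) : x ∈ (Λ : Submodule A⟦X⟧ A⸨X⸩) := by
  rw [mem_unit_iff]
  intro a ha
  rw [exists_algebraMap_iff]
  intro n hn
  by_contra h0
  obtain ⟨B, _, φ, hφ, hx⟩ := h _ h0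
  refine hφ ?_
  rw [← mapLaurent_coeff, map_mul]
  exact (exists_algebraMap_iff _).1 (inv_mul_mem (Units.map (baseChange φ) Λ)
    (mem_baseChange φ ha) hx) n hn

theorem baseChange_span_singleton (φ : A →+* B) (x : A⸨X⸩) :
    baseChange φ (Submodule.span A⟦X⟧ {x}) = Submodule.span B⟦X⟧ {mapLaurent φ x} := by
  refine le_antisymm (Submodule.span_le.2 ?_) (Submodule.span_le.2 ?_)
  · rintro _ ⟨y, hy, rfl⟩
    obtain ⟨a, rfl⟩ := Submodule.mem_span_singleton.1 hy
    rw [mapLaurent_smul]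
    exact Submodule.smul_mem _ _ (Submodule.mem_span_singleton_self _)
  · rintro _ rfl
    exact mem_baseChange φ (Submodule.mem_span_singleton_self x)

/-- Base change of effective divisors. -/
def mapPos (φ : A →+* B) : grPos A →* grPos B :=
  ((Units.map (baseChange φ)).comp (grPos A).subtype).codRestrict (grPos B)
    (fun Λ => grPos_map φ Λ.2)

theorem coe_mapPos (φ : A →+* B) (Λ : grPos A) :
    (mapPos φ Λ).1 = Units.map (baseChange φ) Λ.1 := rfl

theorem mapPos_comp (φ : A →+* B) (ψ : B →+* C) (Λ : grPos A) :
    mapPos (ψ.comp φ) Λ = mapPos ψ (mapPos φ Λ) :=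
  Subtype.ext (Units.ext (baseChange_comp _ _ _))

theorem regular_of_mem_inv (Λ : grPos A) {a : A⸨X⸩}
    (ha : a ∈ (↑Λ.1⁻¹ : Submodule A⟦X⟧ A⸨X⸩)) : ∃ f, algebraMap A⟦X⟧ A⸨X⸩ f = a := by
  have := inv_mul_mem Λ.1 ha Λ.2
  rwa [mul_one] at this

theorem mem_latticeDivisor {Λ : grPos A} {f : A⟦X⟧} : f ∈ latticeDivisor Λ ↔
    algebraMap A⟦X⟧ A⸨X⸩ f ∈ (↑Λ.1⁻¹ : Submodule A⟦X⟧ A⸨X⸩) := Iff.rfl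

theorem map_mem_latticeDivisor (φ : A →+* B) {Λ : grPos A} {f : A⟦X⟧}
    (hf : f ∈ latticeDivisor Λ) : PowerSeries.map φ f ∈ latticeDivisor (mapPos φ Λ) := by
  rw [mem_latticeDivisor, ← mapLaurent_coe]
  exact mem_baseChange φ hf

/-- A decomposition of `1` in `Λ⁻¹ * Λ` is a dual basis whose image is again one after any base
change; compatibility of norms with base change rests on this. -/
theorem exists_isDualBasis (Λ : grPos A) :
    ∃ (ι : Type) (_ : Fintype ι) (α : ι → A⟦X⟧) (b : ι → A⸨X⸩),
      IsDualBasis (latticeDivisor Λ) α b ∧ ∀ (B : Type u) [CommRing B] (φ : A →+* B),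
        IsDualBasis (latticeDivisor (mapPos φ Λ)) (fun i => PowerSeries.map φ (α i))
          (fun i => mapLaurent φ (b i)) := by
  obtain ⟨ι, _, a, b, ha, hb, hab⟩ := exists_dual Λ.1
  choose α hα using fun i => regular_of_mem_inv Λ (ha i)
  obtain rfl : (fun i => algebraMap A⟦X⟧ A⸨X⸩ (α i)) = a := funext hα
  refine ⟨ι, inferInstance, α, b, ⟨ha, fun i x hx => ?_, hab⟩, fun B _ φ => ⟨fun i =>
    map_mem_latticeDivisor φ (ha i), fun i x hx => ?_, ?_⟩⟩
  · rw [mul_comm]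
    exact inv_mul_mem Λ.1 hx (hb i)
  · rw [mul_comm]
    exact inv_mul_mem (mapPos φ Λ).1 hx (mem_baseChange φ (hb i))
  · simp only [← mapLaurent_coe, ← map_mul, ← map_sum, hab, map_one]

theorem isSummand_latticeDivisor (Λ : grPos A) : IsSummand A (A⟦X⟧ ⧸ latticeDivisor Λ) := by
  obtain ⟨ι, _, α, b, h, -⟩ := exists_isDualBasis Λ
  exact h.isSummand

/-- The norm along the divisor of a point of `Gr^pos`. -/
def latticeNorm (Λ : grPos A) (f : A⟦X⟧) : A := divisorNorm (latticeDivisor Λ) f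

theorem latticeNorm_map (φ : A →+* B) (Λ : grPos A) (f : A⟦X⟧) :
    latticeNorm (mapPos φ Λ) (PowerSeries.map φ f) = φ (latticeNorm Λ f) := by
  obtain ⟨ι, _, α, b, h, h'⟩ := exists_isDualBasis Λ
  exact divisorNorm_map φ h (h' B φ) (fun x hx => map_mem_latticeDivisor φ hx) f

theorem latticeNorm_mul_right (Λ : grPos A) (f g : A⟦X⟧) :
    latticeNorm Λ (f * g) = latticeNorm Λ f * latticeNorm Λ g :=
  divisorNorm_mul (isSummand_latticeDivisor Λ) f g

theorem latticeNorm_one_right (Λ : grPos A) : latticeNorm Λ 1 = 1 :=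
  divisorNorm_one (isSummand_latticeDivisor Λ)

theorem latticeNorm_one_left (f : A⟦X⟧) : latticeNorm (1 : grPos A) f = 1 := by
  have : latticeDivisor (1 : grPos A) = ⊤ := by
    rw [Ideal.eq_top_iff_one, mem_latticeDivisor]
    change _ ∈ (((1 : (Submodule A⟦X⟧ A⸨X⸩)ˣ)⁻¹ : (Submodule A⟦X⟧ A⸨X⸩)ˣ) : Submodule A⟦X⟧ A⸨X⸩)
    rw [inv_one, Units.val_one]
    exact Submodule.mem_one.2 ⟨1, rfl⟩
  rw [latticeNorm, this, divisorNorm_top]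

theorem latticeDivisor_eq_span {Λ : grPos A} {P : A⟦X⟧} (h : (↑Λ.1⁻¹ : Submodule A⟦X⟧ A⸨X⸩) =
    Submodule.span A⟦X⟧ {algebraMap A⟦X⟧ A⸨X⸩ P}) : latticeDivisor Λ = Ideal.span {P} := by
  ext f
  rw [mem_latticeDivisor, h, Submodule.mem_span_singleton, Ideal.mem_span_singleton']
  refine exists_congr fun a => ?_
  rw [Algebra.smul_def, ← map_mul, algebraMap_injective.eq_iff]

theorem inv_eq_span {Λ : grPos A} {P : A⟦X⟧} (h : latticeDivisor Λ = Ideal.span {P}) :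
    (↑Λ.1⁻¹ : Submodule A⟦X⟧ A⸨X⸩) = Submodule.span A⟦X⟧ {algebraMap A⟦X⟧ A⸨X⸩ P} := by
  refine le_antisymm (fun x hx => ?_) ?_
  · obtain ⟨f, rfl⟩ := regular_of_mem_inv Λ hx
    have hf : f ∈ latticeDivisor Λ := hx
    rw [h, Ideal.mem_span_singleton'] at hf
    obtain ⟨a, rfl⟩ := hf
    rw [map_mul, ← Algebra.smul_def]
    exact Submodule.smul_mem _ _ (Submodule.mem_span_singleton_self _)
  · rw [Submodule.span_le]
    rintro _ rfl
    have : P ∈ latticeDivisor Λ := by rw [h]; exact Ideal.mem_span_singleton_self P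
    exact this

/-- `Λ` is the line bundle of the divisor `τ_1 + ⋯ + τ_m`, where `l = [τ_1, …, τ_m]`. -/
structure IsSplit (Λ : grPos A) (l : List A) : Prop where
  nilpotent : ∀ τ ∈ l, IsNilpotent τ
  inv_eq : (↑Λ.1⁻¹ : Submodule A⟦X⟧ A⸨X⸩) =
    Submodule.span A⟦X⟧ {algebraMap A⟦X⟧ A⸨X⸩ (rootProd l)}

namespace IsSplit
variable {Λ Λ' : grPos A} {l l' : List A}

theorem map (h : IsSplit Λ l) (φ : A →+* B) : IsSplit (mapPos φ Λ) (l.map φ) where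
  nilpotent τ hτ := by
    obtain ⟨σ, hσ, rfl⟩ := List.mem_map.1 hτ
    exact (h.nilpotent σ hσ).map φ
  inv_eq := by
    change baseChange φ (↑Λ.1⁻¹ : Submodule A⟦X⟧ A⸨X⸩) = _
    rw [h.inv_eq, baseChange_span_singleton, mapLaurent_coe, map_rootProd]

theorem mul (h : IsSplit Λ l) (h' : IsSplit Λ' l') : IsSplit (Λ * Λ') (l ++ l') where
  nilpotent τ hτ := (List.mem_append.1 hτ).elim (h.nilpotent τ) (h'.nilpotent τ)
  inv_eq := by
    change (((Λ.1 * Λ'.1)⁻¹ : (Submodule A⟦X⟧ A⸨X⸩)ˣ) : Submodule A⟦X⟧ A⸨X⸩) = _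
    rw [mul_inv_rev, Units.val_mul, h.inv_eq, h'.inv_eq, Submodule.span_mul_span,
      Set.singleton_mul_singleton, ← map_mul, rootProd_append, mul_comm]

theorem latticeNorm_eq (h : IsSplit Λ l) (f : A⟦X⟧) :
    latticeNorm Λ f = (l.map fun τ => ev τ f).prod := by
  rw [latticeNorm, latticeDivisor_eq_span h.inv_eq]
  exact (divisorNorm_rootProd h.nilpotent f).2

end IsSplit

/-- Over a local ring the finite projective module `A⟦X⟧ / I` is free. The characteristic polynomial
of multiplication by `X` lies in `I` by Cayley-Hamilton and is a power of `X` up to nilpotents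
because `X` acts nilpotently; a comparison of ranks shows that it generates `I`. -/
theorem exists_polynomial_of_isLocalRing [IsLocalRing A] (Λ : grPos A) :
    ∃ (P : Polynomial A) (m : ℕ), P.Monic ∧ IsNilpotent (P - Polynomial.X ^ m) ∧
      latticeDivisor Λ = Ideal.span {(P : A⟦X⟧)} := by
  obtain ⟨ι, _, α, b, h, -⟩ := exists_isDualBasis Λ
  generalize latticeDivisor Λ = I at h ⊢
  obtain ⟨N, hN⟩ := h.exists_pow_mem
  obtain ⟨i, -, hip⟩ := h.exists_retraction hN
  have hsurj : Function.Surjective ((Ideal.Quotient.mkₐ A I).toLinearMap ∘ₗ ofCoeffs N) :=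
    fun y => ⟨i y, LinearMap.congr_fun hip y⟩
  have hfin : Module.Finite A (A⟦X⟧ ⧸ I) := Module.Finite.of_surjective _ hsurj
  have hproj : Module.Projective A (A⟦X⟧ ⧸ I) := Module.Projective.of_split i _ hip
  have hfree : Module.Free A (A⟦X⟧ ⧸ I) := Module.free_of_flat_of_isLocalRing
  let T : Module.End A (A⟦X⟧ ⧸ I) := Algebra.lmul A (A⟦X⟧ ⧸ I) (Ideal.Quotient.mk I X)
  have hT : IsNilpotent T := by
    refine ⟨N, ?_⟩
    rw [← map_pow, ← map_pow, Ideal.Quotient.eq_zero_iff_mem.2 hN, map_zero]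
  let bas := Module.Free.chooseBasis A (A⟦X⟧ ⧸ I)
  set m := Fintype.card (Module.Free.ChooseBasisIndex A (A⟦X⟧ ⧸ I)) with hm
  have hP : T.charpoly.Monic := LinearMap.charpoly_monic T
  have hd : T.charpoly.natDegree = m := by
    rw [LinearMap.charpoly_natDegree, Module.finrank_eq_card_chooseBasisIndex]
  have hnil : IsNilpotent (T.charpoly - Polynomial.X ^ m) :=
    Matrix.isNilpotent_charpoly_sub_pow_of_isNilpotent
      (hT.map (LinearMap.toMatrixAlgEquiv bas))
  have hmk : ∀ Q : Polynomial A, Ideal.Quotient.mk I (Q : A⟦X⟧) =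
      Polynomial.aeval (Ideal.Quotient.mk I X) Q := fun Q => by
    induction Q using Polynomial.induction_on' with
    | add p q hp hq => rw [Polynomial.coe_add, map_add, hp, hq, map_add]
    | monomial n a =>
      rw [Polynomial.coe_monomial, Polynomial.aeval_monomial,
        PowerSeries.monomial_eq_C_mul_X_pow, map_mul, map_pow]
      rfl
  have hPI : (T.charpoly : A⟦X⟧) ∈ I := by
    rw [← Ideal.Quotient.eq_zero_iff_mem, hmk]
    have h1 := LinearMap.aeval_self_charpoly T
    have h2 : Polynomial.aeval T T.charpoly = Algebra.lmul A (A⟦X⟧ ⧸ I)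
        (Polynomial.aeval (Ideal.Quotient.mk I X) T.charpoly) :=
      Polynomial.aeval_algHom_apply (Algebra.lmul A (A⟦X⟧ ⧸ I)) _ _
    rw [h1] at h2
    have h3 := LinearMap.congr_fun h2 1
    simpa using h3.symm
  obtain ⟨M, hM⟩ := dvd_X_pow_of_isNilpotent hnil
  have hM' : (T.charpoly : A⟦X⟧) ∣ X ^ M := by
    obtain ⟨Q, hQ⟩ := hM
    exact ⟨Q, by rw [← Polynomial.coe_mul, ← hQ, Polynomial.coe_pow, Polynomial.coe_X]⟩
  -- division with remainder
  have hdiv : ∀ x : A⟦X⟧, ∃ c : Fin m → A, (T.charpoly : A⟦X⟧) ∣ x - ofCoeffs m c := fun x => by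
    let r := (PowerSeries.trunc M x) %ₘ T.charpoly
    have hr : r.degree < m := by
      have := Polynomial.degree_modByMonic_lt (PowerSeries.trunc M x) hP
      rwa [Polynomial.degree_eq_natDegree hP.ne_zero, hd] at this
    refine ⟨fun j => r.coeff j, ?_⟩
    have e1 : (ofCoeffs m (fun j => r.coeff j) : A⟦X⟧) = (r : A⟦X⟧) := by
      obtain ⟨y, hy⟩ := ofCoeffs_truncLin m (r : A⟦X⟧)
      have e : truncLin m (r : A⟦X⟧) = fun j : Fin m => r.coeff j := by
        ext j; exact Polynomial.coeff_coe r _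
      rw [← e]
      ext n
      rw [ofCoeffs, Fintype.linearCombination_apply, map_sum, Polynomial.coeff_coe]
      by_cases hn : n < m
      · rw [Finset.sum_eq_single (⟨n, hn⟩ : Fin m)]
        · simp [truncLin]
        · intro j _ hj
          have : n ≠ (j : ℕ) := fun e => hj (Fin.ext e.symm)
          simp [PowerSeries.coeff_X_pow, this]
        · simp
      · rw [Polynomial.coeff_eq_zero_of_degree_lt
          (lt_of_lt_of_le hr (by exact_mod_cast not_lt.1 hn))]
        refine Finset.sum_eq_zero fun j _ => ?_
        have : n ≠ (j : ℕ) := by have := j.2; omega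
        simp [PowerSeries.coeff_X_pow, this]
    have e2 : (PowerSeries.trunc M x : A⟦X⟧) - (r : A⟦X⟧) =
        (T.charpoly : A⟦X⟧) * ((PowerSeries.trunc M x /ₘ T.charpoly : Polynomial A) : A⟦X⟧) := by
      rw [← Polynomial.coe_sub, ← Polynomial.coe_mul]
      congr 1
      rw [sub_eq_iff_eq_add, add_comm]
      exact (Polynomial.modByMonic_add_div _ _).symm
    have e3 : (X ^ M : A⟦X⟧) ∣ x - (PowerSeries.trunc M x : A⟦X⟧) := by
      rw [PowerSeries.X_pow_dvd_iff]
      intro n hn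
      rw [map_sub, Polynomial.coeff_coe, PowerSeries.coeff_trunc, if_pos hn, sub_self]
    rw [e1]
    have e4 : x - (r : A⟦X⟧) = (x - (PowerSeries.trunc M x : A⟦X⟧)) +
        ((PowerSeries.trunc M x : A⟦X⟧) - (r : A⟦X⟧)) := by ring
    rw [e4, e2]
    exact dvd_add (hM'.trans e3) (dvd_mul_right _ _)
  let S : (Fin m → A) →ₗ[A] (A⟦X⟧ ⧸ I) := (Ideal.Quotient.mkₐ A I).toLinearMap ∘ₗ ofCoeffs m
  have hS : Function.Surjective S := fun y => by
    obtain ⟨x, rfl⟩ := Ideal.Quotient.mk_surjective y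
    obtain ⟨c, hc⟩ := hdiv x
    refine ⟨c, ?_⟩
    change Ideal.Quotient.mk I _ = _
    rw [Ideal.Quotient.eq, ← neg_sub, neg_mem_iff]
    exact Ideal.mem_of_dvd _ hc hPI
  -- A surjection between free modules of the same finite rank is injective, so the only remainder
  -- of degree `< m` in `I` is zero.
  have hSinj : Function.Injective S := by
    let e : (A⟦X⟧ ⧸ I) ≃ₗ[A] (Fin m → A) :=
      (bas.reindex (Fintype.equivFin _)).equivFun
    have := OrzechProperty.injective_of_surjective_endomorphism (e.toLinearMap ∘ₗ S)
      (e.surjective.comp hS)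
    exact Function.Injective.of_comp (f := e) this
  refine ⟨T.charpoly, m, hP, hnil, le_antisymm (fun x hx => ?_) ?_⟩
  · obtain ⟨c, hc⟩ := hdiv x
    have h0 : S c = 0 := by
      change Ideal.Quotient.mk I _ = 0
      rw [Ideal.Quotient.eq_zero_iff_mem]
      have h1 := Ideal.sub_mem _ hx (Ideal.mem_of_dvd _ hc hPI)
      rwa [sub_sub_cancel] at h1
    have hc0 : c = 0 := hSinj (by rw [h0, map_zero])
    rw [hc0, map_zero, sub_zero] at hc
    exact Ideal.mem_span_singleton.2 hc
  · rw [Ideal.span_le]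
    rintro _ rfl
    exact hPI

theorem exists_isSplit_of_polynomial {Λ : grPos A} {P : Polynomial A} {m : ℕ} (hP : P.Monic)
    (hn : IsNilpotent (P - Polynomial.X ^ m)) (hΛ : latticeDivisor Λ = Ideal.span {(P : A⟦X⟧)}) :
    ∃ (B : Type u) (_ : CommRing B) (φ : A →+* B), Function.Injective φ ∧
      ∃ l, IsSplit (mapPos φ Λ) l := by
  obtain ⟨B, _, φ, hφ, l, hl⟩ := exists_roots _ A P hP rfl
  refine ⟨B, inferInstance, φ, hφ, l, fun τ hτ => ?_, ?_⟩
  · refine isNilpotent_of_mem_roots (m := m) (P := P.map φ) ?_ hl hτ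
    have := hn.map (Polynomial.mapRingHom φ)
    simpa using this
  · change baseChange φ (↑Λ.1⁻¹ : Submodule A⟦X⟧ A⸨X⸩) = _
    rw [inv_eq_span hΛ, baseChange_span_singleton, mapLaurent_coe, ← Polynomial.polynomial_map_coe,
      hl, coe_prod_X_sub_C]

/-- Two effective divisors split after base changes that jointly detect the elements of `A`. -/
theorem exists_isSplit (Λ Λ' : grPos A) {a : A} (ha : a ≠ 0) :
    ∃ (B : Type u) (_ : CommRing B) (φ : A →+* B), φ a ≠ 0 ∧
      (∃ l, IsSplit (mapPos φ Λ) l) ∧ ∃ l, IsSplit (mapPos φ Λ') l := by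
  -- Some localization at a maximal ideal keeps `a` nonzero; the extensions that then split the two
  -- polynomials, one after the other, are injective.
  obtain ⟨J, hJ, h0⟩ : ∃ (J : Ideal A) (_ : J.IsMaximal),
      algebraMap A (Localization.AtPrime J) a ≠ 0 := by
    by_contra! h
    exact ha (eq_zero_of_localization a fun J hJ => h J hJ)
  obtain ⟨P, m, hP, hn, hΛ⟩ :=
    exists_polynomial_of_isLocalRing (mapPos (algebraMap A (Localization.AtPrime J)) Λ)
  obtain ⟨P', m', hP', hn', hΛ'⟩ :=
    exists_polynomial_of_isLocalRing (mapPos (algebraMap A (Localization.AtPrime J)) Λ')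
  obtain ⟨B, _, φ, hφ, l, hl⟩ := exists_isSplit_of_polynomial hP hn hΛ
  have hΛ2 : latticeDivisor (mapPos φ (mapPos (algebraMap A (Localization.AtPrime J)) Λ')) =
      Ideal.span {((P'.map φ : Polynomial B) : B⟦X⟧)} := by
    refine latticeDivisor_eq_span ?_
    change baseChange φ (↑(mapPos (algebraMap A (Localization.AtPrime J)) Λ').1⁻¹ :
      Submodule (Localization.AtPrime J)⟦X⟧ (Localization.AtPrime J)⸨X⸩) = _
    rw [inv_eq_span hΛ', baseChange_span_singleton, mapLaurent_coe, ← Polynomial.polynomial_map_coe]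
  obtain ⟨D, _, ψ, hψ, l', hl'⟩ := exists_isSplit_of_polynomial (m := m') (hP'.map φ) (by
    have := hn'.map (Polynomial.mapRingHom φ)
    simpa using this) hΛ2
  refine ⟨D, inferInstance, (ψ.comp φ).comp (algebraMap A (Localization.AtPrime J)), fun h => ?_,
    ⟨l.map ψ, ?_⟩, ⟨l', ?_⟩⟩
  · refine h0 (hφ (hψ (Eq.trans h ?_)))
    rw [map_zero, map_zero]
  · rw [mapPos_comp, mapPos_comp]
    exact hl.map ψ
  · rw [mapPos_comp, mapPos_comp]
    exact hl'

/-- Norms are additive in the divisor. -/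
theorem latticeNorm_mul_left (Λ Λ' : grPos A) (f : A⟦X⟧) :
    latticeNorm (Λ * Λ') f = latticeNorm Λ f * latticeNorm Λ' f := by
  -- A nonzero difference of the two sides would survive in a ring where both divisors split, and
  -- there norms are products of values.
  by_contra h
  obtain ⟨B, _, φ, h0, ⟨l, hl⟩, ⟨l', hl'⟩⟩ := exists_isSplit Λ Λ' (sub_ne_zero.2 h)
  refine h0 ?_
  rw [map_sub, map_mul, ← latticeNorm_map, ← latticeNorm_map, ← latticeNorm_map, map_mul,
    (hl.mul hl').latticeNorm_eq, hl.latticeNorm_eq, hl'.latticeNorm_eq, List.map_append,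
    List.prod_append, sub_self]

end Lattice

/-! ### Twisting by the divisor `t = 0` and the norm on `Gr` -/

section Principal
variable {A B : Type u} [CommRing A] [CommRing B]

/-- The line bundle generated by an invertible Laurent series. -/
def principal : A⸨X⸩ˣ →* (Submodule A⟦X⟧ A⸨X⸩)ˣ :=
  Units.map
    { toFun := fun x => Submodule.span A⟦X⟧ {x}
      map_one' := Submodule.one_eq_span.symm
      map_mul' := fun x y => by rw [Submodule.span_mul_span, Set.singleton_mul_singleton] }

theorem coe_principal (g : A⸨X⸩ˣ) : (principal g : Submodule A⟦X⟧ A⸨X⸩) =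
    Submodule.span A⟦X⟧ {(g : A⸨X⸩)} := rfl

theorem map_principal (φ : A →+* B) (g : A⸨X⸩ˣ) :
    Units.map (baseChange φ) (principal g) =
      principal (Units.map (mapLaurent φ).toMonoidHom g) :=
  Units.ext (baseChange_span_singleton φ g)

/-- The coordinate `t` as an invertible Laurent series. -/
def unitT : A⸨X⸩ˣ where
  val := HahnSeries.single 1 1
  inv := HahnSeries.single (-1) 1
  val_inv := by rw [HahnSeries.single_mul_single]; simp
  inv_val := by rw [HahnSeries.single_mul_single]; simp

theorem coe_unitT : ((unitT : A⸨X⸩ˣ) : A⸨X⸩) = algebraMap A⟦X⟧ A⸨X⸩ X := by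
  have := algebraMap_X_pow (A := A) 1
  rw [pow_one] at this
  exact this.symm

theorem map_unitT (φ : A →+* B) : Units.map (mapLaurent φ).toMonoidHom unitT = unitT := by
  refine Units.ext ?_
  change mapLaurent φ (unitT : A⸨X⸩ˣ) = _
  rw [coe_unitT, coe_unitT, mapLaurent_coe, PowerSeries.map_X]

variable (A) in
/-- The line bundle `O(0) = t⁻¹ A⟦t⟧` of the divisor `t = 0`. -/
def twist : grPos A := ⟨principal unitT⁻¹, by
  change (1 : A⸨X⸩) ∈ ((principal unitT⁻¹ : (Submodule A⟦X⟧ A⸨X⸩)ˣ) : Submodule A⟦X⟧ A⸨X⸩)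
  rw [coe_principal, Submodule.mem_span_singleton]
  exact ⟨X, by rw [Algebra.smul_def, ← coe_unitT, Units.mul_inv]⟩⟩

theorem coe_twist_pow (N : ℕ) : (twist A ^ N).1 = principal (unitT⁻¹ ^ N) := by
  rw [SubmonoidClass.coe_pow, map_pow]
  rfl

theorem mapPos_twist (φ : A →+* B) : mapPos φ (twist A) = twist B := by
  refine Subtype.ext ?_
  rw [coe_mapPos]
  change Units.map (baseChange φ) (principal unitT⁻¹) = principal unitT⁻¹
  rw [map_principal, map_inv, map_unitT]

theorem isSplit_twist : IsSplit (twist A) [0] where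
  nilpotent τ hτ := by rw [List.mem_singleton.1 hτ]; exact IsNilpotent.zero
  inv_eq := by
    change (((principal unitT⁻¹)⁻¹ : (Submodule A⟦X⟧ A⸨X⸩)ˣ) : Submodule A⟦X⟧ A⸨X⸩) = _
    rw [← map_inv, inv_inv, coe_principal, coe_unitT, rootProd_cons, rootProd_nil]
    simp

theorem latticeNorm_twist (f : A⟦X⟧) : latticeNorm (twist A) f = constantCoeff f := by
  rw [isSplit_twist.latticeNorm_eq]
  simp [ev_zero]

theorem latticeNorm_twist_pow (N : ℕ) (f : A⟦X⟧) :
    latticeNorm (twist A ^ N) f = constantCoeff f ^ N := by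
  induction N with
  | zero => rw [pow_zero, pow_zero, latticeNorm_one_left]
  | succ N ih => rw [pow_succ, latticeNorm_mul_left, ih, latticeNorm_twist, pow_succ]

/-- A line bundle becomes effective after adding a multiple of the divisor `t = 0`. -/
theorem exists_mul_twist_mem (Λ : (Submodule A⟦X⟧ A⸨X⸩)ˣ) :
    ∃ N, Λ * (twist A ^ N).1 ∈ grPos A := by
  obtain ⟨ι, _, a, b, ha, hb, hab⟩ := exists_dual Λ
  choose N hN using fun i => exists_pow_mul (a i)
  choose f hf using fun i => hN i (∑ j, N j) (Finset.single_le_sum (fun j _ => Nat.zero_le (N j))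
    (Finset.mem_univ i))
  refine ⟨∑ j, N j, ?_⟩
  generalize (∑ j, N j) = M at hf
  -- All `X ^ M * a i` are integral, and `X ^ M = ∑ (X ^ M * a i) * b i`.
  have h1 : algebraMap A⟦X⟧ A⸨X⸩ (X ^ M) ∈ (Λ : Submodule A⟦X⟧ A⸨X⸩) := by
    have e : algebraMap A⟦X⟧ A⸨X⸩ (X ^ M) = ∑ i, f i • b i := calc
      algebraMap A⟦X⟧ A⸨X⸩ (X ^ M) = algebraMap A⟦X⟧ A⸨X⸩ (X ^ M) * ∑ i, a i * b i := by
        rw [hab, mul_one]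
      _ = _ := by
        rw [Finset.mul_sum]
        exact Finset.sum_congr rfl fun i _ => by rw [Algebra.smul_def, hf, mul_assoc]
    rw [e]
    exact Submodule.sum_mem _ fun i _ => Submodule.smul_mem _ _ (hb i)
  change (1 : A⸨X⸩) ∈ (Λ : Submodule A⟦X⟧ A⸨X⸩) * ((twist A ^ M).1 : Submodule A⟦X⟧ A⸨X⸩)
  have h2 : ((unitT⁻¹ ^ M : A⸨X⸩ˣ) : A⸨X⸩) ∈ ((twist A ^ M).1 : Submodule A⟦X⟧ A⸨X⸩) := by
    rw [coe_twist_pow, coe_principal]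
    exact Submodule.mem_span_singleton_self _
  have h3 := Submodule.mul_mem_mul h1 h2
  rwa [map_pow, ← coe_unitT, ← Units.val_pow_eq_pow_val, inv_pow, Units.mul_inv] at h3

/-- Both sides are the norm along `Λ` twisted `N + M` times. Hence `grNorm` does not depend on the
twist chosen to make `Λ` effective. -/
theorem latticeNorm_mul_twist_comm {Λ : (Submodule A⟦X⟧ A⸨X⸩)ˣ} {N M : ℕ}
    (hN : Λ * (twist A ^ N).1 ∈ grPos A) (hM : Λ * (twist A ^ M).1 ∈ grPos A) (f : A⟦X⟧) :
    latticeNorm ⟨_, hN⟩ f * constantCoeff f ^ M = latticeNorm ⟨_, hM⟩ f * constantCoeff f ^ N := by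
  rw [← latticeNorm_twist_pow, ← latticeNorm_twist_pow, ← latticeNorm_mul_left,
    ← latticeNorm_mul_left]
  congr 1
  exact Subtype.ext (Units.ext (mul_right_comm (Λ : Submodule A⟦X⟧ A⸨X⸩) _ _))

/-- The constant coefficient of an invertible power series. -/
def constUnit : A⟦X⟧ˣ →* Aˣ := Units.map (constantCoeff (R := A)).toMonoidHom

theorem coe_constUnit (f : A⟦X⟧ˣ) : (constUnit f : A) = constantCoeff (f : A⟦X⟧) := rfl

/-- The norm pairing of `Gr` with `𝔏⁺𝔾_m`. -/
def grNorm (Λ : (Submodule A⟦X⟧ A⸨X⸩)ˣ) (f : A⟦X⟧ˣ) : A :=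
  latticeNorm ⟨_, (exists_mul_twist_mem Λ).choose_spec⟩ (f : A⟦X⟧) *
    (((constUnit f)⁻¹ ^ (exists_mul_twist_mem Λ).choose : Aˣ) : A)

theorem grNorm_eq {Λ : (Submodule A⟦X⟧ A⸨X⸩)ˣ} {N : ℕ} (hN : Λ * (twist A ^ N).1 ∈ grPos A)
    (f : A⟦X⟧ˣ) : grNorm Λ f =
      latticeNorm ⟨_, hN⟩ (f : A⟦X⟧) * (((constUnit f)⁻¹ ^ N : Aˣ) : A) := by
  have h := latticeNorm_mul_twist_comm (exists_mul_twist_mem Λ).choose_spec hN f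
  rw [← coe_constUnit, ← Units.val_pow_eq_pow_val, ← Units.val_pow_eq_pow_val] at h
  rw [grNorm, inv_pow, inv_pow, Units.mul_inv_eq_iff_eq_mul, mul_right_comm, ← h, mul_assoc,
    Units.mul_inv, mul_one]

theorem grNorm_mul_const_pow {Λ : (Submodule A⟦X⟧ A⸨X⸩)ˣ} {N : ℕ}
    (hN : Λ * (twist A ^ N).1 ∈ grPos A) (f : A⟦X⟧ˣ) :
    grNorm Λ f * constantCoeff (f : A⟦X⟧) ^ N = latticeNorm ⟨_, hN⟩ (f : A⟦X⟧) := by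
  rw [grNorm_eq hN, ← coe_constUnit, ← Units.val_pow_eq_pow_val, inv_pow,
    Units.inv_mul_cancel_right]

theorem grNorm_coe (Λ : grPos A) (f : A⟦X⟧ˣ) : grNorm Λ.1 f = latticeNorm Λ (f : A⟦X⟧) := by
  have e : Λ.1 * (twist A ^ 0).1 = Λ.1 := mul_one _
  have h : Λ.1 * (twist A ^ 0).1 ∈ grPos A := by rw [e]; exact Λ.2
  have e2 : (((constUnit f)⁻¹ ^ 0 : Aˣ) : A) = 1 := by rw [pow_zero, Units.val_one]
  rw [grNorm_eq h, e2, mul_one]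
  congr 1
  exact Subtype.ext e

theorem map_mul_twist_mem (φ : A →+* B) {Λ : (Submodule A⟦X⟧ A⸨X⸩)ˣ} {N : ℕ}
    (hN : Λ * (twist A ^ N).1 ∈ grPos A) :
    ∃ h : Units.map (baseChange φ) Λ * (twist B ^ N).1 ∈ grPos B,
      (⟨_, h⟩ : grPos B) = mapPos φ ⟨_, hN⟩ := by
  have e : Units.map (baseChange φ) Λ * (twist B ^ N).1 = (mapPos φ ⟨_, hN⟩).1 := by
    rw [coe_mapPos, map_mul, ← coe_mapPos, map_pow, mapPos_twist]
  exact ⟨by rw [e]; exact (mapPos φ ⟨_, hN⟩).2, Subtype.ext e⟩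

theorem grNorm_map (φ : A →+* B) (Λ : (Submodule A⟦X⟧ A⸨X⸩)ˣ) (f : A⟦X⟧ˣ) :
    grNorm (Units.map (baseChange φ) Λ) (Units.map (PowerSeries.map φ).toMonoidHom f) =
      φ (grNorm Λ f) := by
  obtain ⟨N, hN⟩ := exists_mul_twist_mem Λ
  obtain ⟨h, e⟩ := map_mul_twist_mem φ hN
  have e2 : constUnit (Units.map (PowerSeries.map φ).toMonoidHom f) =
      Units.map φ.toMonoidHom (constUnit f) := Units.ext (by
    change constantCoeff (PowerSeries.map φ (f : A⟦X⟧)) = φ (constantCoeff (f : A⟦X⟧))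
    rw [← PowerSeries.coeff_zero_eq_constantCoeff_apply, PowerSeries.coeff_map,
      PowerSeries.coeff_zero_eq_constantCoeff_apply])
  rw [grNorm_eq h, grNorm_eq hN, e, e2, map_mul, ← map_inv, ← map_pow]
  congr 1
  exact latticeNorm_map φ _ _

theorem grNorm_mul_left (Λ Λ' : (Submodule A⟦X⟧ A⸨X⸩)ˣ) (f : A⟦X⟧ˣ) :
    grNorm (Λ * Λ') f = grNorm Λ f * grNorm Λ' f := by
  obtain ⟨N, hN⟩ := exists_mul_twist_mem Λ
  obtain ⟨M, hM⟩ := exists_mul_twist_mem Λ'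
  have e : Λ * Λ' * (twist A ^ (N + M)).1 =
      ((⟨_, hN⟩ : grPos A) * (⟨_, hM⟩ : grPos A)).1 := by
    rw [pow_add]
    exact Units.ext (mul_mul_mul_comm (Λ : Submodule A⟦X⟧ A⸨X⸩) _ _ _)
  have h : Λ * Λ' * (twist A ^ (N + M)).1 ∈ grPos A := by rw [e]; exact Subtype.property _
  have e' : (⟨_, h⟩ : grPos A) = ⟨_, hN⟩ * ⟨_, hM⟩ := Subtype.ext e
  rw [grNorm_eq hN, grNorm_eq hM, grNorm_eq h, e', latticeNorm_mul_left, pow_add, Units.val_mul]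
  ring

theorem grNorm_mul_right (Λ : (Submodule A⟦X⟧ A⸨X⸩)ˣ) (f g : A⟦X⟧ˣ) :
    grNorm Λ (f * g) = grNorm Λ f * grNorm Λ g := by
  obtain ⟨N, hN⟩ := exists_mul_twist_mem Λ
  rw [grNorm_eq hN, grNorm_eq hN, grNorm_eq hN, Units.val_mul, latticeNorm_mul_right, map_mul,
    mul_inv, mul_pow, Units.val_mul]
  ring

theorem grNorm_one_left (f : A⟦X⟧ˣ) : grNorm 1 f = 1 :=
  (grNorm_coe (1 : grPos A) f).trans (latticeNorm_one_left _)

theorem grNorm_one_right (Λ : (Submodule A⟦X⟧ A⸨X⸩)ˣ) : grNorm Λ 1 = 1 := by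
  obtain ⟨N, hN⟩ := exists_mul_twist_mem Λ
  rw [grNorm_eq hN, Units.val_one, latticeNorm_one_right, map_one, inv_one, one_pow, Units.val_one,
    mul_one]

end Principal

/-! ### The pairings of `Gr^pos` and of `Gr` -/

section Pairings
variable (k : Type u) [Field k]

/-- The pairing of `Gr^pos` with `𝔏⁺𝔸¹`. -/
def posPairing : Pairing (GrPos k) (LPlusA1 k) where
  toFun A Λ f := latticeNorm (A := A) Λ f
  map_map f x y := latticeNorm_map f.hom.toRingHom x y
  one_left _ y := latticeNorm_one_left y
  one_right _ x := latticeNorm_one_right x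
  mul_left _ x x' y := latticeNorm_mul_left x x' y
  mul_right _ x y y' := latticeNorm_mul_right x y y'

/-- The pairing of `Gr` with `𝔏⁺𝔾_m`. -/
def grPairing : Pairing (Gr k) (LPlusGm k) where
  toFun A Λ f := grNorm (A := A) Λ f
  map_map f x y := grNorm_map f.hom.toRingHom x y
  one_left _ y := grNorm_one_left y
  one_right _ x := grNorm_one_right x
  mul_left _ x x' y := grNorm_mul_left x x' y
  mul_right _ x y y' := grNorm_mul_right x y y'

end Pairings

/-! ### Logarithmic derivatives, power sums and `Gr^{≤n}` -/

section LogDerivative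
variable {A B : Type u} [CommRing A] [CommRing B]

/-- The Laurent series `(t - τ)⁻¹ = ∑ τ ^ j t ^ (-j - 1)`. -/
def geom (τ : A) : A⸨X⸩ :=
  ∑ j ∈ Finset.range (nilpotencyClass τ), HahnSeries.single (-((j : ℤ) + 1)) (τ ^ j)

theorem coeff_geom {τ : A} (h : IsNilpotent τ) (j : ℕ) :
    (geom τ).coeff (-((j : ℤ) + 1)) = τ ^ j := by
  rw [geom, HahnSeries.coeff_sum]
  by_cases hj : j < nilpotencyClass τ
  · rw [Finset.sum_eq_single j]
    · simp
    · intro i _ hi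
      exact HahnSeries.coeff_single_of_ne (by omega)
    · intro h'
      exact absurd (Finset.mem_range.2 hj) h'
  · rw [pow_eq_zero_of_le (not_lt.1 hj) (pow_nilpotencyClass h)]
    refine Finset.sum_eq_zero fun i hi => HahnSeries.coeff_single_of_ne ?_
    rw [Finset.mem_range] at hi
    omega

theorem X_sub_C_mul_geom {τ : A} (h : IsNilpotent τ) :
    algebraMap A⟦X⟧ A⸨X⸩ (X - C τ) * geom τ = 1 := by
  -- The product with a partial sum of the geometric series telescopes, with an error that dies with
  -- `τ ^ N`.
  have h1 : ∀ N : ℕ, algebraMap A⟦X⟧ A⸨X⸩ (X - C τ) *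
      ∑ j ∈ Finset.range N, HahnSeries.single (-((j : ℤ) + 1)) (τ ^ j) =
      1 - HahnSeries.single (-(N : ℤ)) (τ ^ N) := fun N => by
    induction N with
    | zero => simp
    | succ N ih =>
      have hX : algebraMap A⟦X⟧ A⸨X⸩ (X - C τ) =
          HahnSeries.single 1 1 - HahnSeries.single 0 τ := by
        rw [map_sub, ← coe_unitT, LaurentSeries.coe_algebraMap, HahnSeries.ofPowerSeries_C]
        rfl
      rw [Finset.sum_range_succ, mul_add, ih, hX, sub_mul, HahnSeries.single_mul_single,
        HahnSeries.single_mul_single, one_mul, ← pow_succ']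
      have e1 : (1 : ℤ) + -((N : ℤ) + 1) = -(N : ℤ) := by ring
      have e2 : (0 : ℤ) + -((N : ℤ) + 1) = -((N + 1 : ℕ) : ℤ) := by push_cast; ring
      rw [e1, e2]
      ring
  rw [geom, h1, pow_nilpotencyClass h]
  simp

/-- `(t - τ_1) ⋯ (t - τ_m)` as an invertible Laurent series. -/
def rootUnit (l : List A) (h : ∀ τ ∈ l, IsNilpotent τ) : A⸨X⸩ˣ :=
  Units.mkOfMulEqOne (algebraMap A⟦X⟧ A⸨X⸩ (rootProd l)) (l.map geom).prod (by
    induction l with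
    | nil => simp [rootProd]
    | cons τ l ih =>
      rw [rootProd_cons, List.map_cons, List.prod_cons, map_mul, mul_mul_mul_comm,
        X_sub_C_mul_geom (h τ List.mem_cons_self), one_mul,
        ih fun σ hσ => h σ (List.mem_cons_of_mem _ hσ)])

theorem coe_rootUnit (l : List A) (h : ∀ τ ∈ l, IsNilpotent τ) :
    (rootUnit l h : A⸨X⸩) = algebraMap A⟦X⟧ A⸨X⸩ (rootProd l) := rfl

theorem IsSplit.eq_principal {Λ : grPos A} {l : List A} (h : IsSplit Λ l) :
    Λ.1 = principal (rootUnit l h.nilpotent)⁻¹ := by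
  rw [map_inv, ← inv_inj, inv_inv]
  exact Units.ext h.inv_eq

theorem derivative_rootProd (l : List A) (h : ∀ τ ∈ l, IsNilpotent τ) :
    LaurentSeries.derivative A (algebraMap A⟦X⟧ A⸨X⸩ (rootProd l)) =
      algebraMap A⟦X⟧ A⸨X⸩ (rootProd l) * (l.map geom).sum := by
  induction l with
  | nil =>
    rw [rootProd_nil, derivative_coe]
    simp
  | cons τ l ih =>
    rw [rootProd_cons, map_mul, derivative_mul, ih fun σ hσ => h σ (List.mem_cons_of_mem _ hσ),
      derivative_coe, List.map_cons, List.sum_cons]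
    have e : PowerSeries.derivative A (X - C τ) = 1 := by
      rw [map_sub, PowerSeries.derivative_X, PowerSeries.derivative_C, sub_zero]
    rw [e, map_one, ← X_sub_C_mul_geom (h τ List.mem_cons_self)]
    ring

theorem derivative_single (N : ℕ) : LaurentSeries.derivative A (HahnSeries.single (N : ℤ) 1) =
    HahnSeries.single (N : ℤ) 1 * ((N : A⸨X⸩) * HahnSeries.single (-1) 1) := by
  rw [derivative_eq]
  have e : euler (HahnSeries.single (N : ℤ) (1 : A)) =
      (N : A⸨X⸩) * HahnSeries.single (N : ℤ) 1 := by
    rw [← nsmul_eq_mul]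
    ext n
    rw [HahnSeries.coeff_nsmul]
    change (n : A) * (HahnSeries.single (N : ℤ) (1 : A)).coeff n =
      N • (HahnSeries.single (N : ℤ) (1 : A)).coeff n
    by_cases hn : n = N
    · subst hn; simp
    · rw [HahnSeries.coeff_single_of_ne hn]; simp
  rw [e]
  ring

/-- The logarithmic derivative of `t ^ N / ((t - τ_1) ⋯ (t - τ_m))`. -/
theorem derivative_generator (N : ℕ) (l : List A) (h : ∀ τ ∈ l, IsNilpotent τ) :
    LaurentSeries.derivative A (((rootUnit l h)⁻¹ * unitT ^ N : A⸨X⸩ˣ) : A⸨X⸩) =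
      (((rootUnit l h)⁻¹ * unitT ^ N : A⸨X⸩ˣ) : A⸨X⸩) *
        ((N : A⸨X⸩) * HahnSeries.single (-1) 1 - (l.map geom).sum) := by
  set g : A⸨X⸩ˣ := (rootUnit l h)⁻¹ * unitT ^ N with hg
  -- Differentiating this product, instead of the quotient, avoids derivatives of inverses.
  have hgp : (g : A⸨X⸩) * (rootUnit l h : A⸨X⸩) = HahnSeries.single (N : ℤ) 1 := by
    rw [← Units.val_mul, hg, mul_right_comm, inv_mul_cancel, one_mul, Units.val_pow_eq_pow_val,
      coe_unitT, ← map_pow, algebraMap_X_pow]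
  have hD := congrArg (LaurentSeries.derivative A) hgp
  rw [derivative_mul, derivative_single, ← hgp, coe_rootUnit, derivative_rootProd l h,
    ← coe_rootUnit l h] at hD
  rw [← Units.mul_left_inj (rootUnit l h)]
  linear_combination hD

/-- The power sums `∑ τ_i ^ j` with `j ≥ n` vanish. -/
def PowerSumsVanish (n : ℕ) (l : List A) : Prop := ∀ j ≥ n, (l.map fun τ => τ ^ j).sum = 0

/-- As `n ≠ 0`, the factor `X ^ n` cancels the pole of `N / t`; the coefficient of `X ^ n / (X - τ)`
at `-(j + 1)` is `τ ^ (n + j)`. -/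
theorem coeff_logDerivative {l : List A} (h : ∀ τ ∈ l, IsNilpotent τ) (n N j : ℕ) (hn : n ≠ 0) :
    (algebraMap A⟦X⟧ A⸨X⸩ (X ^ n) * ((N : A⸨X⸩) * HahnSeries.single (-1) 1 -
      (l.map geom).sum)).coeff (-((j : ℤ) + 1)) = -(l.map fun τ => τ ^ (n + j)).sum := by
  rw [mul_sub, HahnSeries.coeff_sub, algebraMap_X_pow, ← nsmul_eq_mul, mul_smul_comm,
    HahnSeries.single_mul_single, HahnSeries.coeff_nsmul, Pi.smul_apply,
    HahnSeries.coeff_single_of_ne (by omega), smul_zero, zero_sub, HahnSeries.coeff_single_mul,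
    one_mul, neg_inj]
  induction l with
  | nil => simp
  | cons τ l ih =>
    rw [List.map_cons, List.sum_cons, List.map_cons, List.sum_cons, HahnSeries.coeff_add,
      ih fun σ hσ => h σ (List.mem_cons_of_mem _ hσ)]
    congr 1
    rw [← coeff_geom (h τ List.mem_cons_self)]
    congr 1
    push_cast
    ring

theorem eq_principal_of_isSplit {Λ : (Submodule A⟦X⟧ A⸨X⸩)ˣ} {N : ℕ}
    {hN : Λ * (twist A ^ N).1 ∈ grPos A} {l : List A} (hl : IsSplit ⟨_, hN⟩ l) :
    Λ = principal ((rootUnit l hl.nilpotent)⁻¹ * unitT ^ N) := by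
  have h := hl.eq_principal
  rw [map_mul, ← h]
  change _ = Λ * (twist A ^ N).1 * _
  rw [coe_twist_pow, mul_assoc, ← map_mul, inv_pow, inv_mul_cancel, map_one, mul_one]

/-- The condition `dlog g ∈ t^{-n} A⟦t⟧ dt` in terms of power sums. -/
theorem mem_grLe_iff {n : ℕ} (hn : n ≠ 0) {Λ : (Submodule A⟦X⟧ A⸨X⸩)ˣ} {N : ℕ}
    {hN : Λ * (twist A ^ N).1 ∈ grPos A} {l : List A} (hl : IsSplit ⟨_, hN⟩ l) :
    Λ ∈ grLe n A ↔ PowerSumsVanish n l := by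
  have hΛ := eq_principal_of_isSplit hl
  have hD := derivative_generator N l hl.nilpotent
  set g : A⸨X⸩ˣ := (rootUnit l hl.nilpotent)⁻¹ * unitT ^ N with hg
  have key : (∃ f, algebraMap A⟦X⟧ A⸨X⸩ f = algebraMap A⟦X⟧ A⸨X⸩ (X ^ n) *
      ((N : A⸨X⸩) * HahnSeries.single (-1) 1 - (l.map geom).sum)) ↔ PowerSumsVanish n l := by
    rw [exists_algebraMap_iff]
    constructor
    · intro h j hj
      obtain ⟨i, rfl⟩ := Nat.exists_eq_add_of_le hj
      have := h (-((i : ℤ) + 1)) (by omega)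
      rwa [coeff_logDerivative hl.nilpotent n N i hn, neg_eq_zero] at this
    · intro h m hm
      obtain ⟨i, rfl⟩ : ∃ i : ℕ, m = -((i : ℤ) + 1) := ⟨(-m - 1).toNat, by omega⟩
      rw [coeff_logDerivative hl.nilpotent n N i hn, h _ (by omega), neg_zero]
  rw [← key, hΛ]
  constructor
  · intro h
    have h1 := h.2 (g : A⸨X⸩) (Submodule.mem_span_singleton_self _)
    obtain ⟨a, ha⟩ := Submodule.mem_span_singleton.1 h1
    refine ⟨a, ?_⟩
    rw [Algebra.smul_def, Algebra.smul_def, hD] at ha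
    rw [← Units.mul_left_inj g, ha]
    ring
  -- By the Leibniz rule, stability under `t ^ n d/dt` passes from the generator `g` to all its
  -- multiples.
  · rintro ⟨f, hf⟩
    refine ⟨fun h => absurd h hn, fun x hx => ?_⟩
    obtain ⟨a, rfl⟩ := Submodule.mem_span_singleton.1 hx
    refine Submodule.mem_span_singleton.2 ⟨X ^ n * PowerSeries.derivative A a + f * a, ?_⟩
    rw [derivative_smul, hD, Algebra.smul_def, Algebra.smul_def, Algebra.smul_def,
      Algebra.smul_def, map_add, map_mul, map_mul, hf]
    ring

/-- The sum is a linear combination of power sums `∑ τ ^ j`, and only exponents `j ≥ n` occur. -/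
theorem sum_ev_X_pow_mul {n : ℕ} {l : List A} (hl : ∀ τ ∈ l, IsNilpotent τ)
    (h : PowerSumsVanish n l) (g : A⟦X⟧) : (l.map fun τ => ev τ (X ^ n * g)).sum = 0 := by
  -- A common exponent lets all evaluations be written over the same finite range.
  obtain ⟨K, hK⟩ : ∃ K, ∀ τ ∈ l, τ ^ K = 0 := by
    clear h
    induction l with
    | nil => exact ⟨0, by simp⟩
    | cons τ l ih =>
      obtain ⟨K, hK⟩ := ih fun σ hσ => hl σ (List.mem_cons_of_mem _ hσ)
      obtain ⟨M, hM⟩ := hl τ List.mem_cons_self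
      refine ⟨M + K, fun σ hσ => ?_⟩
      rcases List.mem_cons.1 hσ with rfl | hσ
      · rw [pow_add, hM, zero_mul]
      · rw [pow_add, hK σ hσ, mul_zero]
  have e : (l.map fun τ => ev τ (X ^ n * g)) =
      l.map fun τ => ∑ j ∈ Finset.range K, coeff j (X ^ n * g) * τ ^ j :=
    List.map_congr_left fun τ hτ => ev_eq_sum (hK τ hτ) _
  have e2 : ∀ l : List A,
      (l.map fun τ => ∑ j ∈ Finset.range K, coeff j (X ^ n * g) * τ ^ j).sum =
      ∑ j ∈ Finset.range K, coeff j (X ^ n * g) * (l.map fun τ => τ ^ j).sum := fun l => by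
    induction l with
    | nil => simp
    | cons τ l ih => simp only [List.map_cons, List.sum_cons, ih, mul_add, Finset.sum_add_distrib]
  rw [e, e2]
  refine Finset.sum_eq_zero fun j _ => ?_
  rw [PowerSeries.coeff_X_pow_mul']
  split_ifs with hj
  · rw [h j hj, mul_zero]
  · rw [zero_mul]

/-- If all power sums of the `c i` vanish, so do the elementary symmetric functions. -/
theorem prod_one_add_eq_one (hA : ∀ n : ℕ, n ≠ 0 → IsUnit (n : A)) {m : ℕ} (c : Fin m → A)
    (hc : ∀ r : ℕ, r ≠ 0 → ∑ i, c i ^ r = 0) : ∏ i, (1 + c i) = 1 := by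
  have he : ∀ r : ℕ, r ≠ 0 → ∑ t ∈ Finset.powersetCard r Finset.univ, ∏ i ∈ t, c i = 0 := by
    intro r hr
    -- Newton's identities write `r * e_r` through power sums of positive index, all of which
    -- vanish; `r` is invertible.
    have h1 := congrArg (MvPolynomial.aeval c) (MvPolynomial.mul_esymm_eq_sum (Fin m) ℤ r)
    have h2 : MvPolynomial.aeval c (MvPolynomial.esymm (Fin m) ℤ r) =
        ∑ t ∈ Finset.powersetCard r Finset.univ, ∏ i ∈ t, c i := by
      simp [MvPolynomial.esymm, map_sum, map_prod]
    have h3 : ∀ s : ℕ, s ≠ 0 → MvPolynomial.aeval c (MvPolynomial.psum (Fin m) ℤ s) = 0 := by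
      intro s hs
      rw [MvPolynomial.psum, map_sum, ← hc s hs]
      simp
    rw [map_mul, map_natCast, h2, map_mul, map_sum] at h1
    refine ((hA r hr).mul_right_eq_zero).1 (h1.trans ?_)
    rw [Finset.sum_eq_zero, mul_zero]
    · intro a ha
      rw [Finset.mem_filter, Finset.HasAntidiagonal.mem_antidiagonal] at ha
      rw [map_mul, h3 a.2 (by omega), mul_zero]
  rw [Finset.prod_one_add, Finset.sum_powerset, Finset.sum_eq_single 0]
  · simp
  · intro r _ hr
    exact he r hr
  · simp

/-- Positive powers of `X ^ n * g` are again multiples of `X ^ n`, so all power sums of its values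
vanish, and with them the elementary symmetric functions. -/
theorem prod_ev_one_add {n : ℕ} (hA : ∀ n : ℕ, n ≠ 0 → IsUnit (n : A)) {l : List A}
    (hl : ∀ τ ∈ l, IsNilpotent τ) (h : PowerSumsVanish n l) (g : A⟦X⟧) :
    (l.map fun τ => ev τ (1 + X ^ n * g)).prod = 1 := by
  have e : (l.map fun τ => ev τ (1 + X ^ n * g)) = l.map fun τ => 1 + ev τ (X ^ n * g) :=
    List.map_congr_left fun τ hτ => by rw [ev_add, ev_one (hl τ hτ)]
  rw [e, ← Fin.prod_univ_fun_getElem l fun τ => 1 + ev τ (X ^ n * g)]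
  refine prod_one_add_eq_one hA _ fun r hr => ?_
  rw [Fin.sum_univ_fun_getElem l fun τ => ev τ (X ^ n * g) ^ r]
  have e2 : (l.map fun τ => ev τ (X ^ n * g) ^ r) =
      l.map fun τ => ev τ (X ^ n * (X ^ (n * (r - 1)) * g ^ r)) :=
    List.map_congr_left fun τ hτ => by
      rw [← ev_pow (hl τ hτ)]
      congr 1
      rw [mul_pow, ← pow_mul, ← mul_assoc, ← pow_add]
      congr 2
      obtain ⟨s, rfl⟩ := Nat.exists_eq_succ_of_ne_zero hr
      simp
      ring
  rw [e2]
  exact sum_ev_X_pow_mul hl h _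

/-- The pairing of `Gr^{≤n}` with invertible power series depends only on the series modulo
`t ^ n`. -/
theorem grNorm_eq_one (hA : ∀ n : ℕ, n ≠ 0 → IsUnit (n : A)) {n : ℕ}
    {Λ : (Submodule A⟦X⟧ A⸨X⸩)ˣ} (hΛ : Λ ∈ grLe n A) {f : A⟦X⟧ˣ} {g : A⟦X⟧}
    (hf : (f : A⟦X⟧) = 1 + X ^ n * g) : grNorm Λ f = 1 := by
  -- The description by power sums is valid only for `n ≠ 0`; for `n = 0` the line bundle is trivial
  -- by convention.
  by_cases hn : n = 0
  · rw [hΛ.1 hn, grNorm_one_left]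
  by_contra hne
  obtain ⟨N, hN⟩ := exists_mul_twist_mem Λ
  obtain ⟨B, _, φ, h0, ⟨l, hl⟩, -⟩ := exists_isSplit ⟨_, hN⟩ ⟨_, hN⟩ (sub_ne_zero.2 hne)
  refine h0 ?_
  obtain ⟨h, e⟩ := map_mul_twist_mem φ hN
  rw [← e] at hl
  have hps := (mem_grLe_iff hn hl).1 (grLe_map n φ hΛ)
  have hB : ∀ n : ℕ, n ≠ 0 → IsUnit (n : B) := fun n hn => by
    have := (hA n hn).map φ
    rwa [map_natCast] at this
  have hf' : ((Units.map (PowerSeries.map φ).toMonoidHom f : B⟦X⟧ˣ) : B⟦X⟧) =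
      1 + X ^ n * PowerSeries.map φ g := by
    change PowerSeries.map φ (f : A⟦X⟧) = _
    rw [hf]
    simp
  have hc : constUnit (Units.map (PowerSeries.map φ).toMonoidHom f) = 1 := Units.ext (by
    rw [coe_constUnit, hf']
    simp [hn])
  rw [map_sub, map_one, ← grNorm_map, grNorm_eq h, hl.latticeNorm_eq, hf',
    prod_ev_one_add hB hl.nilpotent hps, hc]
  simp

end LogDerivative

/-! ### Density of `k`-points -/

section Density
variable {k : Type u} [Field k] [CharZero k]

/-- A polynomial with coefficients in a `k`-algebra that vanishes at all `k`-points is zero. -/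
theorem mvPolynomial_eq_zero {σ : Type*} {B : Type u} [CommRing B] [Algebra k B]
    (H : MvPolynomial σ B)
    (h : ∀ c : σ → k, MvPolynomial.eval (fun i => algebraMap k B (c i)) H = 0) :
    H = 0 := by
  ext m
  rw [MvPolynomial.coeff_zero, ← Module.forall_dual_apply_eq_zero_iff k]
  intro ℓ
  -- Applying a functional to the coefficients reduces to polynomials over the infinite field `k`.
  let Hℓ : MvPolynomial σ k := ∑ d ∈ H.support, MvPolynomial.monomial d (ℓ (H.coeff d))
  have h0 : Hℓ = 0 := MvPolynomial.funext fun c => by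
    have hc : ∑ d ∈ H.support, H.coeff d * ∏ i ∈ d.support, algebraMap k B (c i) ^ d i = 0 :=
      (MvPolynomial.eval_eq _ H).symm.trans (h c)
    rw [map_zero, ← map_zero ℓ, ← hc, map_sum, map_sum]
    refine Finset.sum_congr rfl fun d _ => ?_
    rw [MvPolynomial.eval_monomial]
    have e : (∏ i ∈ d.support, algebraMap k B (c i) ^ d i) =
        algebraMap k B (∏ i ∈ d.support, c i ^ d i) := by
      rw [map_prod]
      exact Finset.prod_congr rfl fun i _ => (map_pow _ _ _).symm
    rw [e, mul_comm (H.coeff d), ← Algebra.smul_def, map_smul, smul_eq_mul, mul_comm]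
    rfl
  have h1 : MvPolynomial.coeff m Hℓ = ℓ (H.coeff m) := by
    classical
    refine (MvPolynomial.coeff_sum H.support _ m).trans ?_
    rw [Finset.sum_congr rfl fun d _ => MvPolynomial.coeff_monomial m d _, Finset.sum_ite_eq']
    split_ifs with hm
    · rfl
    · rw [MvPolynomial.notMem_support_iff.1 hm, map_zero]
  rw [← h1, h0, MvPolynomial.coeff_zero]

/-- Polynomials in one variable over a `k`-algebra are determined by their values on `k`. -/
theorem polynomial_eq {B : Type u} [CommRing B] [Algebra k B] {P Q : Polynomial B}
    (h : ∀ c : k, P.eval (algebraMap k B c) = Q.eval (algebraMap k B c)) : P = Q := by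
  have key : ∀ m < max (P.natDegree + 1) (Q.natDegree + 1), P.coeff m - Q.coeff m = 0 := by
    refine eq_zero_of_sum_pow_smul (k := k) _ (fun m => P.coeff m - Q.coeff m) fun c => ?_
    have h1 := h c
    rw [Polynomial.eval_eq_sum_range' (lt_of_lt_of_le (Nat.lt_succ_self _)
        (le_max_left (P.natDegree + 1) (Q.natDegree + 1))),
      Polynomial.eval_eq_sum_range' (lt_of_lt_of_le (Nat.lt_succ_self _)
        (le_max_right (P.natDegree + 1) (Q.natDegree + 1))), ← sub_eq_zero,
      ← Finset.sum_sub_distrib] at h1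
    rw [← h1]
    refine Finset.sum_congr rfl fun m _ => ?_
    rw [Algebra.smul_def, map_pow]
    ring
  ext m
  by_cases hm : m < max (P.natDegree + 1) (Q.natDegree + 1)
  · exact sub_eq_zero.1 (key m hm)
  · rw [not_lt, max_le_iff] at hm
    rw [Polynomial.coeff_eq_zero_of_natDegree_lt (by omega),
      Polynomial.coeff_eq_zero_of_natDegree_lt (by omega)]

/-- Polynomials in one variable over a `k`-algebra are determined by their values on the complement
of a finite subset of `k`. -/
theorem polynomial_eq_of_ne_zero {B : Type u} [CommRing B] [Algebra k B] {P Q : Polynomial B}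
    (S : Finset k)
    (h : ∀ c : k, c ∉ S → P.eval (algebraMap k B c) = Q.eval (algebraMap k B c)) : P = Q := by
  -- After multiplication by this monic, hence regular, polynomial the two sides agree on all of
  -- `k`.
  let R : Polynomial B := ∏ c ∈ S, (Polynomial.X - Polynomial.C (algebraMap k B c))
  have hR : R.Monic := Polynomial.monic_prod_of_monic _ _ fun c _ => Polynomial.monic_X_sub_C _
  refine hR.isRegular.right (polynomial_eq (k := k) fun c => ?_)
  change (P * R).eval _ = (Q * R).eval _
  rw [Polynomial.eval_mul, Polynomial.eval_mul]
  by_cases hc : c ∈ S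
  · have h0 : R.eval (algebraMap k B c) = 0 := by
      rw [Polynomial.eval_prod]
      exact Finset.prod_eq_zero hc (by simp)
    rw [h0, mul_zero, mul_zero]
  · rw [h c hc]

end Density

/-! ### Functions and coproducts on the spaces of power series -/

section Functions
variable (k : Type u) [Field k]

/-- The power series with indeterminate coefficients. -/
def univSeries (R : Type*) [CommRing R] : (MvPolynomial ℕ R)⟦X⟧ := PowerSeries.mk MvPolynomial.X

theorem map_univSeries {R S : Type*} [CommRing R] [CommRing S] (φ : MvPolynomial ℕ R →+* S)
    (f : S⟦X⟧) (h : ∀ j, φ (MvPolynomial.X j) = coeff j f) :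
    PowerSeries.map φ (univSeries R) = f := by
  ext j
  rw [PowerSeries.coeff_map, univSeries, PowerSeries.coeff_mk, h]

variable {k}

/-- The value of a polynomial at the coefficients of a power series. -/
def evalCoeffs {B : Type u} [CommRing B] [Algebra k B] (f : B⟦X⟧) : MvPolynomial ℕ k →ₐ[k] B :=
  MvPolynomial.aeval fun j => coeff j f

@[simp] theorem evalCoeffs_X {B : Type u} [CommRing B] [Algebra k B] (f : B⟦X⟧) (j : ℕ) :
    evalCoeffs (k := k) f (MvPolynomial.X j) = coeff j f := MvPolynomial.aeval_X _ _

theorem evalCoeffs_map {B C : Type u} [CommRing B] [Algebra k B] [CommRing C] [Algebra k C]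
    (φ : B →ₐ[k] C) (f : B⟦X⟧) (p : MvPolynomial ℕ k) :
    evalCoeffs (PowerSeries.map φ.toRingHom f) p = φ (evalCoeffs f p) := by
  have : evalCoeffs (PowerSeries.map φ.toRingHom f) = φ.comp (evalCoeffs (k := k) f) :=
    MvPolynomial.algHom_ext fun j => by simp
  rw [this]
  rfl

theorem evalCoeffs_eq_eval (f : k⟦X⟧) (p : MvPolynomial ℕ k) :
    evalCoeffs f p = MvPolynomial.eval (fun j => coeff j f) p := by
  exact RingHom.congr_fun (MvPolynomial.coe_aeval_eq_eval fun j => coeff j f) p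

/-- The function on `𝔏⁺𝔸¹` given by a polynomial in the coefficients. -/
def ofPoly (p : MvPolynomial ℕ k) : functionAlgebra (LPlusA1 k) :=
  ⟨fun B f => evalCoeffs (B := B) f p, fun _ _ φ f => evalCoeffs_map φ.hom f p⟩

theorem ofPoly_apply (p : MvPolynomial ℕ k) (B : CommAlgCat.{u} k) (f : B⟦X⟧) :
    (ofPoly p).1 B f = evalCoeffs f p := rfl

/-- Yoneda: the polynomial is the value at the series with indeterminate coefficients. -/
theorem exists_ofPoly (q : functionAlgebra (LPlusA1 k)) : ∃ p, ofPoly p = q := by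
  refine ⟨q.1 (CommAlgCat.of k (MvPolynomial ℕ k)) (univSeries k), Subtype.ext ?_⟩
  funext B f
  refine (q.2 (CommAlgCat.of k (MvPolynomial ℕ k)) B (CommAlgCat.ofHom (evalCoeffs (B := B) f))
    (univSeries k)).symm.trans (congrArg (q.1 B) ?_)
  exact map_univSeries _ _ fun j => evalCoeffs_X _ j

/-- Multiplication of series corresponds to the comultiplication `X_j ↦ ∑ X_i ⊗ X_{j-i}`; the image
of `p` is a finite sum of pure tensors. -/
theorem evalCoeffs_mul (p : MvPolynomial ℕ k) : ∃ (ι : Type u) (_ : Fintype ι)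
    (a b : ι → MvPolynomial ℕ k), ∀ (B : Type u) [CommRing B] [Algebra k B] (y z : B⟦X⟧),
      evalCoeffs (y * z) p = ∑ i, evalCoeffs y (a i) * evalCoeffs z (b i) := by
  let Δ : MvPolynomial ℕ k →ₐ[k] MvPolynomial ℕ k ⊗[k] MvPolynomial ℕ k :=
    MvPolynomial.aeval fun j => ∑ i ∈ Finset.HasAntidiagonal.antidiagonal j,
      MvPolynomial.X i.1 ⊗ₜ MvPolynomial.X i.2
  obtain ⟨S, hS⟩ := TensorProduct.exists_finset (Δ p)
  refine ⟨S, inferInstance, fun i => i.1.1, fun i => i.1.2, fun B _ _ y z => ?_⟩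
  have e : evalCoeffs (y * z) =
      (Algebra.TensorProduct.productMap (evalCoeffs y) (evalCoeffs z)).comp Δ :=
    MvPolynomial.algHom_ext fun j => by
      simp only [evalCoeffs_X, AlgHom.comp_apply, Δ, MvPolynomial.aeval_X, map_sum,
        Algebra.TensorProduct.productMap_apply_tmul, PowerSeries.coeff_mul]
  rw [e, AlgHom.comp_apply, hS, map_sum, ← Finset.sum_coe_sort]
  exact Finset.sum_congr rfl fun i _ => Algebra.TensorProduct.productMap_apply_tmul _ _ _ _

theorem hasCoproduct_LPlusA1 [CharZero k] : HasCoproduct (LPlusA1 k) where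
  ext q q' h := by
    obtain ⟨p, rfl⟩ := exists_ofPoly q
    obtain ⟨p', rfl⟩ := exists_ofPoly q'
    refine congrArg ofPoly (MvPolynomial.funext fun x => ?_)
    have h1 : evalCoeffs (PowerSeries.mk x) p = evalCoeffs (PowerSeries.mk x) p' :=
      h (PowerSeries.mk x : k⟦X⟧)
    simpa [evalCoeffs_eq_eval] using h1
  comul q := by
    obtain ⟨p, rfl⟩ := exists_ofPoly q
    obtain ⟨ι, _, a, b, h⟩ := evalCoeffs_mul p
    exact ⟨ι, inferInstance, fun i => ofPoly (a i), fun i => ofPoly (b i), fun y z => h k y z⟩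

/-- The function `f ↦ f(0)^{-N} p(f)` on `𝔏⁺𝔾_m`. -/
def ofPolyUnit (N : ℕ) (p : MvPolynomial ℕ k) : functionAlgebra (LPlusGm k) :=
  ⟨fun B f => (((constUnit (A := B) f)⁻¹ ^ N : Bˣ) : B) * evalCoeffs (B := B) (f : B⟦X⟧ˣ).val p,
    fun B C φ f => by
      rw [map_mul]
      refine congrArg₂ (· * ·) ?_ (evalCoeffs_map φ.hom (f : B⟦X⟧ˣ).val p)
      have e : constUnit (A := C) ((LPlusGm k).map φ f) =
          Units.map φ.hom.toRingHom.toMonoidHom (constUnit (A := B) f) := Units.ext (by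
        change constantCoeff (PowerSeries.map φ.hom.toRingHom (f : B⟦X⟧ˣ).val) =
          φ.hom.toRingHom (constantCoeff (f : B⟦X⟧ˣ).val)
        rw [← PowerSeries.coeff_zero_eq_constantCoeff_apply, PowerSeries.coeff_map,
          PowerSeries.coeff_zero_eq_constantCoeff_apply])
      rw [e, ← map_inv, ← map_pow]
      rfl⟩

theorem ofPolyUnit_apply (N : ℕ) (p : MvPolynomial ℕ k) (B : CommAlgCat.{u} k) (f : B⟦X⟧ˣ) :
    (ofPolyUnit N p).1 B f = (((constUnit f)⁻¹ ^ N : Bˣ) : B) * evalCoeffs (f : B⟦X⟧) p := rfl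

/-- Yoneda over the ring of indeterminate coefficients with `X_0` inverted, where the universal
series is invertible and denominators are powers of `X_0`. -/
theorem exists_ofPolyUnit (q : functionAlgebra (LPlusGm k)) : ∃ N p, ofPolyUnit N p = q := by
  let L := Localization.Away (MvPolynomial.X 0 : MvPolynomial ℕ k)
  let i : MvPolynomial ℕ k →ₐ[k] L := Algebra.algHom k (MvPolynomial ℕ k) L
  have hu : IsUnit (PowerSeries.map i.toRingHom (univSeries k)) := by
    rw [PowerSeries.isUnit_iff_constantCoeff, ← PowerSeries.coeff_zero_eq_constantCoeff_apply,
      PowerSeries.coeff_map, univSeries, PowerSeries.coeff_mk]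
    exact IsLocalization.Away.algebraMap_isUnit (MvPolynomial.X 0 : MvPolynomial ℕ k)
  obtain ⟨N, p, hp⟩ := IsLocalization.Away.surj (MvPolynomial.X 0 : MvPolynomial ℕ k)
    (q.1 (CommAlgCat.of k L) hu.unit : L)
  refine ⟨N, p, Subtype.ext ?_⟩
  funext B f
  have hf : IsUnit (evalCoeffs (k := k) (f : B⟦X⟧ˣ).val (MvPolynomial.X 0)) := by
    rw [evalCoeffs_X, PowerSeries.coeff_zero_eq_constantCoeff_apply]
    exact (constUnit (A := B) f).isUnit
  let φ : L →ₐ[k] B := IsLocalization.liftAlgHom (M := Submonoid.powers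
    (MvPolynomial.X 0 : MvPolynomial ℕ k)) (f := evalCoeffs (k := k) (f : B⟦X⟧ˣ).val) (by
      rintro ⟨_, n, rfl⟩
      change IsUnit (evalCoeffs (k := k) (f : B⟦X⟧ˣ).val (MvPolynomial.X 0 ^ n))
      rw [map_pow]
      exact hf.pow n)
  have hφ : ∀ x, φ (algebraMap (MvPolynomial ℕ k) L x) = evalCoeffs (f : B⟦X⟧ˣ).val x := fun x =>
    IsLocalization.lift_eq _ x
  have h1 : q.1 B f = φ (q.1 (CommAlgCat.of k L) hu.unit) := by
    refine Eq.trans (congrArg (q.1 B) ?_)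
      (q.2 (CommAlgCat.of k L) B (CommAlgCat.ofHom φ) hu.unit)
    refine Units.ext ?_
    change (f : B⟦X⟧ˣ).val =
      PowerSeries.map φ.toRingHom (PowerSeries.map i.toRingHom (univSeries k))
    ext j
    rw [PowerSeries.coeff_map, PowerSeries.coeff_map, univSeries, PowerSeries.coeff_mk]
    exact ((hφ _).trans (evalCoeffs_X _ j)).symm
  have h2 := congrArg φ hp
  rw [map_mul, ← h1, map_pow, hφ, hφ, evalCoeffs_X,
    PowerSeries.coeff_zero_eq_constantCoeff_apply] at h2
  refine (ofPolyUnit_apply N p B f).trans ?_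
  change _ * ((constUnit (A := B) f : Bˣ) : B) ^ N = _ at h2
  rw [← h2, mul_comm, mul_assoc, ← Units.val_pow_eq_pow_val, ← Units.val_mul,
    inv_pow, mul_inv_cancel, Units.val_one, mul_one]

theorem hasCoproduct_LPlusGm [CharZero k] : HasCoproduct (LPlusGm k) where
  ext q q' h := by
    obtain ⟨N, p, rfl⟩ := exists_ofPolyUnit q
    obtain ⟨N', p', rfl⟩ := exists_ofPolyUnit q'
    -- The additional factor `X 0` makes the identity hold trivially where the constant coefficient
    -- vanishes, so it can be checked at all `k`-points.
    have e : p * MvPolynomial.X 0 ^ N' * MvPolynomial.X 0 =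
        p' * MvPolynomial.X 0 ^ N * MvPolynomial.X 0 := MvPolynomial.funext fun x => by
      simp only [map_mul, map_pow, MvPolynomial.eval_X]
      by_cases hx : x 0 = 0
      · rw [hx, mul_zero, mul_zero]
      · have hu : IsUnit (PowerSeries.mk x : k⟦X⟧) := by
          rw [PowerSeries.isUnit_iff_constantCoeff, ← PowerSeries.coeff_zero_eq_constantCoeff_apply,
            PowerSeries.coeff_mk]
          exact isUnit_iff_ne_zero.2 hx
        have h1 : (((constUnit hu.unit)⁻¹ ^ N : kˣ) : k) * evalCoeffs (hu.unit : k⟦X⟧) p =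
            (((constUnit hu.unit)⁻¹ ^ N' : kˣ) : k) * evalCoeffs (hu.unit : k⟦X⟧) p' := h hu.unit
        have hx' : ((constUnit (hu.unit) : kˣ) : k) = x 0 := by
          rw [coe_constUnit]
          change constantCoeff (PowerSeries.mk x : k⟦X⟧) = _
          rw [← PowerSeries.coeff_zero_eq_constantCoeff_apply, PowerSeries.coeff_mk]
        simp only [Units.val_pow_eq_pow_val, Units.val_inv_eq_inv_val, hx'] at h1
        have e1 : ∀ p : MvPolynomial ℕ k, evalCoeffs (hu.unit : k⟦X⟧) p =
            MvPolynomial.eval x p := fun p => by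
          rw [evalCoeffs_eq_eval]
          congr 1
          congr 1
          funext j
          exact PowerSeries.coeff_mk j x
        have h1' : (x 0)⁻¹ ^ N * MvPolynomial.eval x p = (x 0)⁻¹ ^ N' * MvPolynomial.eval x p' := by
          rw [← e1, ← e1]; exact h1
        rw [inv_pow, inv_pow, inv_mul_eq_iff_eq_mul₀ (pow_ne_zero _ hx), mul_left_comm,
          eq_inv_mul_iff_mul_eq₀ (pow_ne_zero _ hx)] at h1'
        rw [mul_comm (MvPolynomial.eval x p), h1', mul_comm (x 0 ^ N)]
    refine Subtype.ext (funext fun B => funext fun f => ?_)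
    refine (ofPolyUnit_apply N p B f).trans (Eq.trans ?_ (ofPolyUnit_apply N' p' B f).symm)
    have h2 := congrArg (evalCoeffs (f : B⟦X⟧ˣ).val) e
    simp only [map_mul, map_pow, evalCoeffs_X, PowerSeries.coeff_zero_eq_constantCoeff_apply] at h2
    set c := constUnit (A := B) f with hc
    have hc' : constantCoeff (f : B⟦X⟧ˣ).val = (c : B) := rfl
    rw [hc', Units.mul_left_inj, ← Units.val_pow_eq_pow_val, ← Units.val_pow_eq_pow_val] at h2
    rw [inv_pow, inv_pow, Units.inv_mul_eq_iff_eq_mul, mul_left_comm, Units.eq_inv_mul_iff_mul_eq,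
      mul_comm, h2, mul_comm]
  comul q := by
    obtain ⟨N, p, rfl⟩ := exists_ofPolyUnit q
    obtain ⟨ι, _, a, b, h⟩ := evalCoeffs_mul p
    refine ⟨ι, inferInstance, fun i => ofPolyUnit N (a i), fun i => ofPolyUnit N (b i),
      fun y z => ?_⟩
    change k⟦X⟧ˣ at y z
    change (((constUnit (y * z))⁻¹ ^ N : kˣ) : k) * evalCoeffs ((y * z : k⟦X⟧ˣ) : k⟦X⟧) p =
      ∑ i, ((((constUnit y)⁻¹ ^ N : kˣ) : k) * evalCoeffs (y : k⟦X⟧) (a i)) *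
        ((((constUnit z)⁻¹ ^ N : kˣ) : k) * evalCoeffs (z : k⟦X⟧) (b i))
    rw [map_mul, Units.val_mul, h k, Finset.mul_sum]
    refine Finset.sum_congr rfl fun i _ => ?_
    rw [mul_inv, mul_pow, Units.val_mul]
    ring

/-- The condition `HasCoproduct` is inherited by retracts. -/
theorem HasCoproduct.of_retract {Y Z : MonoidPrestack k} (hY : HasCoproduct Y)
    (r : ∀ B : CommAlgCat.{u} k, Y.obj B →* Z.obj B)
    (hr : ∀ (B C : CommAlgCat.{u} k) (f : B ⟶ C) y, r C (Y.map f y) = Z.map f (r B y))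
    (s : ∀ B : CommAlgCat.{u} k, Z.obj B → Y.obj B)
    (hs : ∀ (B C : CommAlgCat.{u} k) (f : B ⟶ C) z, s C (Z.map f z) = Y.map f (s B z))
    (hrs : ∀ B z, r B (s B z) = z) : HasCoproduct Z where
  ext q q' h := by
    have e : ∀ q : functionAlgebra Z, ∃ p : functionAlgebra Y, ∀ B y, p.1 B y = q.1 B (r B y) :=
      fun q => ⟨⟨fun B y => q.1 B (r B y), fun B C f y => by
      change q.1 C (r C (Y.map f y)) = f (q.1 B (r B y))
      rw [hr, q.2]⟩, fun _ _ => rfl⟩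
    obtain ⟨p, hp⟩ := e q
    obtain ⟨p', hp'⟩ := e q'
    have hpp : p = p' := hY.ext _ _ fun y => by rw [hp, hp', h]
    refine Subtype.ext (funext fun B => funext fun z => ?_)
    rw [← hrs B z, ← hp, ← hp', hpp]
  comul q := by
    let p : functionAlgebra Y := ⟨fun B y => q.1 B (r B y), fun B C f y => by
      change q.1 C (r C (Y.map f y)) = f (q.1 B (r B y))
      rw [hr, q.2]⟩
    obtain ⟨ι, _, a, b, h⟩ := hY.comul p
    refine ⟨ι, inferInstance, fun i => ⟨fun B z => (a i).1 B (s B z), fun B C f z => by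
      change (a i).1 C (s C (Z.map f z)) = f ((a i).1 B (s B z))
      rw [hs, (a i).2]⟩, fun i => ⟨fun B z => (b i).1 B (s B z), fun B C f z => by
      change (b i).1 C (s C (Z.map f z)) = f ((b i).1 B (s B z))
      rw [hs, (b i).2]⟩, fun y z => ?_⟩
    rw [← h, ← hrs _ y, ← hrs _ z, ← map_mul]
    simp only [hrs]
    rfl

section Trunc
variable {B C : Type u} [CommRing B] [CommRing C]

theorem mk_trunc_eq {n : ℕ} {f g : B⟦X⟧} : (Ideal.Quotient.mk (Ideal.span {(X ^ n : B⟦X⟧)}) f =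
    Ideal.Quotient.mk _ g) ↔ ∀ j < n, coeff j f = coeff j g := by
  rw [Ideal.Quotient.eq, Ideal.mem_span_singleton, PowerSeries.X_pow_dvd_iff]
  simp only [map_sub, sub_eq_zero]

/-- The lift of an element of `B⟦t⟧ / t ^ n` to a polynomial of degree `< n`. -/
def truncRep (n : ℕ) (y : Trunc n B) : B⟦X⟧ :=
  (PowerSeries.trunc n (Ideal.Quotient.mk_surjective y).choose : B⟦X⟧)

theorem coeff_truncRep_mk (n : ℕ) (f : B⟦X⟧) (j : ℕ) :
    coeff j (truncRep n (Ideal.Quotient.mk _ f)) = if j < n then coeff j f else 0 := by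
  rw [truncRep, Polynomial.coeff_coe, PowerSeries.coeff_trunc]
  split_ifs with h
  · exact mk_trunc_eq.1 (Ideal.Quotient.mk_surjective
      (Ideal.Quotient.mk (Ideal.span {(X ^ n : B⟦X⟧)}) f)).choose_spec j h
  · rfl

theorem mk_truncRep (n : ℕ) (y : Trunc n B) : Ideal.Quotient.mk _ (truncRep n y) = y := by
  obtain ⟨f, rfl⟩ := Ideal.Quotient.mk_surjective y
  rw [mk_trunc_eq]
  intro j hj
  rw [coeff_truncRep_mk, if_pos hj]

theorem truncMap_mk (n : ℕ) (φ : B →+* C) (f : B⟦X⟧) :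
    truncMap n φ (Ideal.Quotient.mk _ f) = Ideal.Quotient.mk _ (PowerSeries.map φ f) := rfl

theorem truncRep_map (n : ℕ) (φ : B →+* C) (y : Trunc n B) :
    truncRep n (truncMap n φ y) = PowerSeries.map φ (truncRep n y) := by
  obtain ⟨f, rfl⟩ := Ideal.Quotient.mk_surjective y
  ext j
  rw [truncMap_mk, coeff_truncRep_mk]
  refine Eq.trans ?_ (PowerSeries.coeff_map _ _ _).symm
  rw [coeff_truncRep_mk, apply_ite φ, map_zero, PowerSeries.coeff_map]

/-- For `n ≠ 0` the constant coefficient survives modulo `X ^ n`, so the lift of `y⁻¹` provides its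
inverse. -/
theorem isUnit_truncRep {n : ℕ} (hn : n ≠ 0) (y : (Trunc n B)ˣ) :
    IsUnit (truncRep n (y : Trunc n B)) := by
  rw [PowerSeries.isUnit_iff_constantCoeff]
  refine IsUnit.of_mul_eq_one (constantCoeff (truncRep n ((y⁻¹ : (Trunc n B)ˣ) : Trunc n B))) ?_
  have h : Ideal.Quotient.mk (Ideal.span {(X ^ n : B⟦X⟧)}) (truncRep n (y : Trunc n B) *
      truncRep n ((y⁻¹ : (Trunc n B)ˣ) : Trunc n B)) = Ideal.Quotient.mk _ 1 := by
    rw [map_mul, mk_truncRep, mk_truncRep, Units.mul_inv, map_one]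
  have h0 := mk_trunc_eq.1 h 0 (Nat.pos_of_ne_zero hn)
  simpa using h0

/-- The lift of an invertible element of `B⟦t⟧ / t ^ n` to an invertible power series. -/
def unitRep (n : ℕ) (y : (Trunc n B)ˣ) : B⟦X⟧ˣ :=
  -- Modulo `t ^ 0` the truncated lift is zero, so another lift has to be chosen.
  if hn : n = 0 then 1 else (isUnit_truncRep hn y).unit

/-- Reduction modulo `t ^ n` of invertible power series. -/
def unitMk (n : ℕ) : B⟦X⟧ˣ →* (Trunc n B)ˣ :=
  Units.map (Ideal.Quotient.mk (Ideal.span {(X ^ n : B⟦X⟧)})).toMonoidHom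

theorem subsingleton_trunc_zero : Subsingleton (Trunc 0 B) :=
  Ideal.Quotient.subsingleton_iff.2 (by rw [pow_zero, Ideal.span_singleton_one])

theorem unitMk_unitRep (n : ℕ) (y : (Trunc n B)ˣ) : unitMk n (unitRep n y) = y := by
  refine Units.ext ?_
  by_cases hn : n = 0
  · subst hn
    exact subsingleton_trunc_zero.elim _ _
  · rw [unitRep, dif_neg hn]
    exact mk_truncRep n _

theorem unitRep_map (n : ℕ) (φ : B →+* C) (y : (Trunc n B)ˣ) :
    unitRep n (Units.map (truncMap n φ).toMonoidHom y) =
      Units.map (PowerSeries.map φ).toMonoidHom (unitRep n y) := by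
  by_cases hn : n = 0
  · rw [unitRep, unitRep, dif_pos hn, dif_pos hn, map_one]
  · refine Units.ext ?_
    rw [unitRep, unitRep, dif_neg hn, dif_neg hn]
    exact truncRep_map n φ _

end Trunc

/-- The lift by truncation is natural but not multiplicative; a retract in this sense needs a monoid
map only in the direction of the projection. -/
theorem hasCoproduct_LnA1 [CharZero k] (n : ℕ) : HasCoproduct (LnA1 k n) :=
  hasCoproduct_LPlusA1.of_retract
    (fun B => (Ideal.Quotient.mk (Ideal.span {(X ^ n : B⟦X⟧)})).toMonoidHom)
    (fun _ _ _ _ => rfl) (fun B => truncRep (B := B) n)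
    (fun _ _ f z => truncRep_map n f.hom.toRingHom z) (fun _ z => mk_truncRep n z)

theorem hasCoproduct_LnGm [CharZero k] (n : ℕ) : HasCoproduct (LnGm k n) :=
  hasCoproduct_LPlusGm.of_retract
    (fun B => unitMk (B := B) n)
    (fun _ _ _ _ => Units.ext rfl) (fun B => unitRep (B := B) n)
    (fun _ _ f z => unitRep_map n f.hom.toRingHom z) (fun _ z => unitMk_unitRep n z)

end Functions

/-! ### Principal divisors contained in a multiple of `t = 0` -/

section Principal
variable {A B : Type u} [CommRing A] [CommRing B]

/-- The Laurent series `X ^ (-M) * Q` is the inverse of `P`, so the two form a dual basis of length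
one. -/
theorem isDualBasis_span {P Q : A⟦X⟧} {M : ℕ} (h : P * Q = X ^ M) :
    IsDualBasis (Ideal.span {P}) (fun _ : Unit => P)
      (fun _ => HahnSeries.single (-(M : ℤ)) 1 * algebraMap A⟦X⟧ A⸨X⸩ Q) := by
  have h1 : HahnSeries.single (-(M : ℤ)) (1 : A) * algebraMap A⟦X⟧ A⸨X⸩ (X ^ M) = 1 := by
    rw [algebraMap_X_pow, HahnSeries.single_mul_single]
    simp
  have h2 : algebraMap A⟦X⟧ A⸨X⸩ P *
      (HahnSeries.single (-(M : ℤ)) 1 * algebraMap A⟦X⟧ A⸨X⸩ Q) = 1 := by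
    rw [mul_left_comm, ← map_mul, h, h1]
  refine ⟨fun _ => Ideal.mem_span_singleton_self P, fun _ x hx => ?_, by simpa using h2⟩
  obtain ⟨y, rfl⟩ := Ideal.mem_span_singleton.1 hx
  exact ⟨y, by rw [map_mul, ← mul_assoc, mul_comm _ (algebraMap A⟦X⟧ A⸨X⸩ P), h2, one_mul]⟩

theorem isSummand_span {P : A⟦X⟧} {M : ℕ} (h : P ∣ X ^ M) :
    IsSummand A (A⟦X⟧ ⧸ Ideal.span {P}) := by
  obtain ⟨Q, hQ⟩ := h
  exact (isDualBasis_span hQ.symm).isSummand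

theorem divisorNorm_span_map (φ : A →+* B) {P : A⟦X⟧} {M : ℕ} (h : P ∣ X ^ M) (f : A⟦X⟧) :
    divisorNorm (Ideal.span {PowerSeries.map φ P}) (PowerSeries.map φ f) =
      φ (divisorNorm (Ideal.span {P}) f) := by
  obtain ⟨Q, hQ⟩ := h
  have hQ' : PowerSeries.map φ P * PowerSeries.map φ Q = X ^ M := by
    rw [← map_mul, ← hQ, map_pow, PowerSeries.map_X]
  refine divisorNorm_map φ (isDualBasis_span hQ.symm) ?_ (fun x hx => ?_) f
  · convert isDualBasis_span hQ' using 2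
    rw [map_mul, mapLaurent_coe]
    congr 1
    ext n
    rw [mapLaurent_coeff, HahnSeries.coeff_single, HahnSeries.coeff_single]
    split_ifs <;> simp
  · obtain ⟨y, rfl⟩ := Ideal.mem_span_singleton.1 hx
    rw [map_mul]
    exact Ideal.mem_span_singleton.2 (dvd_mul_right _ _)

theorem exists_latticeDivisor_eq {P : A⟦X⟧} {M : ℕ} (h : P ∣ X ^ M) :
    ∃ Λ : grPos A, latticeDivisor Λ = Ideal.span {P} := by
  obtain ⟨Q, hQ⟩ := h
  have h2 := (isDualBasis_span hQ.symm).sum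
  rw [Fintype.sum_unique] at h2
  let g : A⸨X⸩ˣ := Units.mkOfMulEqOne _ _ h2
  refine ⟨⟨(principal g)⁻¹, ?_⟩, latticeDivisor_eq_span ?_⟩
  · change (1 : A⸨X⸩) ∈ (((principal g)⁻¹ : (Submodule A⟦X⟧ A⸨X⸩)ˣ) : Submodule A⟦X⟧ A⸨X⸩)
    rw [← map_inv, coe_principal, Submodule.mem_span_singleton]
    exact ⟨P, by rw [Algebra.smul_def]; exact g.mul_inv⟩
  · change (((principal g)⁻¹⁻¹ : (Submodule A⟦X⟧ A⸨X⸩)ˣ) : Submodule A⟦X⟧ A⸨X⸩) = _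
    rw [inv_inv]
    rfl

/-- The norm along `P = 0` of the power series with indeterminate coefficients. -/
def normPoly (P : A⟦X⟧) : MvPolynomial ℕ A :=
  divisorNorm (Ideal.span {PowerSeries.map MvPolynomial.C P}) (univSeries A)

/-- The universal series specializes to `f`, and norms commute with base change. Norms are thus
polynomial in the coefficients, which later allows identities between them to be tested at
`k`-points. -/
theorem eval_normPoly {P : A⟦X⟧} {M : ℕ} (h : P ∣ X ^ M) (f : A⟦X⟧) :
    MvPolynomial.eval (fun j => coeff j f) (normPoly P) = divisorNorm (Ideal.span {P}) f := by
  have h' : PowerSeries.map MvPolynomial.C P ∣ (X ^ M : (MvPolynomial ℕ A)⟦X⟧) := by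
    have := map_dvd (PowerSeries.map (MvPolynomial.C : A →+* MvPolynomial ℕ A)) h
    rwa [map_pow, PowerSeries.map_X] at this
  rw [normPoly, ← divisorNorm_span_map _ h', map_univSeries _ f fun j => MvPolynomial.eval_X j]
  congr 3
  ext j
  rw [PowerSeries.coeff_map, PowerSeries.coeff_map, MvPolynomial.eval_C]

end Principal

/-! ### The universal divisor over the symmetric powers -/

section Sym
variable {k : Type u} [Field k] {R : Type u} [CommRing R] [Algebra k R]
open TPow

variable (k R) in
/-- The pull-back of functions along the `i`-th projection. -/
def coordHom {m : ℕ} (i : Fin m) : R →ₐ[k] TPow k R m :=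
  AlgHom.ofLinearMap ((tmk k R m).toLinearMap 1 i)
    (by
      change tmk k R m (Function.update 1 i 1) = 1
      rw [Function.update_one]
      exact tmk_one)
    (fun x y => by
      change tmk k R m (Function.update 1 i (x * y)) =
        tmk k R m (Function.update 1 i x) * tmk k R m (Function.update 1 i y)
      rw [tmk_mul, ← Function.update_mul, one_mul])

theorem coordHom_apply {m : ℕ} (i : Fin m) (r : R) : coordHom k R i r = coord k R i r := rfl

theorem prod_coord (m : ℕ) (r : R) : ∏ i : Fin m, coord k R i r = tmk k R m fun _ => r := by
  let T : (Fin m → R) →* TPow k R m :=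
    { toFun := tmk k R m, map_one' := tmk_one, map_mul' := fun a b => (tmk_mul a b).symm }
  have h := map_prod T (fun i : Fin m => Function.update (1 : Fin m → R) i r) Finset.univ
  have e : ∏ i : Fin m, Function.update (1 : Fin m → R) i r = fun _ => r :=
    Finset.univ_prod_mulSingle fun _ : Fin m => r
  rw [e] at h
  exact h.symm

theorem coord_pow {m : ℕ} (i : Fin m) {r : R} {n : ℕ} (h : r ^ n = 0) :
    coord k R i r ^ n = 0 := by
  rw [← coordHom_apply, ← map_pow, h, map_zero]

variable (k R) in
/-- Restriction of functions to `Sym^m`, pulled back to the `m`-th power. -/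
def SymAll.proj (m : ℕ) : SymAll k R →+* TPow k R m :=
  ((SymT k R m).val.comp (Pi.evalAlgHom k (fun m => SymT k R m) m)).toRingHom

theorem map_proj_divisor (r : R) (m : ℕ) :
    PowerSeries.map (SymAll.proj k R m) (divisor k R r) = divisorAux k R r m := by
  ext j
  rw [PowerSeries.coeff_map]
  exact (congrArg (SymAll.proj k R m) (PowerSeries.coeff_mk j _)).trans rfl

theorem divisorAux_eq_rootProd (r : R) (m : ℕ) :
    divisorAux k R r m = rootProd (List.ofFn fun i => coord k R i r) := by
  rw [divisorAux, rootProd, List.map_ofFn, List.prod_ofFn]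
  rfl

/-- Each factor `X - c` has `c ^ n = 0` and divides `X ^ n`, with a geometric sum as cofactor. The
product of the cofactors is symmetric, so its coefficients are invariants; the extra power of `X`
makes the exponent the same for all `m < N`. -/
theorem exists_codivisor {r : R} {n : ℕ} (hr : r ^ n = 0) (N : ℕ) : ∃ E : (SymAll k R)⟦X⟧,
    ∀ m < N, PowerSeries.map (SymAll.proj k R m) (divisor k R r * E) = X ^ (n * N) := by
  let G : ∀ m, TPow k R m → (TPow k R m)⟦X⟧ := fun m c =>
    ∑ j ∈ Finset.range n, X ^ j * C c ^ (n - 1 - j)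
  have hG : ∀ m (σ : Equiv.Perm (Fin m)) c, PowerSeries.map (perm k R σ).toRingHom (G m c) =
      G m (perm k R σ c) := fun m σ c => by
    simp only [G, map_sum, map_mul, map_pow, PowerSeries.map_X, PowerSeries.map_C]
    rfl
  let E : ∀ m, (TPow k R m)⟦X⟧ := fun m => X ^ (n * (N - m)) * ∏ i : Fin m, G m (coord k R i r)
  have hE : ∀ m (σ : Equiv.Perm (Fin m)), PowerSeries.map (perm k R σ).toRingHom (E m) = E m :=
    fun m σ => by
      simp only [E, map_mul, map_pow, PowerSeries.map_X, map_prod, hG]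
      congr 1
      refine Fintype.prod_equiv σ.symm _ _ fun i => ?_
      rw [perm_coord]
  refine ⟨PowerSeries.mk fun j => fun m => ⟨coeff j (E m), fun σ => ?_⟩, fun m hm => ?_⟩
  · have := congrArg (coeff j) (hE m σ)
    rwa [PowerSeries.coeff_map] at this
  · have e : PowerSeries.map (SymAll.proj k R m) (PowerSeries.mk fun j => fun m =>
        (⟨coeff j (E m), fun σ => by
          have := congrArg (coeff j) (hE m σ)
          rwa [PowerSeries.coeff_map] at this⟩ : SymT k R m)) = E m := by
      ext j
      rw [PowerSeries.coeff_map]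
      exact (congrArg (SymAll.proj k R m) (PowerSeries.coeff_mk j _)).trans rfl
    rw [map_mul, map_proj_divisor, e]
    simp only [E]
    rw [mul_left_comm, divisorAux, ← Finset.prod_mul_distrib]
    have h1 : ∀ i : Fin m, (X - C (coord k R i r)) * G m (coord k R i r) = X ^ n := fun i => by
      rw [(Commute.all _ _).mul_geom_sum₂ n, ← map_pow, coord_pow i hr, map_zero, sub_zero]
    rw [Finset.prod_congr rfl fun i _ => h1 i, Finset.prod_const, Finset.card_univ,
      Fintype.card_fin, ← pow_mul, ← pow_add, ← mul_add, Nat.sub_add_cancel hm.le]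

variable {B : Type u} [CommRing B] [Algebra k B]

/-- A point sees only the components below its bound, and invariants embed into the tensor power. -/
theorem SymPoint.eq_of_proj {φ : SymPoint k R B} {x y : SymAll k R}
    (h : ∀ m < φ.bound, SymAll.proj k R m x = SymAll.proj k R m y) : φ.1 x = φ.1 y := by
  rw [← sub_eq_zero, ← map_sub]
  refine φ.2.choose_spec _ fun m hm => Subtype.ext ?_
  have := h m hm
  rw [← sub_eq_zero, ← map_sub] at this
  exact this

theorem map_divisor_dvd {r : R} {n : ℕ} (hr : r ^ n = 0) (φ : SymPoint k R B) :
    PowerSeries.map φ.1.toRingHom (divisor k R r) ∣ X ^ (n * φ.bound) := by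
  obtain ⟨E, hE⟩ := exists_codivisor (k := k) hr φ.bound
  refine ⟨PowerSeries.map φ.1.toRingHom E, ?_⟩
  have e : (X ^ (n * φ.bound) : B⟦X⟧) = PowerSeries.map φ.1.toRingHom (X ^ (n * φ.bound)) := by
    rw [map_pow, PowerSeries.map_X]
  rw [← map_mul, e]
  ext j
  rw [PowerSeries.coeff_map, PowerSeries.coeff_map]
  refine SymPoint.eq_of_proj fun m hm => ?_
  rw [← PowerSeries.coeff_map, ← PowerSeries.coeff_map, hE m hm, map_pow, PowerSeries.map_X]

end Sym

/-! ### The pairing of `Gr^{pos,≤n}` -/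

section SymPairing
variable {k : Type u} [Field k]

theorem mk_X_pow_trunc (n : ℕ) :
    (Ideal.Quotient.mk (Ideal.span {(X ^ n : k⟦X⟧)}) X : Trunc n k) ^ n = 0 := by
  rw [← map_pow]
  exact Ideal.Quotient.eq_zero_iff_mem.2 (Ideal.mem_span_singleton_self _)

theorem trunc_eq_sum (n : ℕ) (f : k⟦X⟧) : (Ideal.Quotient.mk (Ideal.span {(X ^ n : k⟦X⟧)}) f) =
    ∑ j ∈ Finset.range n, coeff j f • (Ideal.Quotient.mk (Ideal.span {(X ^ n : k⟦X⟧)}) X) ^ j := by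
  have e : ∑ j ∈ Finset.range n,
      coeff j f • (Ideal.Quotient.mk (Ideal.span {(X ^ n : k⟦X⟧)}) X) ^ j =
      Ideal.Quotient.mk (Ideal.span {(X ^ n : k⟦X⟧)})
        (∑ j ∈ Finset.range n, coeff j f • X ^ j) := by
    rw [map_sum]
    refine Finset.sum_congr rfl fun j _ => ?_
    rw [← map_pow]
    rfl
  rw [e, mk_trunc_eq]
  intro i hi
  rw [map_sum, Finset.sum_eq_single i]
  · simp
  · intro j _ hj
    rw [PowerSeries.coeff_smul, PowerSeries.coeff_X_pow, if_neg hj.symm, smul_zero]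
  · intro h
    exact absurd (Finset.mem_range.2 hi) h

/-- Both sides are `∑ coeff j f * c ^ j` over `j < n`, where `c` is the `i`-th coordinate of the
universal cycle. -/
theorem ev_coord {n m : ℕ} (i : Fin m) (f : k⟦X⟧) :
    ev (coord k (Trunc n k) i (Ideal.Quotient.mk _ X))
      (PowerSeries.map (algebraMap k (TPow k (Trunc n k) m)) f) =
        coord k (Trunc n k) i (Ideal.Quotient.mk _ f) := by
  rw [ev_eq_sum (coord_pow i (mk_X_pow_trunc n)), trunc_eq_sum n f, ← coordHom_apply,
    ← coordHom_apply, map_sum]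
  refine Finset.sum_congr rfl fun j _ => ?_
  rw [map_smul, map_pow, PowerSeries.coeff_map, Algebra.smul_def]

variable {B : Type u} [CommRing B] [Algebra k B]

/-- The norm along a cycle of a power series with coefficients in `k`. -/
theorem divisorNorm_symDivisor {n : ℕ} (φ : SymPoint k (Trunc n k) B) (f : k⟦X⟧) :
    divisorNorm (symDivisor φ) (PowerSeries.map (algebraMap k B) f) =
      φ.1 (SymAll.pow k (Trunc n k) (Ideal.Quotient.mk _ f)) := by
  let R := Trunc n k
  let r : R := Ideal.Quotient.mk _ X
  -- `φ` factors through the image of the functions in finitely many tensor powers. Over that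
  -- quotient the universal divisor divides a power of `X`, so norms commute with base change both
  -- to `B` and to each tensor power.
  let ρ : SymAll k R →+* (∀ m : Fin φ.bound, TPow k R m) :=
    RingHom.pi fun m => SymAll.proj k R m
  let q := Ideal.Quotient.mk (RingHom.ker ρ)
  let ψ : (SymAll k R ⧸ RingHom.ker ρ) →+* B := Ideal.Quotient.lift _ φ.1.toRingHom fun x hx => by
    refine (SymPoint.eq_of_proj (y := 0) fun m hm => ?_).trans (map_zero φ.1)
    rw [map_zero]
    exact congrFun hx ⟨m, hm⟩
  have hψ : ψ.comp q = φ.1.toRingHom := RingHom.ext fun x => rfl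
  obtain ⟨E, hE⟩ := exists_codivisor (k := k) (R := R) (r := r) (mk_X_pow_trunc n) φ.bound
  have hP : PowerSeries.map q (divisor k R r) ∣ X ^ (n * φ.bound) := by
    refine ⟨PowerSeries.map q E, ?_⟩
    rw [← map_mul, ← PowerSeries.map_X q, ← map_pow]
    ext j
    rw [PowerSeries.coeff_map, PowerSeries.coeff_map]
    refine (Ideal.Quotient.eq.2 ((RingHom.sub_mem_ker_iff ρ).2 (funext fun m => ?_))).symm
    have := hE m m.2
    rw [← PowerSeries.map_X (SymAll.proj k R m), ← map_pow] at this
    exact congrArg (coeff j) this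
  -- The identity is tested in each tensor power, where the divisor splits and the norm is the
  -- product of the values at the coordinates, `f ⊗ ⋯ ⊗ f`.
  have key : divisorNorm (Ideal.span {PowerSeries.map q (divisor k R r)})
      (PowerSeries.map (q.comp (algebraMap k _)) f) =
        q (SymAll.pow k R (Ideal.Quotient.mk _ f)) := by
    refine RingHom.kerLift_injective ρ (funext fun m => ?_)
    let h : (SymAll k R ⧸ RingHom.ker ρ) →+* TPow k R m :=
      (Pi.evalRingHom (fun m : Fin φ.bound => TPow k R m) m).comp ρ.kerLift
    have hh : h.comp q = SymAll.proj k R m := RingHom.ext fun x => rfl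
    change h (divisorNorm (Ideal.span {PowerSeries.map q (divisor k R r)})
      (PowerSeries.map (q.comp (algebraMap k _)) f)) =
        h (q (SymAll.pow k R (Ideal.Quotient.mk _ f)))
    rw [← divisorNorm_span_map h hP, ← RingHom.comp_apply h q,
      ← RingHom.comp_apply (PowerSeries.map h),
      ← RingHom.comp_apply (PowerSeries.map h), ← PowerSeries.map_comp, ← PowerSeries.map_comp,
      ← RingHom.comp_assoc, hh, map_proj_divisor, divisorAux_eq_rootProd,
      (divisorNorm_rootProd (fun τ hτ => ?_) _).2]
    · rw [List.map_ofFn, List.prod_ofFn]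
      refine (Finset.prod_congr rfl fun i _ => ev_coord i f).trans ?_
      exact prod_coord _ _
    · obtain ⟨i, rfl⟩ := (List.mem_ofFn' _ _).1 hτ
      exact ⟨n, coord_pow i (mk_X_pow_trunc n)⟩
  have h1 := congrArg ψ key
  rw [← divisorNorm_span_map ψ hP, ← RingHom.comp_apply ψ q,
      ← RingHom.comp_apply (PowerSeries.map ψ),
      ← RingHom.comp_apply (PowerSeries.map ψ), ← PowerSeries.map_comp, ← PowerSeries.map_comp,
      ← RingHom.comp_assoc, hψ, AlgHom.toRingHom_eq_coe, AlgHom.comp_algebraMap] at h1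
  exact h1

theorem symDivisor_dvd {n : ℕ} (φ : SymPoint k (Trunc n k) B) :
    PowerSeries.map φ.1.toRingHom (divisor k (Trunc n k) (Ideal.Quotient.mk _ X)) ∣
      X ^ (n * φ.bound) := map_divisor_dvd (mk_X_pow_trunc n) φ

/-- The norm along a cycle, as a polynomial in the coefficients of the function. -/
def symPoly {n : ℕ} (φ : SymPoint k (Trunc n k) B) : MvPolynomial ℕ B :=
  normPoly (PowerSeries.map φ.1.toRingHom (divisor k (Trunc n k) (Ideal.Quotient.mk _ X)))

theorem eval_symPoly {n : ℕ} (φ : SymPoint k (Trunc n k) B) (f : B⟦X⟧) :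
    MvPolynomial.eval (fun j => coeff j f) (symPoly φ) = divisorNorm (symDivisor φ) f :=
  eval_normPoly (symDivisor_dvd φ) f

theorem eval_symPoly_base {n : ℕ} (φ : SymPoint k (Trunc n k) B) (c : ℕ → k) :
    MvPolynomial.eval (fun j => algebraMap k B (c j)) (symPoly φ) =
      φ.1 (SymAll.pow k (Trunc n k) (Ideal.Quotient.mk _ (PowerSeries.mk c))) := by
  rw [← divisorNorm_symDivisor, ← eval_symPoly]
  congr 2
  funext j
  rw [PowerSeries.coeff_map, PowerSeries.coeff_mk]

variable [CharZero k]

/-- For series over `k` the norm is the value of the point on a tensor `r ⊗ ⋯ ⊗ r`, where a sum of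
cycles acts by the product; density of `k`-points does the rest. -/
theorem symPoly_mul {n : ℕ} (φ ψ : SymPoint k (Trunc n k) B) :
    symPoly (φ * ψ) = symPoly φ * symPoly ψ := by
  refine sub_eq_zero.1 (mvPolynomial_eq_zero (k := k) _ fun c => ?_)
  rw [map_sub, map_mul, eval_symPoly_base, eval_symPoly_base, eval_symPoly_base,
    SymPoint.mul_pow', sub_self]

theorem symPoly_one (n : ℕ) : symPoly (1 : SymPoint k (Trunc n k) B) = 1 := by
  refine sub_eq_zero.1 (mvPolynomial_eq_zero (k := k) _ fun c => ?_)
  rw [map_sub, map_one, eval_symPoly_base, SymPoint.one_pow', sub_self]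

/-- For series over `k` the norm depends only on the class modulo `t ^ n`, so by density the norm
polynomial involves only the first `n` variables. -/
theorem symPoly_trunc {n : ℕ} (φ : SymPoint k (Trunc n k) B) :
    MvPolynomial.bind₁ (fun j => if j < n then MvPolynomial.X j else 0) (symPoly φ) =
      symPoly φ := by
  refine sub_eq_zero.1 (mvPolynomial_eq_zero (k := k) _ fun c => ?_)
  have e : ∀ H : MvPolynomial ℕ B, MvPolynomial.eval (fun j => algebraMap k B (c j))
      (MvPolynomial.bind₁ (fun j => if j < n then MvPolynomial.X j else 0) H) =
      MvPolynomial.eval (fun j => algebraMap k B (if j < n then c j else 0)) H := fun H => by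
    rw [← MvPolynomial.coe_aeval_eq_eval, ← MvPolynomial.coe_aeval_eq_eval]
    refine (MvPolynomial.aeval_bind₁ _ _ _).trans ?_
    change MvPolynomial.aeval _ H = MvPolynomial.aeval _ H
    congr 2
    funext j
    split_ifs <;> simp
  rw [map_sub, e, eval_symPoly_base, eval_symPoly_base, sub_eq_zero]
  congr 2
  rw [mk_trunc_eq]
  intro j hj
  rw [PowerSeries.coeff_mk, PowerSeries.coeff_mk, if_pos hj]

theorem divisorNorm_symDivisor_congr {n : ℕ} (φ : SymPoint k (Trunc n k) B) {f g : B⟦X⟧}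
    (h : ∀ j < n, coeff j f = coeff j g) :
    divisorNorm (symDivisor φ) f = divisorNorm (symDivisor φ) g := by
  have e : ∀ f : B⟦X⟧, divisorNorm (symDivisor φ) f =
      MvPolynomial.aeval (fun j => if j < n then coeff j f else 0) (symPoly φ) := fun f => by
    rw [← eval_symPoly]
    conv_lhs => rw [← symPoly_trunc]
    rw [← MvPolynomial.coe_aeval_eq_eval]
    refine (MvPolynomial.aeval_bind₁ _ _ _).trans ?_
    congr 2
    funext j
    split_ifs <;> simp
  rw [e, e]
  congr 2
  funext j
  split_ifs with hj
  · exact h j hj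
  · rfl

theorem symDivisor_map {n : ℕ} {C : Type u} [CommRing C] [Algebra k C] (χ : B →ₐ[k] C)
    (φ : SymPoint k (Trunc n k) B) (f : B⟦X⟧) :
    divisorNorm (symDivisor (SymPoint.map χ φ)) (PowerSeries.map χ.toRingHom f) =
      χ (divisorNorm (symDivisor φ) f) := divisorNorm_span_map χ.toRingHom (symDivisor_dvd φ) f

/-- The norm along a cycle of a function on `Spec B⟦t⟧ / t ^ n`. -/
def symNorm {n : ℕ} (φ : SymPoint k (Trunc n k) B) (y : Trunc n B) : B :=
  divisorNorm (symDivisor φ) (truncRep n y)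

theorem symNorm_mk {n : ℕ} (φ : SymPoint k (Trunc n k) B) (f : B⟦X⟧) :
    symNorm φ (Ideal.Quotient.mk (Ideal.span {(X ^ n : B⟦X⟧)}) f) =
      divisorNorm (symDivisor φ) f :=
  divisorNorm_symDivisor_congr φ (mk_trunc_eq.1 (mk_truncRep n _))

theorem symNorm_map {n : ℕ} {C : Type u} [CommRing C] [Algebra k C] (χ : B →ₐ[k] C)
    (φ : SymPoint k (Trunc n k) B) (y : Trunc n B) :
    symNorm (SymPoint.map χ φ) (truncMap n χ.toRingHom y) = χ (symNorm φ y) := by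
  rw [symNorm, truncRep_map, symDivisor_map, symNorm]

theorem symNorm_one_left {n : ℕ} (y : Trunc n B) :
    symNorm (1 : SymPoint k (Trunc n k) B) y = 1 := by
  rw [symNorm, ← eval_symPoly, symPoly_one, map_one]

theorem symNorm_mul_left {n : ℕ} (φ ψ : SymPoint k (Trunc n k) B) (y : Trunc n B) :
    symNorm (φ * ψ) y = symNorm φ y * symNorm ψ y := by
  rw [symNorm, ← eval_symPoly, symPoly_mul, map_mul, eval_symPoly, eval_symPoly]
  rfl

theorem symNorm_one_right {n : ℕ} (φ : SymPoint k (Trunc n k) B) : symNorm φ 1 = 1 :=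
  (symNorm_mk φ 1).trans (divisorNorm_one (isSummand_span (symDivisor_dvd φ)))

theorem symNorm_mul_right {n : ℕ} (φ : SymPoint k (Trunc n k) B) (y z : Trunc n B) :
    symNorm φ (y * z) = symNorm φ y * symNorm φ z := by
  obtain ⟨f, rfl⟩ := Ideal.Quotient.mk_surjective y
  obtain ⟨g, rfl⟩ := Ideal.Quotient.mk_surjective z
  rw [← map_mul, symNorm_mk, symNorm_mk, symNorm_mk]
  exact divisorNorm_mul (isSummand_span (symDivisor_dvd φ)) f g

variable (k) in
/-- The pairing of `Gr^{pos,≤n}` with `𝔏_n⁺𝔸¹`. -/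
def symPairing (n : ℕ) : Pairing (GrPosLe k n) (LnA1 k n) where
  toFun A φ y := symNorm (B := A) φ y
  map_map f x y := symNorm_map f.hom x y
  one_left _ y := symNorm_one_left y
  one_right _ x := symNorm_one_right x
  mul_left _ x x' y := symNorm_mul_left x x' y
  mul_right _ x y z := symNorm_mul_right x y z

/-- In this form perfectness says that points of the symmetric powers are the multiplicative
polynomial laws. -/
theorem symPairing_char {n : ℕ} (A : CommAlgCat.{u} k) (φ : SymPoint k (Trunc n k) A)
    (y : Trunc n k) : (symPairing k n).char (A := A) φ y = φ.1 (SymAll.pow k (Trunc n k) y) := by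
  obtain ⟨f, rfl⟩ := Ideal.Quotient.mk_surjective y
  exact (symNorm_mk φ (PowerSeries.map (algebraMap k A) f)).trans (divisorNorm_symDivisor φ f)

end SymPairing

/-! ### Multiplicative polynomial laws as points of symmetric powers -/

section PolynomialLaws
variable {k : Type u} [Field k] {R : Type u} [CommRing R] [Algebra k R]
  {A : Type u} [CommRing A] [Algebra k A]
open TPow

variable (k R A) in
/-- The polynomial maps from `R` to `A`. -/
def polyLaws : Submodule k (R → A) :=
  Submodule.span k {F | ∃ (m : ℕ) (ψ : TPow k R m →ₗ[k] A), F = fun r => ψ (tmk k R m fun _ => r)}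

theorem polyLaws_of {m : ℕ} (ψ : TPow k R m →ₗ[k] A) :
    (fun r => ψ (tmk k R m fun _ => r)) ∈ polyLaws k R A := Submodule.subset_span ⟨m, ψ, rfl⟩

theorem polyLaws_const (a : A) : (fun _ => a) ∈ polyLaws k R A := by
  have := polyLaws_of (R := R) ((LinearMap.toSpanSingleton k A a) ∘ₗ
    (SymPoint.aug k R).toLinearMap)
  convert this using 2
  change a = SymPoint.aug k R _ • a
  rw [SymPoint.aug_tmk, one_smul]

theorem polyLaws_linear (ℓ : R →ₗ[k] A) : (fun r => ℓ r) ∈ polyLaws k R A := by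
  have := polyLaws_of (A := A) (liftLin (m := 1) (MultilinearMap.ofSubsingleton k R A 0 ℓ))
  convert this using 2
  rw [liftLin_tmk]
  rfl

/-- Through `split`, a product of homogeneous laws of degrees `m` and `m'` is homogeneous of degree
`m + m'`. -/
theorem polyLaws_mul {F F' : R → A} (hF : F ∈ polyLaws k R A) (hF' : F' ∈ polyLaws k R A) :
    F * F' ∈ polyLaws k R A := by
  induction hF using Submodule.span_induction with
  | zero => rw [zero_mul]; exact Submodule.zero_mem _
  | add a b _ _ ha hb => rw [add_mul]; exact Submodule.add_mem _ ha hb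
  | smul c a _ ha => rw [smul_mul_assoc]; exact Submodule.smul_mem _ _ ha
  | mem a ha =>
    induction hF' using Submodule.span_induction with
    | zero => rw [mul_zero]; exact Submodule.zero_mem _
    | add b c _ _ hb hc => rw [mul_add]; exact Submodule.add_mem _ hb hc
    | smul c b _ hb => rw [mul_smul_comm]; exact Submodule.smul_mem _ _ hb
    | mem b hb =>
      obtain ⟨m, ψ, rfl⟩ := ha
      obtain ⟨m', ψ', rfl⟩ := hb
      let L : TPow k R m ⊗[k] TPow k R m' →ₗ[k] A :=
        TensorProduct.lift ((LinearMap.mul k A).compl₁₂ ψ ψ')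
      have e : ((fun r => ψ (tmk k R m fun _ => r)) * fun r => ψ' (tmk k R m' fun _ => r)) =
          fun r => (L ∘ₗ (split k R m m').toLinearMap) (tmk k R (m + m') fun _ => r) := by
        funext r
        change _ = L (split k R m m' (tmk k R (m + m') fun _ => r))
        rw [split_tmk, TensorProduct.lift.tmul]
        rfl
      rw [e]
      exact polyLaws_of _

/-- Allowing every `M ≥ N` lets expansions of different lengths be added. -/
theorem exists_of_mem_polyLaws {F : R → A} (hF : F ∈ polyLaws k R A) :
    ∃ (N : ℕ) (ψ : ∀ m, TPow k R m →ₗ[k] A), ∀ M ≥ N, ∀ r,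
      F r = ∑ m ∈ Finset.range M, ψ m (tmk k R m fun _ => r) := by
  induction hF using Submodule.span_induction with
  | zero => exact ⟨0, 0, fun M _ r => by simp⟩
  | add a b _ _ ha hb =>
    obtain ⟨N, ψ, h⟩ := ha
    obtain ⟨N', ψ', h'⟩ := hb
    refine ⟨N + N', ψ + ψ', fun M hM r => ?_⟩
    rw [Pi.add_apply, h M (by omega), h' M (by omega), ← Finset.sum_add_distrib]
    rfl
  | smul c a _ ha =>
    obtain ⟨N, ψ, h⟩ := ha
    refine ⟨N, c • ψ, fun M hM r => ?_⟩
    rw [Pi.smul_apply, h M hM, Finset.smul_sum]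
    rfl
  | mem a ha =>
    obtain ⟨m, ψ, rfl⟩ := ha
    refine ⟨m + 1, Pi.single m ψ, fun M hM r => ?_⟩
    rw [Finset.sum_eq_single m]
    · rw [Pi.single_eq_same]
    · intro j _ hj
      rw [Pi.single_eq_of_ne hj, LinearMap.zero_apply]
    · intro h
      exact absurd (Finset.mem_range.2 (by omega)) h

variable [CharZero k]

/-- Replacing `r` by `c • r` separates the degrees, as `k` is infinite, and the tensors `r ⊗ ⋯ ⊗ r`
span the invariants. -/
theorem SymT.linearMap_eq_zero (N : ℕ) (D : ∀ m, SymT k R m →ₗ[k] A)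
    (h : ∀ r, ∑ m ∈ Finset.range N, D m (SymT.pow k R m r) = 0) : ∀ m < N, D m = 0 := by
  intro m hm
  have h1 : ∀ r, D m (SymT.pow k R m r) = 0 := fun r => by
    refine eq_zero_of_sum_pow_smul (k := k) N (fun m => D m (SymT.pow k R m r)) (fun c => ?_) m hm
    rw [← h (c • r)]
    refine Finset.sum_congr rfl fun j _ => ?_
    have e : SymT.pow k R j (c • r) = c ^ j • SymT.pow k R j r := Subtype.ext (by
      change tmk k R j (fun _ => c • r) = c ^ j • tmk k R j (fun _ => r)
      rw [MultilinearMap.map_smul_univ (tmk k R j) (fun _ => c) (fun _ => r)]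
      simp)
    rw [e, map_smul]
  refine LinearMap.ext fun s => ?_
  have hs : s ∈ Submodule.span k (Set.range (SymT.pow k R m)) := by
    rw [SymT.span_pow]; trivial
  induction hs using Submodule.span_induction with
  | mem x hx => obtain ⟨r, rfl⟩ := hx; exact h1 r
  | zero => simp
  | add x y _ _ hx hy => rw [map_add, hx, hy]; simp
  | smul c x _ hx => rw [map_smul, hx]; simp

/-- A multiplicative polynomial law is given by a point of the coproduct of the `Sym^m`. -/
theorem exists_symPoint (G : R →* A) (hG : (G : R → A) ∈ polyLaws k R A) :
    ∃ φ : SymPoint k R A, ∀ r, φ.1 (SymAll.pow k R r) = G r := by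
  obtain ⟨N, ψ, h⟩ := exists_of_mem_polyLaws hG
  let ψ' : ∀ m, SymT k R m →ₗ[k] A := fun m => ψ m ∘ₗ (SymT k R m).val.toLinearMap
  let Φ : SymAll k R →ₗ[k] A := ∑ m ∈ Finset.range N, ψ' m ∘ₗ
    (Pi.evalAlgHom k (fun m => SymT k R m) m).toLinearMap
  have hΦ : ∀ x, Φ x = ∑ m ∈ Finset.range N, ψ' m (x m) := fun x => by
    simp only [Φ, LinearMap.sum_apply]
    rfl
  have hpow : ∀ r, Φ (SymAll.pow k R r) = G r := fun r => by
    rw [hΦ]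
    exact (h N le_rfl r).symm
  -- The defect of multiplicativity against a fixed `z` is a finite sum of linear maps on the
  -- components, so it vanishes once it vanishes on all `pow r`.
  have ext : ∀ (a : A) (z : SymAll k R), (∀ r, Φ (SymAll.pow k R r * z) =
      Φ (SymAll.pow k R r) * a) → ∀ x, Φ (x * z) = Φ x * a := fun a z hz x => by
    let D : ∀ m, SymT k R m →ₗ[k] A := fun m =>
      ψ' m ∘ₗ LinearMap.mulRight k (z m) - LinearMap.mulRight k a ∘ₗ ψ' m
    have hD : ∀ x, ∑ m ∈ Finset.range N, D m (x m) = Φ (x * z) - Φ x * a := fun x => by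
      rw [hΦ, hΦ, Finset.sum_mul, ← Finset.sum_sub_distrib]
      rfl
    rw [← sub_eq_zero, ← hD]
    refine Finset.sum_eq_zero fun m hm => ?_
    rw [SymT.linearMap_eq_zero N D (fun r => (hD (SymAll.pow k R r)).trans (by rw [hz, sub_self])) m
      (Finset.mem_range.1 hm), LinearMap.zero_apply]
  have pow_mul : ∀ r s, SymAll.pow k R r * SymAll.pow k R s = SymAll.pow k R (r * s) := fun r s =>
    funext fun m => (SymT.pow_mul k R m r s).symm
  -- Multiplicativity on pairs of powers is that of `G`; it is extended to general elements in one
  -- variable at a time.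
  have h1 : ∀ s x, Φ (x * SymAll.pow k R s) = Φ x * Φ (SymAll.pow k R s) := fun s =>
    ext _ _ fun r => by rw [pow_mul, hpow, hpow, hpow, map_mul]
  have h2 : ∀ x y, Φ (x * y) = Φ x * Φ y := fun x y => ext _ _ (fun r => by
    rw [mul_comm, h1, mul_comm]) x
  refine ⟨⟨AlgHom.ofLinearMap Φ ?_ h2, N, fun x hx => ?_⟩, hpow⟩
  · rw [← SymPoint.pow_one, hpow, map_one]
  · change Φ x = 0
    rw [hΦ]
    exact Finset.sum_eq_zero fun m hm => by rw [hx m (Finset.mem_range.1 hm), map_zero]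

end PolynomialLaws

/-! ### Perfectness for effective divisors -/

section Perfect
variable {k : Type u} [Field k]

/-- Functions can be pulled back along natural maps. -/
theorem IsRegular.comp {Y Z : MonoidPrestack k} {A : Type u} [AddCommGroup A] [Module k A]
    {G : Z.obj (CommAlgCat.of k k) → A} (hG : IsRegular Z G)
    (r : ∀ B : CommAlgCat.{u} k, Y.obj B → Z.obj B)
    (hr : ∀ (B C : CommAlgCat.{u} k) (f : B ⟶ C) y, r C (Y.map f y) = Z.map f (r B y)) :
    IsRegular Y fun y => G (r _ y) := fun ξ => by
  obtain ⟨q, hq⟩ := hG ξ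
  refine ⟨⟨fun B y => q.1 B (r B y), fun B C f y => ?_⟩, fun y => hq _⟩
  change q.1 C (r C (Y.map f y)) = f (q.1 B (r B y))
  rw [hr, q.2]

/-- Regular maps from `k⟦t⟧` are polynomial in the coefficients. -/
theorem IsRegular.exists_polynomials {A : Type u} [CommRing A] [Algebra k A] [Module.Finite k A]
    {G : k⟦X⟧ → A} (hG : IsRegular (LPlusA1 k) G) :
    ∃ p : Module.Free.ChooseBasisIndex k A → MvPolynomial ℕ k, ∀ f,
      G f = ∑ i, evalCoeffs f (p i) • Module.Free.chooseBasis k A i := by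
  let b := Module.Free.chooseBasis k A
  choose q hq using fun i => hG (b.coord i)
  choose p hp using fun i => exists_ofPoly (q i)
  refine ⟨p, fun f => ?_⟩
  rw [← b.sum_repr (G f)]
  refine Finset.sum_congr rfl fun i _ => ?_
  congr 1
  refine (hq i f).trans ?_
  rw [← hp]
  rfl

theorem IsRegular.of_polynomials {A : Type u} [CommRing A] [Algebra k A] {ι : Type*} [Fintype ι]
    (p : ι → MvPolynomial ℕ k) (e : ι → A) :
    IsRegular (LPlusA1 k) fun f : k⟦X⟧ => ∑ i, evalCoeffs f (p i) • e i := fun ξ => by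
  refine ⟨ofPoly (∑ i, ξ (e i) • p i), fun f => ?_⟩
  refine Eq.trans ?_ (ofPoly_apply _ (CommAlgCat.of k k) f).symm
  rw [map_sum, map_sum]
  refine Finset.sum_congr rfl fun i _ => ?_
  rw [map_smul, map_smul, smul_eq_mul, smul_eq_mul, mul_comm]

theorem IsRegular.comp_truncRep {A : Type u} [AddCommGroup A] [Module k A] {G : k⟦X⟧ → A}
    (hG : IsRegular (LPlusA1 k) G) (n : ℕ) :
    IsRegular (LnA1 k n) fun y : Trunc n k => G (truncRep n y) :=
  IsRegular.comp (Y := LnA1 k n) (Z := LPlusA1 k) (G := G) hG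
    (fun B y => truncRep (B := B) n y) fun _ _ f y => truncRep_map n f.hom.toRingHom y

/-- The coefficients of an element of `k⟦t⟧ / t ^ n`. -/
def truncCoeff (n j : ℕ) : Trunc n k →ₗ[k] k where
  toFun y := coeff j (truncRep n y)
  map_add' x y := by
    obtain ⟨f, rfl⟩ := Ideal.Quotient.mk_surjective x
    obtain ⟨g, rfl⟩ := Ideal.Quotient.mk_surjective y
    rw [← map_add, coeff_truncRep_mk, coeff_truncRep_mk, coeff_truncRep_mk]
    split_ifs <;> simp
  map_smul' c y := by
    obtain ⟨f, rfl⟩ := Ideal.Quotient.mk_surjective y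
    have e : c • Ideal.Quotient.mk (Ideal.span {(X ^ n : k⟦X⟧)}) f =
      Ideal.Quotient.mk (Ideal.span {(X ^ n : k⟦X⟧)}) (c • f) := rfl
    rw [e, coeff_truncRep_mk, coeff_truncRep_mk]
    split_ifs <;> simp

variable [CharZero k]

/-- A regular character is polynomial in the coefficients of its argument, and these are linear
functions, so it is a polynomial law. -/
theorem exists_symPoint_of_isRegular {A : Type u} [CommRing A] [Algebra k A] [Module.Finite k A]
    {n : ℕ} (G : Trunc n k →* A) (hG : IsRegular (LnA1 k n) G) :
    ∃ φ : SymPoint k (Trunc n k) A, ∀ y, φ.1 (SymAll.pow k (Trunc n k) y) = G y := by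
  have hG' : IsRegular (LPlusA1 k) fun f : k⟦X⟧ => G (Ideal.Quotient.mk _ f) :=
    IsRegular.comp (Y := LPlusA1 k) (Z := LnA1 k n) (G := G) hG
      (fun B => Ideal.Quotient.mk (Ideal.span {(X ^ n : B⟦X⟧)})) fun _ _ _ _ => rfl
  obtain ⟨p, hp⟩ := hG'.exists_polynomials
  have hmem : ((G : Trunc n k →* A) : Trunc n k → A) ∈ polyLaws k (Trunc n k) A := by
    have e : ((G : Trunc n k →* A) : Trunc n k → A) =
        ∑ i, fun y => evalCoeffs (truncRep n y) (p i) • Module.Free.chooseBasis k A i := by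
      funext y
      rw [Finset.sum_apply]
      refine Eq.trans ?_ (hp _)
      exact congrArg G (mk_truncRep n y).symm
    rw [e]
    refine Submodule.sum_mem _ fun i _ => ?_
    have h1 : ∀ P : MvPolynomial ℕ k, (fun y : Trunc n k =>
        algebraMap k A (evalCoeffs (truncRep n y) P)) ∈ polyLaws k (Trunc n k) A := fun P => by
      induction P using MvPolynomial.induction_on with
      | C a =>
        convert polyLaws_const (k := k) (R := Trunc n k) (algebraMap k A a) using 2
        rw [evalCoeffs, MvPolynomial.aeval_C]
        rfl
      | add P Q hP hQ =>
        simp only [map_add]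
        exact Submodule.add_mem _ hP hQ
      | mul_X P j hP =>
        simp only [map_mul, evalCoeffs_X]
        exact polyLaws_mul hP (polyLaws_linear (Algebra.linearMap k A ∘ₗ truncCoeff n j))
    have h2 := polyLaws_mul (h1 (p i)) (polyLaws_const (Module.Free.chooseBasis k A i))
    convert h2 using 2
    rw [Algebra.smul_def]
    rfl
  exact exists_symPoint G hmem

theorem isPerfect_symPairing (n : ℕ) : IsPerfect (symPairing k n) where
  inj A _ φ φ' h := SymPoint.ext_pow fun r =>
    (symPairing_char A φ r).symm.trans ((h r).trans (symPairing_char A φ' r))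
  surj A hA G hG := by
    obtain ⟨φ, hφ⟩ := exists_symPoint_of_isRegular (A := A) G hG
    exact ⟨φ, fun y => (symPairing_char A φ y).trans (hφ y)⟩

theorem unit_eq_of_baseChange {A : Type u} [CommRing A] (Λ Λ' : (Submodule A⟦X⟧ A⸨X⸩)ˣ)
    (h : ∀ a : A, a ≠ 0 → ∃ (B : Type u) (_ : CommRing B) (φ : A →+* B), φ a ≠ 0 ∧
      Units.map (baseChange φ) Λ = Units.map (baseChange φ) Λ') : Λ = Λ' := by
  have key : ∀ Λ Λ' : (Submodule A⟦X⟧ A⸨X⸩)ˣ, (∀ a : A, a ≠ 0 → ∃ (B : Type u) (_ : CommRing B)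
      (φ : A →+* B), φ a ≠ 0 ∧ Units.map (baseChange φ) Λ = Units.map (baseChange φ) Λ') →
      (Λ : Submodule A⟦X⟧ A⸨X⸩) ≤ Λ' := fun Λ Λ' h x hx => by
    refine mem_of_baseChange Λ' x fun a ha => ?_
    obtain ⟨B, _, φ, h0, e⟩ := h a ha
    refine ⟨B, inferInstance, φ, h0, ?_⟩
    have e' : baseChange φ (Λ : Submodule A⟦X⟧ A⸨X⸩) = baseChange φ Λ' := congrArg Units.val e
    rw [← e']
    exact mem_baseChange φ hx
  refine Units.ext (le_antisymm (key Λ Λ' h) (key Λ' Λ fun a ha => ?_))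
  obtain ⟨B, i, φ, h0, e⟩ := h a ha
  exact ⟨B, i, φ, h0, e.symm⟩

/-- A point of `Gr^pos` is determined by the norms of the functions `s - t`, `s ∈ kˣ`. -/
theorem grPos_ext {A : Type u} [CommRing A] [Algebra k A] {Λ Λ' : grPos A}
    (h : ∀ s : k, s ≠ 0 → latticeNorm Λ (C (algebraMap k A s) - X) =
      latticeNorm Λ' (C (algebraMap k A s) - X)) : Λ = Λ' := by
  refine Subtype.ext (unit_eq_of_baseChange _ _ fun a ha => ?_)
  obtain ⟨B, _, φ, h0, ⟨l, hl⟩, ⟨l', hl'⟩⟩ := exists_isSplit Λ Λ' ha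
  refine ⟨B, inferInstance, φ, h0, congrArg Subtype.val (?_ : mapPos φ Λ = mapPos φ Λ')⟩
  let _ : Algebra k B := (φ.comp (algebraMap k A)).toAlgebra
  -- For a split divisor the norm of `s - t` is the value of `∏ (X - τ_i)` at `s`.
  have hn : ∀ {Λ : grPos A} {l : List B}, IsSplit (mapPos φ Λ) l → ∀ s : k,
      ((l.map fun τ => Polynomial.X - Polynomial.C τ).prod : Polynomial B).eval (algebraMap k B s) =
        φ (latticeNorm Λ (C (algebraMap k A s) - X)) := fun {Λ l} hl s => by
    rw [← latticeNorm_map, hl.latticeNorm_eq, ← Polynomial.coe_evalRingHom, map_list_prod,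
      List.map_map]
    congr 1
    refine List.map_congr_left fun τ hτ => ?_
    rw [map_sub, PowerSeries.map_C, PowerSeries.map_X, ev_sub, ev_C (hl.nilpotent τ hτ),
      ev_X (hl.nilpotent τ hτ)]
    simp only [Function.comp_apply, Polynomial.coe_evalRingHom, Polynomial.eval_sub,
      Polynomial.eval_X, Polynomial.eval_C]
    rfl
  -- Leaving out `s = 0` keeps `s - t` invertible, so the same criterion serves `Gr`.
  have e := polynomial_eq_of_ne_zero (k := k) {0} fun s hs => (hn hl s).trans
    ((congrArg φ (h s fun h0 => hs (Finset.mem_singleton.2 h0))).trans (hn hl' s).symm)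
  have e' : rootProd l = rootProd l' := by rw [← coe_prod_X_sub_C, e, coe_prod_X_sub_C]
  refine Subtype.ext (inv_injective (Units.ext ?_))
  rw [hl.inv_eq, hl'.inv_eq, e']

/-- Finitely many polynomials involve finitely many coefficients, so the character factors through
some `k⟦t⟧ / t ^ n` and is the norm along a divisor from `Gr^{pos,≤n}`. -/
theorem exists_grPos_of_isRegular {A : Type u} [CommRing A] [Algebra k A] [Module.Finite k A]
    (G : k⟦X⟧ →* A) (hG : IsRegular (LPlusA1 k) G) :
    ∃ Λ : grPos A, ∀ f, latticeNorm Λ (PowerSeries.map (algebraMap k A) f) = G f := by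
  obtain ⟨p, hp⟩ := hG.exists_polynomials
  obtain ⟨n, hn⟩ : ∃ n, ∀ i, ∀ j ∈ (p i).vars, j < n :=
    ⟨∑ i, ∑ j ∈ (p i).vars, (j + 1), fun i j hj =>
      (Nat.lt_succ_self j).trans_le ((Finset.single_le_sum (f := fun j => j + 1)
        (fun _ _ => Nat.zero_le _) hj).trans (Finset.single_le_sum
          (f := fun i => ∑ j ∈ (p i).vars, (j + 1)) (fun _ _ => Nat.zero_le _)
          (Finset.mem_univ i)))⟩
  have hG1 : ∀ f g : k⟦X⟧, (∀ j < n, coeff j f = coeff j g) → G f = G g := fun f g hfg => by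
    rw [hp, hp]
    refine Finset.sum_congr rfl fun i _ => ?_
    congr 1
    rw [evalCoeffs_eq_eval, evalCoeffs_eq_eval]
    exact MvPolynomial.eval₂Hom_congr' rfl (fun j hj _ => hfg j (hn i j hj)) rfl
  let G' : Trunc n k →* A :=
    { toFun := fun y => G (truncRep n y : k⟦X⟧)
      map_one' := (hG1 _ 1 (mk_trunc_eq.1 (mk_truncRep n 1))).trans (map_one G)
      map_mul' := fun y z => (hG1 _ (truncRep n y * truncRep n z) (mk_trunc_eq.1 (by
        rw [map_mul, mk_truncRep, mk_truncRep, mk_truncRep]))).trans (map_mul G _ _) }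
  have hG' : IsRegular (LnA1 k n) G' := hG.comp_truncRep n
  obtain ⟨φ, hφ⟩ := exists_symPoint_of_isRegular G' hG'
  obtain ⟨Λ, hΛ⟩ := exists_latticeDivisor_eq (symDivisor_dvd φ)
  refine ⟨Λ, fun f => ?_⟩
  rw [latticeNorm, hΛ]
  refine (divisorNorm_symDivisor φ f).trans ((hφ _).trans ?_)
  exact hG1 _ _ (mk_trunc_eq.1 (mk_truncRep n _))

theorem isPerfect_posPairing : IsPerfect (posPairing k) where
  inj A _ Λ Λ' h := grPos_ext (A := A) (k := k) fun s _ => by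
    have := h (C s - X : k⟦X⟧)
    change latticeNorm (A := A) Λ (PowerSeries.map (algebraMap k A) (C s - X)) =
      latticeNorm (A := A) Λ' (PowerSeries.map (algebraMap k A) (C s - X)) at this
    rwa [map_sub, PowerSeries.map_C, PowerSeries.map_X] at this
  surj A hA G hG := exists_grPos_of_isRegular (A := A) G hG

end Perfect

/-! ### Perfectness for `Gr` and `Gr^{≤n}` -/

section Units
variable {k : Type u} [Field k] {A : Type u} [CommRing A] [Algebra k A]

variable (A) in
/-- Extension of scalars for invertible power series. -/
def baseUnit : k⟦X⟧ˣ →* A⟦X⟧ˣ := Units.map (PowerSeries.map (algebraMap k A)).toMonoidHom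

theorem coe_baseUnit (f : k⟦X⟧ˣ) :
    (baseUnit A f : A⟦X⟧) = PowerSeries.map (algebraMap k A) (f : k⟦X⟧) := rfl

theorem constantCoeff_baseUnit (f : k⟦X⟧ˣ) : constantCoeff (baseUnit A f : A⟦X⟧) =
    algebraMap k A (constantCoeff (f : k⟦X⟧)) := by
  rw [coe_baseUnit, ← PowerSeries.coeff_zero_eq_constantCoeff_apply, PowerSeries.coeff_map,
    PowerSeries.coeff_zero_eq_constantCoeff_apply]

/-- Regular maps from `k⟦t⟧ˣ` are polynomial in the coefficients, up to a power of the constant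
coefficient. -/
theorem IsRegular.exists_polynomials_unit [Module.Finite k A] {G : k⟦X⟧ˣ → A}
    (hG : IsRegular (LPlusGm k) G) :
    ∃ (N : ℕ) (p : Module.Free.ChooseBasisIndex k A → MvPolynomial ℕ k), ∀ f : k⟦X⟧ˣ,
      ∑ i, evalCoeffs (f : k⟦X⟧) (p i) • Module.Free.chooseBasis k A i =
        constantCoeff (f : k⟦X⟧) ^ N • G f := by
  let b := Module.Free.chooseBasis k A
  choose q hq using fun i => hG (b.coord i)
  choose N p hp using fun i => exists_ofPolyUnit (q i)
  -- The denominators of the coordinates are brought to the common exponent `∑ i, N i`.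
  refine ⟨∑ i, N i, fun i => MvPolynomial.X 0 ^ (∑ i, N i - N i) * p i, fun f => ?_⟩
  conv_rhs => rw [← b.sum_repr (G f), Finset.smul_sum]
  refine Finset.sum_congr rfl fun i _ => ?_
  rw [smul_smul]
  congr 1
  have h1 : b.repr (G f) i =
      (((constUnit f)⁻¹ ^ N i : kˣ) : k) * evalCoeffs (f : k⟦X⟧) (p i) := by
    refine (hq i f).trans ?_
    rw [← hp]
    rfl
  have h2 : ∑ i, N i = (∑ i, N i - N i) + N i :=
    (Nat.sub_add_cancel (Finset.single_le_sum (fun _ _ => Nat.zero_le _) (Finset.mem_univ i))).symm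
  rw [h1, map_mul, map_pow, evalCoeffs_X, PowerSeries.coeff_zero_eq_constantCoeff_apply,
    ← coe_constUnit]
  conv_rhs => rw [h2]
  rw [pow_add, mul_assoc]
  congr 1
  rw [← mul_assoc, ← Units.val_pow_eq_pow_val, ← Units.val_mul, inv_pow, mul_inv_cancel,
    Units.val_one, one_mul]

variable [CharZero k]

/-- Multiplicativity of a polynomial map can be checked on invertible series. -/
theorem polynomial_mul_of_units {ι : Type*} [Fintype ι] (p : ι → MvPolynomial ℕ k) (e : ι → A)
    {Γ : k⟦X⟧ → A} (hΓ : ∀ f, Γ f = ∑ i, evalCoeffs f (p i) • e i)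
    (h : ∀ f g : k⟦X⟧ˣ, Γ ((f : k⟦X⟧) * g) = Γ f * Γ g) (f g : k⟦X⟧) : Γ (f * g) = Γ f * Γ g := by
  let Γ' : (Polynomial k)⟦X⟧ → Polynomial A := fun F =>
    ∑ i, (evalCoeffs (k := k) F (p i)).map (algebraMap k A) * Polynomial.C (e i)
  have hΓ' : ∀ (c : k) (F : (Polynomial k)⟦X⟧), (Γ' F).eval (algebraMap k A c) =
      Γ (PowerSeries.map (Polynomial.aeval c).toRingHom F) := fun c F => by
    simp only [Γ', hΓ, Polynomial.eval_finsetSum, Polynomial.eval_mul, Polynomial.eval_C,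
      Polynomial.eval_map, Polynomial.eval₂_at_apply, evalCoeffs_map, Algebra.smul_def]
    rfl
  -- A variable constant is added to both series. The shift of each is invertible for all values of
  -- the variable but one, so the identity holds off at most two values, hence as polynomials, hence
  -- at `0`.
  let S : k⟦X⟧ → (Polynomial k)⟦X⟧ := fun f => PowerSeries.map Polynomial.C f + C Polynomial.X
  have hS : ∀ (c : k) f, PowerSeries.map (Polynomial.aeval c).toRingHom (S f) = f + C c :=
    fun c f => by
      have e1 : PowerSeries.map (Polynomial.aeval c : Polynomial k →ₐ[k] k).toRingHom
          (PowerSeries.map Polynomial.C f) = f := by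
        ext j
        rw [PowerSeries.coeff_map, PowerSeries.coeff_map]
        exact Polynomial.aeval_C c _
      rw [map_add, e1, PowerSeries.map_C]
      congr 2
      exact Polynomial.aeval_X c
  have hu : ∀ (f : k⟦X⟧) (c : k), c ≠ -constantCoeff f → IsUnit (f + C c) := fun f c hc => by
    rw [PowerSeries.isUnit_iff_constantCoeff, map_add, PowerSeries.constantCoeff_C]
    exact isUnit_iff_ne_zero.2 fun h0 => hc (eq_neg_of_add_eq_zero_right h0)
  classical
  have key : Γ' (S f * S g) = Γ' (S f) * Γ' (S g) :=
    polynomial_eq_of_ne_zero (k := k) {-constantCoeff f, -constantCoeff g} fun c hc => by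
      rw [Finset.mem_insert, Finset.mem_singleton, not_or] at hc
      rw [Polynomial.eval_mul, hΓ', hΓ', hΓ', map_mul, hS, hS]
      exact h (hu f c hc.1).unit (hu g c hc.2).unit
  have h0 := congrArg (Polynomial.eval (algebraMap k A 0)) key
  rwa [Polynomial.eval_mul, hΓ', hΓ', hΓ', map_mul, hS, hS, map_zero, add_zero, add_zero] at h0

/-- A common twist makes both line bundles effective, and `grPos_ext` needs only the invertible
series `s - t` with `s ≠ 0`. -/
theorem gr_ext {Λ Λ' : (Submodule A⟦X⟧ A⸨X⸩)ˣ}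
    (h : ∀ f : k⟦X⟧ˣ, grNorm Λ (baseUnit A f) = grNorm Λ' (baseUnit A f)) : Λ = Λ' := by
  obtain ⟨N, hN⟩ := exists_mul_twist_mem Λ
  obtain ⟨N', hN'⟩ := exists_mul_twist_mem Λ'
  have e : ∀ {Λ : (Submodule A⟦X⟧ A⸨X⸩)ˣ} {N : ℕ} (M : ℕ), Λ * (twist A ^ N).1 ∈ grPos A →
      Λ * (twist A ^ (N + M)).1 ∈ grPos A := fun {Λ N} M hN => by
    rw [pow_add]
    change Λ * ((twist A ^ N).1 * (twist A ^ M).1) ∈ _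
    rw [← mul_assoc]
    exact (grPos A).mul_mem hN (twist A ^ M).2
  have h1 := e N' hN
  have h2 := e N hN'
  rw [add_comm N' N] at h2
  have key : (⟨_, h1⟩ : grPos A) = ⟨_, h2⟩ := grPos_ext (k := k) fun s hs => by
    have hu : IsUnit (C s - X : k⟦X⟧) := by
      rw [PowerSeries.isUnit_iff_constantCoeff]
      simpa using hs
    have e2 : (baseUnit A hu.unit : A⟦X⟧) = C (algebraMap k A s) - X := by
      rw [coe_baseUnit, IsUnit.unit_spec, map_sub, PowerSeries.map_C, PowerSeries.map_X]
    rw [← e2, ← grNorm_mul_const_pow, ← grNorm_mul_const_pow, h]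
  exact mul_right_cancel (congrArg Subtype.val key)

/-- A power of the constant coefficient clears denominators and extends the character to `k⟦t⟧`.
Since the constant coefficient is the norm along `t = 0`, it is removed again by the inverse twist.
-/
theorem exists_gr_of_isRegular [Module.Finite k A] (G : k⟦X⟧ˣ →* A)
    (hG : IsRegular (LPlusGm k) G) :
    ∃ Λ : (Submodule A⟦X⟧ A⸨X⸩)ˣ, ∀ f, grNorm Λ (baseUnit A f) = G f := by
  obtain ⟨N, p, hp⟩ := hG.exists_polynomials_unit
  let Γ : k⟦X⟧ → A := fun f => ∑ i, evalCoeffs f (p i) • Module.Free.chooseBasis k A i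
  have hΓ : ∀ f : k⟦X⟧ˣ, Γ f = constantCoeff (f : k⟦X⟧) ^ N • G f := hp
  let G' : k⟦X⟧ →* A :=
    { toFun := Γ
      map_one' := by
        have := hΓ 1
        rwa [Units.val_one, map_one, one_pow, one_smul, map_one] at this
      map_mul' := polynomial_mul_of_units p _ (fun f => rfl) fun f g => by
        rw [← Units.val_mul, hΓ, hΓ, hΓ, map_mul, Units.val_mul, map_mul, mul_pow,
          smul_mul_smul_comm] }
  obtain ⟨Λ, hΛ⟩ := exists_grPos_of_isRegular G' (IsRegular.of_polynomials p _)
  have e : Λ.1 * (twist A ^ N).1⁻¹ * (twist A ^ N).1 = Λ.1 := inv_mul_cancel_right _ _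
  have hN : Λ.1 * (twist A ^ N).1⁻¹ * (twist A ^ N).1 ∈ grPos A := by
    rw [e]
    exact Λ.2
  refine ⟨Λ.1 * (twist A ^ N).1⁻¹, fun f => ?_⟩
  have h1 := grNorm_mul_const_pow hN (baseUnit A f)
  have e2 : (⟨_, hN⟩ : grPos A) = Λ := Subtype.ext e
  rw [e2, constantCoeff_baseUnit, coe_baseUnit, hΛ] at h1
  have h2 : G' f = constantCoeff (f : k⟦X⟧) ^ N • G f := hΓ f
  rw [h2, Algebra.smul_def, mul_comm, map_pow] at h1
  refine (IsUnit.pow N ?_).mul_left_cancel h1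
  exact ((constUnit f).isUnit).map (algebraMap k A)

variable (k) in
theorem isPerfect_grPairing : IsPerfect (grPairing k) where
  inj A _ _ _ h := gr_ext (A := A) (k := k) h
  surj A _ G hG := exists_gr_of_isRegular (A := A) G hG

variable (k) in
theorem isUnit_natCast (A : Type u) [CommRing A] [Algebra k A] (n : ℕ) (hn : n ≠ 0) :
    IsUnit (n : A) := by
  have h : IsUnit (n : k) := isUnit_iff_ne_zero.2 (Nat.cast_ne_zero.2 hn)
  have := h.map (algebraMap k A)
  rwa [map_natCast] at this

variable (k) in
-- The ratio of the two series is `1` modulo `t ^ n`, so `grNorm_eq_one` applies to it.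
theorem grNorm_congr {A : Type u} [CommRing A] [Algebra k A] {n : ℕ}
    {Λ : (Submodule A⟦X⟧ A⸨X⸩)ˣ} (hΛ : Λ ∈ grLe n A) {f g : A⟦X⟧ˣ}
    (h : unitMk n f = unitMk n g) : grNorm Λ f = grNorm Λ g := by
  have h1 : (f : A⟦X⟧) - g ∈ Ideal.span {(X ^ n : A⟦X⟧)} :=
    Ideal.Quotient.eq.1 (congrArg Units.val h)
  obtain ⟨w, hw⟩ := Ideal.mem_span_singleton.1 h1
  have h2 : ((g⁻¹ * f : A⟦X⟧ˣ) : A⟦X⟧) = 1 + X ^ n * (((g⁻¹ : A⟦X⟧ˣ) : A⟦X⟧) * w) := by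
    rw [Units.val_mul, mul_left_comm, ← hw, mul_sub, Units.inv_mul]
    ring
  rw [← mul_inv_cancel_left g f, grNorm_mul_right, grNorm_eq_one (isUnit_natCast k A) hΛ h2,
    mul_one]

theorem unitMk_unitRep_mul {A : Type u} [CommRing A] (n : ℕ) (y z : (Trunc n A)ˣ) :
    unitMk n (unitRep n (y * z)) = unitMk n (unitRep n y * unitRep n z) := by
  rw [map_mul, unitMk_unitRep, unitMk_unitRep, unitMk_unitRep]

variable (k) in
/-- The pairing of `Gr^{≤n}` with `𝔏_n⁺𝔾_m`. -/
def lePairing (n : ℕ) : Pairing (GrLe k n) (LnGm k n) where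
  toFun A Λ y := grNorm (A := A) (Subtype.val Λ) (unitRep (B := A) n y)
  map_map f _ y := (congrArg (grNorm _) (unitRep_map n f.hom.toRingHom y)).trans
    (grNorm_map f.hom.toRingHom _ _)
  one_left _ _ := grNorm_one_left _
  one_right A x := (grNorm_congr (A := A) k x.2 ((unitMk_unitRep n 1).trans
    (map_one _).symm)).trans (grNorm_one_right _)
  mul_left _ _ _ _ := grNorm_mul_left _ _ _
  mul_right A x y z := (grNorm_congr (A := A) k x.2 (unitMk_unitRep_mul n y z)).trans
    (grNorm_mul_right _ _ _)

theorem lePairing_mk {n : ℕ} (A : CommAlgCat.{u} k) (Λ : grLe n A) (f : A⟦X⟧ˣ) :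
    (lePairing k n).toFun A Λ (unitMk n f) = grNorm Λ.1 f :=
  grNorm_congr (A := A) k Λ.2 (unitMk_unitRep n _)

/-- The linear coefficient serves to extract power sums from norms of the series `1 + s t ^ j`. -/
theorem coeff_one_prod {B : Type*} [CommRing B] (l : List B) :
    ((l.map fun a => 1 + Polynomial.C a * Polynomial.X).prod).coeff 0 = 1 ∧
      ((l.map fun a => 1 + Polynomial.C a * Polynomial.X).prod).coeff 1 = l.sum := by
  induction l with
  | nil => simp [Polynomial.coeff_one]
  | cons a l ih =>
    rw [List.map_cons, List.prod_cons, add_mul, one_mul, mul_right_comm, Polynomial.coeff_add,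
      Polynomial.coeff_add, Polynomial.coeff_mul_X, Polynomial.coeff_C_mul,
      Polynomial.mul_coeff_zero, ih.1, ih.2]
    simp [add_comm]

/-- A line bundle that pairs trivially with the series `1 + s t ^ j` for `j ≥ n` is a point
of `Gr^{≤n}`. -/
theorem mem_grLe_of_grNorm {n : ℕ} (hn : n ≠ 0) {Λ : (Submodule A⟦X⟧ A⸨X⸩)ˣ}
    (h : ∀ j ≥ n, ∀ (s : k) (f : k⟦X⟧ˣ), (f : k⟦X⟧) = 1 + C s * X ^ j →
      grNorm Λ (baseUnit A f) = 1) : Λ ∈ grLe n A := by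
  refine ⟨fun h => absurd h hn, fun x hx => mem_of_baseChange Λ _ fun a ha => ?_⟩
  obtain ⟨N, hN⟩ := exists_mul_twist_mem Λ
  obtain ⟨B, _, φ, h0, ⟨l, hl⟩, -⟩ := exists_isSplit ⟨_, hN⟩ ⟨_, hN⟩ ha
  obtain ⟨h', e⟩ := map_mul_twist_mem φ hN
  let _ : Algebra k B := (φ.comp (algebraMap k A)).toAlgebra
  have hps : PowerSumsVanish n l := fun j hj => by
    have hj0 : j ≠ 0 := by omega
    -- The norm of `1 + s t ^ j` is `∏ (1 + s τ_i ^ j)`, which equals `1` for all `s` in `k`, hence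
    -- as a polynomial in `s`; its linear coefficient is the power sum.
    have hP : ((l.map fun τ => τ ^ j).map fun a => 1 + Polynomial.C a * Polynomial.X).prod =
        (1 : Polynomial B) := polynomial_eq (k := k) fun s => by
      have hc : constantCoeff (1 + C s * X ^ j : k⟦X⟧) = 1 := by simp [hj0]
      have hu : IsUnit (1 + C s * X ^ j : k⟦X⟧) := by
        rw [PowerSeries.isUnit_iff_constantCoeff, hc]
        exact isUnit_one
      have h1 := grNorm_mul_const_pow hN (baseUnit A hu.unit)
      rw [h j hj s hu.unit rfl, constantCoeff_baseUnit, IsUnit.unit_spec, hc, map_one, one_pow,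
        one_mul, coe_baseUnit, IsUnit.unit_spec] at h1
      have h2 := congrArg φ h1
      rw [← latticeNorm_map, hl.latticeNorm_eq, map_one] at h2
      rw [Polynomial.eval_one, h2, ← Polynomial.coe_evalRingHom, map_list_prod, List.map_map,
        List.map_map]
      congr 1
      refine List.map_congr_left fun τ hτ => ?_
      have hτ' := hl.nilpotent τ hτ
      simp only [map_add, map_mul, map_one, map_pow, PowerSeries.map_C, PowerSeries.map_X,
        Function.comp_apply, Polynomial.coe_evalRingHom, Polynomial.eval_add, Polynomial.eval_one,
        Polynomial.eval_mul, Polynomial.eval_pow, Polynomial.eval_C, Polynomial.eval_X]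
      rw [ev_add, ev_one hτ', ev_mul hτ', ev_C hτ', ev_pow hτ', ev_X hτ', mul_comm]
      rfl
    have h3 := (coeff_one_prod (l.map fun τ => τ ^ j)).2
    rw [hP, Polynomial.coeff_one, if_neg one_ne_zero] at h3
    exact h3.symm
  refine ⟨B, inferInstance, φ, h0, ?_⟩
  rw [← e] at hl
  have := ((mem_grLe_iff hn hl).2 hps).2 _ (mem_baseChange φ hx)
  rwa [mapLaurent_smul, mapLaurent_derivative, map_pow, PowerSeries.map_X]

/-- The character of `k⟦t⟧ˣ` induced by `G` comes from a point of `Gr`. It is trivial on `1 + s t ^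
j` for `j ≥ n`, which for `n ≠ 0` forces that point into `Gr^{≤n}`. -/
theorem exists_grLe_of_isRegular [Module.Finite k A] {n : ℕ} (G : (Trunc n k)ˣ →* A)
    (hG : IsRegular (LnGm k n) G) :
    ∃ Λ : grLe n A, ∀ f : k⟦X⟧ˣ, grNorm Λ.1 (baseUnit A f) = G (unitMk n f) := by
  have hG' : IsRegular (LPlusGm k) fun f : k⟦X⟧ˣ => G (unitMk n f) :=
    IsRegular.comp (Y := LPlusGm k) (Z := LnGm k n) (G := G) hG (fun B f => unitMk (B := B) n f)
      fun _ _ _ _ => Units.ext rfl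
  obtain ⟨Λ, hΛ⟩ := exists_gr_of_isRegular (G.comp (unitMk n)) hG'
  have hmem : Λ ∈ grLe n A := by
    by_cases hn : n = 0
    -- For `n = 0` the whole character is trivial, and so is the line bundle by uniqueness.
    · have e : Λ = 1 := gr_ext (k := k) fun f => by
        rw [hΛ, grNorm_one_left]
        subst hn
        have : unitMk 0 f = 1 := Units.ext (subsingleton_trunc_zero.elim _ _)
        rw [MonoidHom.comp_apply, this, map_one]
      rw [e]
      exact (grLe n A).one_mem
    · refine mem_grLe_of_grNorm (k := k) hn fun j hj s f hf => ?_
      have : unitMk n f = 1 := Units.ext (by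
        change Ideal.Quotient.mk _ (f : k⟦X⟧) = Ideal.Quotient.mk _ 1
        rw [mk_trunc_eq]
        intro i hi
        rw [hf, map_add, PowerSeries.coeff_C_mul, PowerSeries.coeff_X_pow, if_neg (by omega),
          mul_zero, add_zero])
      rw [hΛ, MonoidHom.comp_apply, this, map_one]
  exact ⟨⟨Λ, hmem⟩, hΛ⟩

variable (k) in
theorem isPerfect_lePairing (n : ℕ) : IsPerfect (lePairing k n) where
  inj A _ Λ Λ' h := Subtype.ext (gr_ext (A := A) (k := k) fun f =>
    (lePairing_mk A Λ (baseUnit A f)).symm.trans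
      ((h (unitMk n f)).trans (lePairing_mk A Λ' (baseUnit A f))))
  surj A hA G hG := by
    obtain ⟨Λ, hΛ⟩ := exists_grLe_of_isRegular (A := A) (k := k) G hG
    refine ⟨Λ, fun y => ?_⟩
    have h := (lePairing_mk A Λ (baseUnit A (unitRep n y))).trans (hΛ (unitRep (B := k) n y))
    refine Eq.trans ?_ (h.trans (congrArg G (unitMk_unitRep (B := k) n y)))
    refine congrArg ((lePairing k n).toFun A Λ) ?_
    have e := congrArg ((LnGm k n).map (toAlg A)) (unitMk_unitRep (B := k) n y)
    exact e.symm.trans (Units.ext rfl)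

end Units

end
end LogCC

theorem proposition3p9 (k : Type u) [Field k] [CharZero k] :
    -- the pairing of `Gr^pos` with `𝔏⁺𝔸¹`, given by norms
    ∃ π_pos : LogCC.Pairing (LogCC.GrPos k) (LogCC.LPlusA1 k),
      (∀ (A : CommAlgCat.{u} k) (Λ : LogCC.grPos A) (f : A⟦X⟧),
        π_pos.toFun A Λ f = LogCC.divisorNorm (LogCC.latticeDivisor Λ) f) ∧
      LogCC.IsDuality π_pos ∧
    -- its extension to a pairing of `Gr` with `𝔏⁺𝔾_m`
    ∃ π_gr : LogCC.Pairing (LogCC.Gr k) (LogCC.LPlusGm k),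
      (∀ (A : CommAlgCat.{u} k) (Λ : LogCC.grPos A) (f : A⟦X⟧ˣ),
        π_gr.toFun A (Λ : (Submodule A⟦X⟧ A⸨X⸩)ˣ) f = π_pos.toFun A Λ (f : A⟦X⟧)) ∧
      LogCC.IsDuality π_gr ∧
    ∀ n : ℕ,
      -- the pairing of `Gr^{pos,≤n}` with `𝔏_n⁺𝔸¹`
      (∃ π : LogCC.Pairing (LogCC.GrPosLe k n) (LogCC.LnA1 k n),
        (∀ (A : CommAlgCat.{u} k) (D : LogCC.SymPoint k (LogCC.Trunc n k) A) (f : A⟦X⟧),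
          π.toFun A D (Ideal.Quotient.mk (Ideal.span {(X ^ n : A⟦X⟧)}) f) =
            LogCC.divisorNorm (LogCC.symDivisor D) f) ∧
        LogCC.IsDuality π) ∧
      -- the pairing of `Gr^{≤n}` with `𝔏_n⁺𝔾_m`
      (∃ π : LogCC.Pairing (LogCC.GrLe k n) (LogCC.LnGm k n),
        (∀ (A : CommAlgCat.{u} k) (Λ : LogCC.grLe n A) (f : A⟦X⟧ˣ),
          π.toFun A Λ (Units.map
              (Ideal.Quotient.mk (Ideal.span {(X ^ n : A⟦X⟧)})).toMonoidHom f) =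
            π_gr.toFun A (Λ : (Submodule A⟦X⟧ A⸨X⸩)ˣ) f) ∧
        LogCC.IsDuality π) :=
  ⟨LogCC.posPairing k, fun _ _ _ => rfl,
    LogCC.isPerfect_posPairing.isDuality LogCC.hasCoproduct_LPlusA1,
    LogCC.grPairing k, fun _ Λ f => LogCC.grNorm_coe Λ f,
    (LogCC.isPerfect_grPairing k).isDuality LogCC.hasCoproduct_LPlusGm,
    fun n => ⟨⟨LogCC.symPairing k n, fun _ D f => LogCC.symNorm_mk D f,
        (LogCC.isPerfect_symPairing n).isDuality (LogCC.hasCoproduct_LnA1 n)⟩,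
      ⟨LogCC.lePairing k n, fun A Λ f => LogCC.lePairing_mk A Λ f,
        (LogCC.isPerfect_lePairing k n).isDuality (LogCC.hasCoproduct_LnGm n)⟩⟩⟩
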